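/- **Setting.** There are $n$ balls and $n$ bins. Let $\log=\log_2$, let $\log^* n$ be the least $k\ge 0$ such that the tower $2^{2^{\cdot^{\cdot^{2}}}}$ of $k$ twos is at least $n$, and put $k(1)=1$ and $k(i+1)=\min\{k(i)\,e^{\lfloor k(i)\rfloor/5},\sqrt{\log n}\}$. The algorithm $\mathcal A_b$ executes rounds $i=1,2,\dots$, each consisting of three steps: (1) every ball not yet placed sends $\lfloor k(i)\rfloor$ requests to bins chosen uniformly and independently at random (all choices of all balls and rounds being independent); (2) every bin that received requests in this round permits one of them, chosen arbitrarily, and declines all others, thus answering every request; (3) every ball that received at least one permission chooses an arbitrary one of the respective bins, informs it, is placed into it and terminates. The arbitrary choices are made by an adversary that knows everything that happened so far, but not the future random choices. In the asynchronous version every message of a ball carries the round counter of the ball, and messages are delivered one at a time in an order determined by an adversary, who knows everything that happened so far but not the future random choices, and who has to deliver some message as long as there are undelivered ones. A bin permits a request immediately if it has not yet permitted a request with the same round counter, and declines it immediately otherwise. An unplaced ball that receives a permission is immediately placed into the respective bin and informs it; a ball all of whose requests with its current counter have been declined increments its counter and sends the requests of the next round. Here, "round $i$" refers to the messages with round counter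 $i$, and the number of rounds is the largest round counter in use. An event (depending on $n$) holds *w.h.p.* if for every constant $c>0$ it has probability at least $1-1/n^c$ for all sufficiently large $n$, where constants hidden in $\mathcal O(\cdot)$-terms of the event may depend on $c$. All bounds below are uniform over the adversaries. **Theorem.** Both for the synchronous and for the asynchronous version of $\mathcal A_b$ the following holds. * Every ball is always eventually placed into exactly one bin. * The algorithm terminates after at most $\log^* n+\mathcal O(1)$ rounds w.h.p. * In the end every bin contains at most $\log^* n+\mathcal O(1)$ balls w.h.p. * W.h.p., in each of the three steps of each round at most $n$ messages are sent in total (in particular, at most $n$ requests per round). The total number of messages (requests, answers and notifications of bins) sent in all rounds is $\mathcal O(n)$ w.h.p. * Each ball sends and receives $\mathcal O(1)$ messages in expectation, and w.h.p. every ball sends and receives $\mathcal O(\sqrt{\log n})$ messages. * Each bin sends and receives $\mathcal O(1)$ messages in expectation, and w.h.p. every bin sends and receives $\mathcal O(\log n/\log\log n)$ messages. * For each ball, the maximum number of bits of the round counters in the messages it sends is $\mathcal O(1)$ in expectation; w.h.p. the round counters in all messages of balls have $\mathcal O(\log\log^* n)$ bits. -/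

import Mathlib

open MeasureTheory Filter
open scoped ENNReal

namespace BallsIntoBins

/-! ### Numerical functions -/

/-- Tetration with base two: `tower k = 2 ^ 2 ^ ⋯ ^ 2` with `k` twos. -/
def tower : ℕ → ℕ
  | 0 => 1
  | k + 1 => 2 ^ tower k

/-- `log* n`: the smallest `k` such that the tower of `k` twos is at least `n`. -/
noncomputable def logStar (n : ℕ) : ℕ := sInf {k : ℕ | n ≤ tower k}

/-- The sequence `k(1) = 1`, `k(i + 1) = min {k(i) e ^ (⌊k(i)⌋ / 5), √(log n)}`, with the binary
logarithm. Rounds are numbered from `1`; the value at `0` is not used. -/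
noncomputable def kSeq (n : ℕ) : ℕ → ℝ
  | 0 => 0
  | 1 => 1
  | i + 2 => min (kSeq n (i + 1) * Real.exp ((⌊kSeq n (i + 1)⌋₊ : ℝ) / 5)) √(Real.logb 2 n)

/-- The number `⌊k(i)⌋` of requests which a ball that is not yet placed sends in round `i`. -/
noncomputable def numRequests (n i : ℕ) : ℕ := ⌊kSeq n i⌋₊

/-! ### Messages

There are `n` balls and `n` bins, both indexed by `Fin n`. Every message is exchanged between one
ball and one bin. -/

/-- The messages of the algorithm.
* `request j i l b`: ball `j` asks bin `b` for permission, as its `l`-th request of round `i`;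
* `answer j i l b g`: bin `b` answers this request; it permits it if `g = true` and declines it
  if `g = false`;
* `inform j i b`: in round `i`, ball `j` informs bin `b` that it is placed into `b`. -/
inductive Msg (n : ℕ) where
  | request (j : Fin n) (i l : ℕ) (b : Fin n)
  | answer (j : Fin n) (i l : ℕ) (b : Fin n) (g : Bool)
  | inform (j : Fin n) (i : ℕ) (b : Fin n)

namespace Msg

variable {n : ℕ}

/-- The ball that sends or receives the message. -/
def ball : Msg n → Fin n
  | request j _ _ _ => j
  | answer j _ _ _ _ => j
  | inform j _ _ => j

/-- The bin that sends or receives the message. -/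
def bin : Msg n → Fin n
  | request _ _ _ b => b
  | answer _ _ _ b _ => b
  | inform _ _ b => b

/-- The round (in asynchronous executions: the round counter) to which the message belongs. -/
def round : Msg n → ℕ
  | request _ i _ _ => i
  | answer _ i _ _ _ => i
  | inform _ i _ => i

/-- The step of a round in which the message is sent. Messages of the steps `1` and `3` are sent
by balls, messages of step `2` are sent by bins. -/
def step : Msg n → ℕ
  | request _ _ _ _ => 1
  | answer _ _ _ _ _ => 2
  | inform _ _ _ => 3

end Msg

/-- Ball `j` has chosen a bin (and thus has terminated) when the messages in `M` have been sent. -/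
def Placed {n : ℕ} (M : Set (Msg n)) (j : Fin n) : Prop := ∃ i b, Msg.inform j i b ∈ M

/-! ### Random choices -/

/-- The random choices of the balls: at `(i, j, l)` the bin which ball `j` contacts by its `l`-th
request of round `i`, if it sends this request at all. -/
abbrev Tape (n : ℕ) : Type := ℕ × Fin n × ℕ → Fin n

/-- All random choices are uniform and independent. -/
noncomputable def tapeLaw (n : ℕ) : Measure (Tape n) :=
  Measure.infinitePi fun _ : ℕ × Fin n × ℕ => ProbabilityTheory.uniformOn (Set.univ : Set (Fin n))

/-- The requests which ball `j` sends in round `i`. -/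
def newRequests {n : ℕ} (ω : Tape n) (i : ℕ) (j : Fin n) : Set (Msg n) :=
  {m | ∃ l < numRequests n i, m = Msg.request j i l (ω (i, j, l))}

/-! ### Synchronous executions -/

/-- The choices that the algorithm leaves open. They are arbitrary, and may depend on all messages
`M` sent so far (the messages carry their round, so `M` determines the whole history).
* In round `i`, bin `b` permits the request number `(permit M i b).2` of ball `(permit M i b).1`,
  which has to be one of the requests that `b` has received in this round, if there are any.
* In round `i`, ball `j` is placed into the bin `pick M i j`, which has to be one of the bins whose
  permission `j` has received in this round, if there are any. -/
structure SyncRule (n : ℕ) where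
  permit : Set (Msg n) → ℕ → Fin n → Fin n × ℕ
  permit_mem : ∀ M i b, (∃ j l, Msg.request j i l b ∈ M) →
    Msg.request (permit M i b).1 i (permit M i b).2 b ∈ M
  pick : Set (Msg n) → ℕ → Fin n → Fin n
  pick_mem : ∀ M i j, (∃ l b, Msg.answer j i l b true ∈ M) →
    ∃ l, Msg.answer j i l (pick M i j) true ∈ M

namespace SyncRule

variable {n : ℕ}

/-- Step 1 of round `i`: all balls that are not yet placed send their requests.
Here and below, `M` is the set of all messages sent before the step, and the result is the set of
all messages sent before or in the step. -/
def requestStep (ω : Tape n) (i : ℕ) (M : Set (Msg n)) : Set (Msg n) :=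
  M ∪ {m | ∃ j, ¬ Placed M j ∧ m ∈ newRequests ω i j}

/-- Step 2 of round `i`: every bin answers all requests of this round; it permits one of them and
declines all others. -/
def answerStep (r : SyncRule n) (i : ℕ) (M : Set (Msg n)) : Set (Msg n) :=
  M ∪ {m | ∃ j l b, Msg.request j i l b ∈ M ∧
    m = Msg.answer j i l b (decide (r.permit M i b = (j, l)))}

/-- Step 3 of round `i`: every ball that got a permission in this round informs the bin it
chooses. -/
def informStep (r : SyncRule n) (i : ℕ) (M : Set (Msg n)) : Set (Msg n) :=
  M ∪ {m | ∃ j, (∃ l b, Msg.answer j i l b true ∈ M) ∧ m = Msg.inform j i (r.pick M i j)}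

/-- The messages sent in the first `i` rounds. -/
def sent (r : SyncRule n) (ω : Tape n) : ℕ → Set (Msg n)
  | 0 => ∅
  | i + 1 => r.informStep (i + 1) (r.answerStep (i + 1) (requestStep ω (i + 1) (r.sent ω i)))

end SyncRule

/-- The synchronous executions of the algorithm, one for each rule resolving the open choices; an
execution is given by the set of all messages sent, as a function of the random choices. -/
def syncExecutions (n : ℕ) : Set (Tape n → Set (Msg n)) :=
  {X | ∃ r : SyncRule n, X = fun ω => ⋃ i, r.sent ω i}

/-! ### Asynchronous executions

Messages are delivered one by one, in an arbitrary order. A ball or bin reacts to a message at the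
moment when the message is delivered to it. -/

/-- State of an asynchronous execution: the set of messages sent so far, and the list of messages
delivered so far, the most recent one first. -/
structure AsyncState (n : ℕ) where
  sent : Set (Msg n)
  delivered : List (Msg n)

/-- The adversary that controls the message delays: it decides which message in transit is delivered
next. It may use everything that has happened so far (including the random choices already made,
which are visible in the messages sent), and it has to deliver some message as long as any message
is in transit. -/
structure Scheduler (n : ℕ) where
  next : AsyncState n → Msg n
  next_mem : ∀ s, (∃ m ∈ s.sent, m ∉ s.delivered) → next s ∈ s.sent ∧ next s ∉ s.delivered

open Classical in
/-- The messages that are sent in reaction to the delivery of a message. The state `s` is the one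
right after the delivery, before the reaction.
* A bin permits a request immediately if it has not yet permitted a request with the same round
  counter, and otherwise declines it immediately.
* A ball that receives a permission and is not yet placed is placed into the respective bin
  immediately, and informs this bin. A ball that is already placed ignores permissions.
* When all requests of a ball with the current round counter have been declined, the ball proceeds
  to the next round and sends new requests.
* A bin needs not react to a ball being placed into it. -/
noncomputable def reaction {n : ℕ} (ω : Tape n) (s : AsyncState n) : Msg n → Set (Msg n)
  | .request j i l b =>
      {Msg.answer j i l b (decide (¬ ∃ j' l', Msg.answer j' i l' b true ∈ s.sent))}
  | .answer j i _ b true => {m | ¬ Placed s.sent j ∧ m = Msg.inform j i b}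
  | .answer j i _ _ false =>
      {m | (∀ l < numRequests n i, ∃ b, Msg.answer j i l b false ∈ s.delivered) ∧
        m ∈ newRequests ω (i + 1) j}
  | .inform _ _ _ => ∅

namespace Scheduler

variable {n : ℕ}

open Classical in
/-- One step of an asynchronous execution: the next message is delivered and the receiver reacts.
Nothing happens if no message is in transit. -/
noncomputable def step (σ : Scheduler n) (ω : Tape n) (s : AsyncState n) : AsyncState n :=
  if ∃ m ∈ s.sent, m ∉ s.delivered then
    { sent := s.sent ∪ reaction ω ⟨s.sent, σ.next s :: s.delivered⟩ (σ.next s)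
      delivered := σ.next s :: s.delivered }
  else s

/-- The state after `t` steps. Initially, all balls send their requests of the first round. -/
noncomputable def state (σ : Scheduler n) (ω : Tape n) : ℕ → AsyncState n
  | 0 => ⟨{m | ∃ j, m ∈ newRequests ω 1 j}, []⟩
  | t + 1 => σ.step ω (σ.state ω t)

end Scheduler

/-- The asynchronous executions of the algorithm, one for each scheduler. -/
def asyncExecutions (n : ℕ) : Set (Tape n → Set (Msg n)) :=
  {X | ∃ σ : Scheduler n, X = fun ω => ⋃ t, (σ.state ω t).sent}

/-! ### Quantities of an execution with set of messages `M` -/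

section Quantities

variable {n : ℕ}

/-- The number of messages in a set of messages. -/
noncomputable def count (M : Set (Msg n)) : ℝ≥0∞ := (M.encard : ℝ≥0∞)

/-- The number of rounds until no ball or bin sends messages any more. -/
noncomputable def numRounds (M : Set (Msg n)) : ℕ∞ := ⨆ m ∈ M, (m.round : ℕ∞)

/-- The number of balls placed into bin `b`. -/
noncomputable def load (M : Set (Msg n)) (b : Fin n) : ℕ∞ :=
  {j : Fin n | ∃ i, Msg.inform j i b ∈ M}.encard

/-- The messages sent or received by ball `j`. -/
def ballMsgs (M : Set (Msg n)) (j : Fin n) : Set (Msg n) := {m ∈ M | m.ball = j}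

/-- The messages sent or received by bin `b`. -/
def binMsgs (M : Set (Msg n)) (b : Fin n) : Set (Msg n) := {m ∈ M | m.bin = b}

/-- The messages sent by ball `j`. -/
def sentByBall (M : Set (Msg n)) (j : Fin n) : Set (Msg n) := {m ∈ ballMsgs M j | m.step ≠ 2}

/-- The largest number of bits of a round counter in the messages of `M`. -/
noncomputable def counterBits (M : Set (Msg n)) : ℝ≥0∞ := ⨆ m ∈ M, (Nat.size m.round : ℝ≥0∞)

end Quantities

end BallsIntoBins

/-!
# Parallel placement of balls into bins by adaptive requests

The difficulty is the adversary: its choices depend on the past, and hence on the random bins, so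
that the set of balls that take part in a round, and the order in which they enter it, are
correlated with these bins. The proof removes the adversary by a deterministic comparison.

*Entry processes.* Of a (synchronous or asynchronous) execution only two facts are used. First,
which balls have entered which rounds at time `t + 1` is a function of the bins contacted by the
entries up to time `t`. Second, if a ball remains unplaced in a round, then every bin it has
contacted in this round has permitted a request of another ball, which is placed and so does not
enter the next round. These are the axioms of `EntryProcess`; `exists_isTranscript` shows that both
kinds of executions are instances. The second fact also shows that at least one ball is placed in
every round, so there are at most `n` rounds and finitely many messages. In an asynchronous
execution, therefore, every message is delivered, and every ball is placed.

*Rearrangement.* Write the bins contacted by the balls of round `i` into row `i` of a table, in the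
order in which the balls enter the round. When a ball enters a round, the past determines its place
in the table, so the original random choices can be recovered from the table. On finite tables, an
injective rearrangement is a bijection, and hence the table is uniformly distributed, whatever the
adversary does (`EntryProcess.tapeLaw_slots`). This remains true if one particular ball is always
put first.

*One round.* Let `m` balls take part in round `i`, each of which sends `K = ⌊k(i)⌋` requests. They
occupy the first blocks of row `i`. A ball that remains unplaced has a covered block: each of its
`K` entries occurs in another one of these blocks. A given block is covered with probability at
most `(m K / n) ^ K`, and a change of one entry changes the number of covered blocks by at most two.
By McDiarmid's inequality, the number of unplaced balls is thus at most
`m (m K / n) ^ K + n ^ (3 / 4)`, except with probability `exp (-√n / 8)`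
(`prob_lt_coveredCount_le`).

*All rounds.* In terms of the ratio `x(i)` of `m k(i)` to `n`, and up to a small error, this reads
`x(i + 1) ≤ (e ^ (1 / 5) x(i)) ^ K x(i)`. In the first round more than `2 n / 5` bins are reached, so
`x(2) < e ^ (-1 / 5)`, and from then on `x` decays geometrically while `k` grows like a tower
function. After `log* n + O(1)` rounds, `k` has reached its maximum `√(log n)`. Three such rounds
reduce the fraction of unplaced balls to `exp (-Ω(√(log n)))`, to a power of `1 / n`, and to `0`,
with high probability. So a typical execution has at most `capRound n + 2` rounds, and the numbers
of balls in them are bounded by `ballBound` (`EntryProcess.Good.le_of_active`,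
`EntryProcess.Good.card_active_le`).

*Messages.* Every request causes at most three messages, so it suffices to count requests
(`IsTranscript.count_le`). The numbers of requests per round and in total, and those of a ball, are
sums of the above bounds. For the expectations, a given ball is put first in its row: it takes part
in round `i + 1` with probability at most `x(i) ^ K`, up to the probability that the execution is
atypical, and this outweighs the growth of `k`. The requests to a given bin are among the
`O(n)` entries of the table that are used, so their expected number is bounded, and it exceeds
`O(log n / log log n)` with small probability by the union bound over sets of entries. A bin permits
at most one request per round, so the bound on the number of rounds bounds the load as well.
-/

namespace BallsIntoBins

/-! ### Entry processes -/

/-- The part of an execution that matters for the probabilistic analysis: which ball has entered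
which round at which time. `entered ω t i j` says that, on the tape `ω`, ball `j` has sent its
requests of round `i` by time `t`. The adversary is hidden in the fact that this relation is
arbitrary, except that the entries up to time `t + 1` are a function of the bins contacted in the
entries up to time `t` (fields `zero` and `succ`). The field `collide` is the only trace of the
permissions: every bin contacted in round `i` by a ball that is not placed in this round has
permitted a request of another ball, which does not take part in round `i + 1`. -/
structure EntryProcess (n : ℕ) where
  entered : Tape n → ℕ → ℕ → Fin n → Prop
  mono : ∀ {ω t t' i j}, t ≤ t' → entered ω t i j → entered ω t' i j
  zero : ∀ {ω ω' i j}, entered ω 0 i j → entered ω' 0 i j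
  succ : ∀ {ω ω' t}, (∀ i j l, entered ω t i j → l < numRequests n i → ω (i, j, l) = ω' (i, j, l)) →
    ∀ {i j}, entered ω (t + 1) i j → entered ω' (t + 1) i j
  one_le : ∀ {ω t i j}, entered ω t i j → 1 ≤ i
  first : ∀ ω j, ∃ t, entered ω t 1 j
  pred : ∀ {ω i j}, 1 ≤ i → (∃ t, entered ω t (i + 1) j) → ∃ t, entered ω t i j
  collide : ∀ {ω i j l}, 1 ≤ i → (∃ t, entered ω t (i + 1) j) → l < numRequests n i →
    ∃ j' l', (∃ t, entered ω t i j') ∧ l' < numRequests n i ∧ ω (i, j', l') = ω (i, j, l) ∧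
      ¬ ∃ t, entered ω t (i + 1) j'

/-- Ball `j` takes part in round `i`. -/
def EntryProcess.Active {n : ℕ} (D : EntryProcess n) (ω : Tape n) (i : ℕ) (j : Fin n) : Prop :=
  ∃ t, D.entered ω t i j

/-- The sets of messages `X ω` obey the rules of the algorithm, with the balls that take part in
the rounds given by `D`. -/
structure IsTranscript {n : ℕ} (D : EntryProcess n) (X : Tape n → Set (Msg n)) : Prop where
  request : ∀ {ω j i l b}, Msg.request j i l b ∈ X ω →
    D.Active ω i j ∧ l < numRequests n i ∧ b = ω (i, j, l)
  answer : ∀ {ω j i l b g}, Msg.answer j i l b g ∈ X ω → Msg.request j i l b ∈ X ω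
  answer_unique : ∀ {ω j i l b g g'}, Msg.answer j i l b g ∈ X ω → Msg.answer j i l b g' ∈ X ω →
    g = g'
  permit_unique : ∀ {ω j j' i l l' b}, Msg.answer j i l b true ∈ X ω →
    Msg.answer j' i l' b true ∈ X ω → j = j'
  inform : ∀ {ω j i b}, Msg.inform j i b ∈ X ω → ∃ l, Msg.answer j i l b true ∈ X ω
  inform_unique : ∀ {ω j i i' b b'}, Msg.inform j i b ∈ X ω → Msg.inform j i' b' ∈ X ω →
    i = i' ∧ b = b'

lemma numRequests_one (n : ℕ) : numRequests n 1 = 1 := by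
  simp [numRequests, kSeq]

/-! ### Synchronous executions -/

namespace SyncRule

variable {n : ℕ} (r : SyncRule n) (ω : Tape n)

lemma sent_mono : Monotone (r.sent ω) :=
  monotone_nat_of_le_succ fun i => by
    simp only [sent, informStep, answerStep, requestStep]
    intro m hm
    exact Or.inl (Or.inl (Or.inl hm))

/-- The messages sent before step 2 of round `i + 1`. -/
def preAnswer (i : ℕ) : Set (Msg n) := requestStep ω (i + 1) (r.sent ω i)

/-- The messages sent before step 3 of round `i + 1`. -/
def preInform (i : ℕ) : Set (Msg n) := r.answerStep (i + 1) (r.preAnswer ω i)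

lemma sent_succ (i : ℕ) : r.sent ω (i + 1) = r.informStep (i + 1) (r.preInform ω i) := rfl

lemma round_bounds {i : ℕ} {m : Msg n} (hm : m ∈ r.sent ω i) : 1 ≤ m.round ∧ m.round ≤ i := by
  induction i with
  | zero => simp [sent] at hm
  | succ i ih =>
    simp only [sent, informStep, answerStep, requestStep, newRequests, Set.mem_union,
      Set.mem_ofPred_eq] at hm
    rcases hm with ((hm | ⟨j, -, l, -, rfl⟩) | ⟨j, l, b, -, rfl⟩) | ⟨j, -, rfl⟩
    · have := ih hm; omega
    all_goals simp [Msg.round]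

lemma mem_preAnswer_request {i l : ℕ} {j b : Fin n} :
    Msg.request j (i + 1) l b ∈ r.preAnswer ω i ↔
      ¬ Placed (r.sent ω i) j ∧ l < numRequests n (i + 1) ∧ b = ω (i + 1, j, l) := by
  simp only [preAnswer, requestStep, newRequests, Set.mem_union, Set.mem_ofPred_eq,
    Msg.request.injEq]
  constructor
  · rintro (h | ⟨j', hj', l', hl', rfl, -, rfl, rfl⟩)
    · have := (r.round_bounds ω h).2
      simp [Msg.round] at this
    · exact ⟨hj', hl', rfl⟩
  · rintro ⟨h1, h2, rfl⟩
    exact Or.inr ⟨j, h1, l, h2, rfl, trivial, rfl, rfl⟩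

lemma mem_preInform_answer {i l : ℕ} {j b : Fin n} {g : Bool} :
    Msg.answer j (i + 1) l b g ∈ r.preInform ω i ↔
      Msg.request j (i + 1) l b ∈ r.preAnswer ω i ∧
        g = decide (r.permit (r.preAnswer ω i) (i + 1) b = (j, l)) := by
  simp only [preInform, answerStep, Set.mem_union, Set.mem_ofPred_eq, Msg.answer.injEq]
  constructor
  · rintro (h | ⟨j', l', b', h, rfl, -, rfl, rfl, rfl⟩)
    · simp only [preAnswer, requestStep, newRequests, Set.mem_union, Set.mem_ofPred_eq] at h
      rcases h with h | ⟨_, _, _, _, h⟩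
      · have := (r.round_bounds ω h).2
        simp [Msg.round] at this
      · cases h
    · exact ⟨h, rfl⟩
  · rintro ⟨h, rfl⟩
    exact Or.inr ⟨j, l, b, h, rfl, trivial, rfl, rfl, rfl⟩

lemma mem_sent_succ_inform {i : ℕ} {j b : Fin n} :
    Msg.inform j (i + 1) b ∈ r.sent ω (i + 1) ↔
      (∃ l b, Msg.answer j (i + 1) l b true ∈ r.preInform ω i) ∧
        b = r.pick (r.preInform ω i) (i + 1) j := by
  rw [sent_succ]
  simp only [informStep, Set.mem_union, Set.mem_ofPred_eq, Msg.inform.injEq]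
  constructor
  · rintro (h | ⟨j', h, rfl, -, rfl⟩)
    · simp only [preInform, preAnswer, answerStep, requestStep, newRequests, Set.mem_union,
        Set.mem_ofPred_eq] at h
      rcases h with (h | ⟨_, _, _, _, h⟩) | ⟨_, _, _, _, h⟩
      · have := (r.round_bounds ω h).2
        simp [Msg.round] at this
      · cases h
      · cases h
    · exact ⟨h, rfl⟩
  · rintro ⟨h, rfl⟩
    exact Or.inr ⟨j, h, rfl, trivial, rfl⟩

lemma preAnswer_subset (i : ℕ) : r.preAnswer ω i ⊆ r.preInform ω i := Set.subset_union_left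

lemma preInform_subset (i : ℕ) : r.preInform ω i ⊆ r.sent ω (i + 1) := Set.subset_union_left

/-- All messages of round `i + 1` are sent by the end of round `i + 1`, never later. -/
lemma mem_sent_round {i : ℕ} {m : Msg n} (hm : m ∈ ⋃ s, r.sent ω s) (hi : m.round = i + 1) :
    m ∈ r.sent ω (i + 1) := by
  obtain ⟨s, hs⟩ := Set.mem_iUnion.1 hm
  induction s with
  | zero => simp [sent] at hs
  | succ s ih =>
    rcases lt_trichotomy s i with h | rfl | h
    · exact r.sent_mono ω (by omega) hs
    · exact hs
    · apply ih
      simp only [sent, informStep, answerStep, requestStep, newRequests, Set.mem_union,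
        Set.mem_ofPred_eq] at hs
      rcases hs with ((hm | ⟨j, -, l, -, rfl⟩) | ⟨j, l, b, -, rfl⟩) | ⟨j, -, rfl⟩
      · exact hm
      all_goals simp only [Msg.round] at hi; omega

lemma mem_iUnion_request {i l : ℕ} {j b : Fin n} :
    Msg.request j i l b ∈ ⋃ s, r.sent ω s ↔
      1 ≤ i ∧ Msg.request j i l b ∈ r.preAnswer ω (i - 1) := by
  constructor
  · intro h
    obtain ⟨s, hs⟩ := Set.mem_iUnion.1 h
    have h1 : 1 ≤ i := (r.round_bounds ω hs).1
    obtain ⟨i, rfl⟩ : ∃ i', i = i' + 1 := ⟨i - 1, by omega⟩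
    refine ⟨h1, ?_⟩
    have := r.mem_sent_round ω h rfl
    rw [sent_succ] at this
    simp only [informStep, preInform, answerStep, Set.mem_union, Set.mem_ofPred_eq] at this
    rcases this with (h | ⟨_, _, _, _, h⟩) | ⟨_, _, h⟩
    · exact h
    · cases h
    · cases h
  · rintro ⟨h1, h⟩
    exact Set.mem_iUnion.2 ⟨i - 1 + 1, r.preInform_subset ω _ (r.preAnswer_subset ω _ h)⟩

lemma mem_iUnion_answer {i l : ℕ} {j b : Fin n} {g : Bool} :
    Msg.answer j i l b g ∈ ⋃ s, r.sent ω s ↔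
      1 ≤ i ∧ Msg.answer j i l b g ∈ r.preInform ω (i - 1) := by
  constructor
  · intro h
    obtain ⟨s, hs⟩ := Set.mem_iUnion.1 h
    have h1 : 1 ≤ i := (r.round_bounds ω hs).1
    obtain ⟨i, rfl⟩ : ∃ i', i = i' + 1 := ⟨i - 1, by omega⟩
    refine ⟨h1, ?_⟩
    have := r.mem_sent_round ω h rfl
    rw [sent_succ] at this
    simp only [informStep, Set.mem_union, Set.mem_ofPred_eq] at this
    rcases this with h | ⟨_, _, h⟩
    · exact h
    · cases h
  · rintro ⟨h1, h⟩
    exact Set.mem_iUnion.2 ⟨i - 1 + 1, r.preInform_subset ω _ h⟩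

/-- A bin that receives requests in round `i + 1` permits one of them, and the ball that has sent
it is placed in round `i + 1`. -/
lemma exists_permitted {i l : ℕ} {j b : Fin n}
    (h : Msg.request j (i + 1) l b ∈ r.preAnswer ω i) :
    ∃ j' l', Msg.request j' (i + 1) l' b ∈ r.preAnswer ω i ∧ Placed (r.sent ω (i + 1)) j' := by
  have hp := r.permit_mem (r.preAnswer ω i) (i + 1) b ⟨j, l, h⟩
  refine ⟨_, _, hp, i + 1, _, (r.mem_sent_succ_inform ω).2
    ⟨⟨(r.permit (r.preAnswer ω i) (i + 1) b).2, b, ?_⟩, rfl⟩⟩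
  exact (r.mem_preInform_answer ω).2 ⟨hp, by simp⟩

lemma sent_congr {ω ω' : Tape n} {t : ℕ}
    (h : ∀ i < t, ∀ j l, ¬ Placed (r.sent ω i) j → l < numRequests n (i + 1) →
      ω (i + 1, j, l) = ω' (i + 1, j, l)) : r.sent ω t = r.sent ω' t := by
  induction t with
  | zero => rfl
  | succ t ih =>
    have ih := ih fun i hi => h i (by omega)
    have hA : requestStep ω (t + 1) (r.sent ω t) = requestStep ω' (t + 1) (r.sent ω' t) := by
      rw [← ih]
      ext m
      simp only [requestStep, newRequests, Set.mem_union, Set.mem_ofPred_eq]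
      refine or_congr_right (exists_congr fun j => and_congr_right fun hj => ?_)
      refine exists_congr fun l => and_congr_right fun hl => ?_
      rw [h t (by omega) j l hj hl]
    simp only [sent, hA]

end SyncRule

/-- In a synchronous execution, a ball enters round `i` right after round `i - 1`, provided that it
is not placed by then. -/
def SyncRule.entries {n : ℕ} (r : SyncRule n) : EntryProcess n where
  entered ω t i j := 1 ≤ i ∧ i ≤ t + 1 ∧ ¬ Placed (r.sent ω (i - 1)) j
  mono := by
    rintro ω t t' i j h ⟨h1, h2, h3⟩
    exact ⟨h1, by omega, h3⟩
  zero := by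
    rintro ω ω' i j ⟨h1, h2, h3⟩
    obtain rfl : i = 1 := by omega
    exact ⟨h1, h2, by simp [SyncRule.sent, Placed]⟩
  succ := by
    rintro ω ω' t h i j ⟨h1, h2, h3⟩
    refine ⟨h1, h2, ?_⟩
    rwa [← r.sent_congr (ω := ω)]
    intro i' hi' j' l hj' hl
    exact h _ _ _ ⟨by omega, by omega, by simpa using hj'⟩ hl
  one_le h := h.1
  first ω j := ⟨0, le_rfl, le_rfl, by simp [SyncRule.sent, Placed]⟩
  pred := by
    rintro ω i j hi ⟨t, h1, h2, h3⟩
    refine ⟨t, hi, by omega, fun ⟨i', b, h⟩ => h3 ⟨i', b, ?_⟩⟩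
    exact r.sent_mono ω (by omega) h
  collide := by
    rintro ω i j l hi ⟨t, h1, h2, h3⟩ hl
    obtain ⟨i, rfl⟩ : ∃ i', i = i' + 1 := ⟨i - 1, by omega⟩
    have h4 : ¬ Placed (r.sent ω i) j := fun ⟨i', b, h⟩ =>
      h3 ⟨i', b, r.sent_mono ω (by omega) h⟩
    obtain ⟨j', l', hr, hp⟩ := r.exists_permitted ω
      ((r.mem_preAnswer_request ω).2 ⟨h4, hl, rfl⟩)
    obtain ⟨h5, h6, h7⟩ := (r.mem_preAnswer_request ω).1 hr
    refine ⟨j', l', ⟨t, hi, by omega, by simpa using h5⟩, h6, h7.symm, ?_⟩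
    rintro ⟨t', -, -, h⟩
    exact h (by simpa using hp)

lemma SyncRule.active_iff {n : ℕ} {r : SyncRule n} {ω : Tape n} {i : ℕ} {j : Fin n} :
    r.entries.Active ω i j ↔ 1 ≤ i ∧ ¬ Placed (r.sent ω (i - 1)) j :=
  ⟨fun ⟨_, h1, _, h2⟩ => ⟨h1, h2⟩, fun ⟨h1, h2⟩ => ⟨i, h1, by omega, h2⟩⟩

lemma SyncRule.isTranscript {n : ℕ} (r : SyncRule n) :
    IsTranscript r.entries fun ω => ⋃ s, r.sent ω s := by
  have hinf : ∀ {ω j i b}, Msg.inform j i b ∈ ⋃ s, r.sent ω s → ∃ i', i = i' + 1 ∧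
      Msg.inform j (i' + 1) b ∈ r.sent ω (i' + 1) := by
    intro ω j i b h
    obtain ⟨s, hs⟩ := Set.mem_iUnion.1 h
    have h1 : 1 ≤ i := (r.round_bounds ω hs).1
    obtain ⟨i, rfl⟩ : ∃ i', i = i' + 1 := ⟨i - 1, by omega⟩
    exact ⟨i, rfl, r.mem_sent_round ω h rfl⟩
  refine ⟨?_, ?_, ?_, ?_, ?_, ?_⟩
  · intro ω j i l b h
    obtain ⟨h1, h2⟩ := (r.mem_iUnion_request ω).1 h
    obtain ⟨i, rfl⟩ : ∃ i', i = i' + 1 := ⟨i - 1, by omega⟩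
    obtain ⟨h3, h4, h5⟩ := (r.mem_preAnswer_request ω).1 h2
    exact ⟨SyncRule.active_iff.2 ⟨h1, h3⟩, h4, h5⟩
  · intro ω j i l b g h
    obtain ⟨h1, h2⟩ := (r.mem_iUnion_answer ω).1 h
    obtain ⟨i, rfl⟩ : ∃ i', i = i' + 1 := ⟨i - 1, by omega⟩
    exact (r.mem_iUnion_request ω).2 ⟨h1, ((r.mem_preInform_answer ω).1 h2).1⟩
  · intro ω j i l b g g' h h'
    obtain ⟨h1, h2⟩ := (r.mem_iUnion_answer ω).1 h
    obtain ⟨-, h2'⟩ := (r.mem_iUnion_answer ω).1 h'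
    obtain ⟨i, rfl⟩ : ∃ i', i = i' + 1 := ⟨i - 1, by omega⟩
    rw [((r.mem_preInform_answer ω).1 h2).2, ((r.mem_preInform_answer ω).1 h2').2]
  · intro ω j j' i l l' b h h'
    obtain ⟨h1, h2⟩ := (r.mem_iUnion_answer ω).1 h
    obtain ⟨-, h2'⟩ := (r.mem_iUnion_answer ω).1 h'
    obtain ⟨i, rfl⟩ : ∃ i', i = i' + 1 := ⟨i - 1, by omega⟩
    have e := of_decide_eq_true ((r.mem_preInform_answer ω).1 h2).2.symm
    have e' := of_decide_eq_true ((r.mem_preInform_answer ω).1 h2').2.symm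
    exact (Prod.ext_iff.1 (e.symm.trans e')).1
  · intro ω j i b h
    obtain ⟨i, rfl, h0⟩ := hinf h
    obtain ⟨hl, rfl⟩ := (r.mem_sent_succ_inform ω).1 h0
    obtain ⟨l, hl⟩ := r.pick_mem _ _ _ hl
    exact ⟨l, (r.mem_iUnion_answer ω).2 ⟨by omega, hl⟩⟩
  · have key : ∀ {ω j i i' b b'}, Msg.inform j (i + 1) b ∈ r.sent ω (i + 1) →
        Msg.inform j (i' + 1) b' ∈ r.sent ω (i' + 1) → ¬ i < i' := by
      intro ω j i i' b b' h h' hlt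
      obtain ⟨⟨l, b'', hl⟩, -⟩ := (r.mem_sent_succ_inform ω).1 h'
      have := ((r.mem_preAnswer_request ω).1 ((r.mem_preInform_answer ω).1 hl).1).1
      exact this ⟨_, _, r.sent_mono ω hlt h⟩
    intro ω j i i' b b' h h'
    obtain ⟨i, rfl, h0⟩ := hinf h
    obtain ⟨i', rfl, h0'⟩ := hinf h'
    obtain rfl : i = i' := le_antisymm (not_lt.1 (key h0' h0)) (not_lt.1 (key h0 h0'))
    exact ⟨rfl, ((r.mem_sent_succ_inform ω).1 h0).2.trans
      ((r.mem_sent_succ_inform ω).1 h0').2.symm⟩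

/-! ### The sets of participating balls -/

lemma kSeq_succ_succ (n i : ℕ) : kSeq n (i + 2) =
    min (kSeq n (i + 1) * Real.exp ((⌊kSeq n (i + 1)⌋₊ : ℝ) / 5)) √(Real.logb 2 n) := rfl

lemma one_le_sqrt_logb {n : ℕ} (hn : 2 ≤ n) : 1 ≤ √(Real.logb 2 n) := by
  rw [Real.one_le_sqrt, Real.le_logb_iff_rpow_le (by norm_num) (by positivity)]
  simpa using (by exact_mod_cast hn : (2 : ℝ) ≤ n)

lemma one_le_kSeq {n : ℕ} (hn : 2 ≤ n) : ∀ {i : ℕ}, 1 ≤ i → 1 ≤ kSeq n i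
  | 1, _ => le_rfl
  | i + 2, _ => by
    have ih := one_le_kSeq hn (i := i + 1) (by omega)
    rw [kSeq_succ_succ]
    refine le_min ?_ (one_le_sqrt_logb hn)
    nlinarith [Real.one_le_exp (x := (⌊kSeq n (i + 1)⌋₊ : ℝ) / 5) (by positivity)]

lemma one_le_numRequests {n : ℕ} (hn : 2 ≤ n) {i : ℕ} (hi : 1 ≤ i) : 1 ≤ numRequests n i :=
  Nat.one_le_floor_iff _ |>.2 (one_le_kSeq hn hi)

/-- If there is a single ball, then `log n = 0`, and no requests are sent after the first round. -/
lemma two_le_of_numRequests_pos {n i : ℕ} (hi : 1 ≤ i) (h : 0 < numRequests n (i + 1)) :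
    2 ≤ n := by
  by_contra hn
  obtain ⟨i, rfl⟩ : ∃ i', i = i' + 1 := ⟨i - 1, by omega⟩
  have h0 : √(Real.logb 2 n) = 0 := by
    have : n = 0 ∨ n = 1 := by omega
    rcases this with rfl | rfl <;> simp
  have : kSeq n (i + 2) ≤ 0 := h0 ▸ min_le_right _ _
  rw [numRequests, Nat.floor_of_nonpos this] at h
  exact lt_irrefl _ h

namespace EntryProcess

variable {n : ℕ} (D : EntryProcess n) (ω : Tape n)

open Classical in
/-- The balls that take part in round `i`. -/
noncomputable def active (i : ℕ) : Finset (Fin n) := {j | D.Active ω i j}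

@[simp] lemma mem_active {i : ℕ} {j : Fin n} : j ∈ D.active ω i ↔ D.Active ω i j := by
  simp [active]

lemma active_succ_subset {i : ℕ} (hi : 1 ≤ i) : D.active ω (i + 1) ⊆ D.active ω i := by
  intro j hj
  rw [mem_active] at *
  exact D.pred hi hj

lemma Active.of_le {D : EntryProcess n} {ω : Tape n} {i i' : ℕ} {j : Fin n}
    (h : D.Active ω i' j) (hi : 1 ≤ i) (hii' : i ≤ i') : D.Active ω i j := by
  induction i', hii' using Nat.le_induction with
  | base => exact h
  | succ k hk ih => exact ih (D.pred (by omega) h)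

/-- In every round at least one participating ball is successful. -/
lemma card_active_succ_lt {i : ℕ} (hi : 1 ≤ i) (hK : 1 ≤ numRequests n i)
    (h : (D.active ω (i + 1)).Nonempty) : (D.active ω (i + 1)).card < (D.active ω i).card := by
  obtain ⟨j, hj⟩ := h
  obtain ⟨j', l', h1, -, -, h2⟩ := D.collide hi ((D.mem_active ω).1 hj) hK
  refine Finset.card_lt_card ⟨D.active_succ_subset ω hi, fun hs => h2 ?_⟩
  exact (D.mem_active ω).1 (hs ((D.mem_active ω).2 h1))

lemma card_active_add_le {i : ℕ} (hn : 2 ≤ n) (hi : 1 ≤ i) (h : (D.active ω i).Nonempty) :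
    (D.active ω i).card + i ≤ n + 1 := by
  induction i, hi using Nat.le_induction with
  | base => simpa using Finset.card_le_univ (D.active ω 1)
  | succ i hi ih =>
    have h1 := D.card_active_succ_lt ω hi (one_le_numRequests hn hi) h
    have := ih (h.mono (D.active_succ_subset ω hi))
    omega

lemma not_active_succ (j : Fin n) : ¬ D.Active ω (n + 1) j := by
  intro h
  have hne : (D.active ω (n + 1)).Nonempty := ⟨j, (D.mem_active ω).2 h⟩
  have hpos := hne.card_pos
  rcases Nat.lt_or_ge n 2 with hn | hn
  · have := j.pos
    obtain rfl : n = 1 := by omega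
    have h1 := D.card_active_succ_lt ω le_rfl (numRequests_one 1).ge hne
    have := Finset.card_le_univ (D.active ω 1)
    simp only [Fintype.card_fin] at this
    omega
  · have := D.card_active_add_le ω hn (by omega) hne
    omega

variable {D ω} in
lemma Active.one_le {i : ℕ} {j : Fin n} (h : D.Active ω i j) : 1 ≤ i := by
  obtain ⟨t, ht⟩ := h
  exact D.one_le ht

variable {D ω} in
/-- There are never more than `n` rounds. -/
lemma Active.le {i : ℕ} {j : Fin n} (h : D.Active ω i j) : i ≤ n := by
  by_contra hi
  exact D.not_active_succ ω j (h.of_le (by omega) (by omega))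

end EntryProcess

/-- In a synchronous execution every ball is placed. -/
lemma SyncRule.exists_inform {n : ℕ} (r : SyncRule n) (ω : Tape n) (j : Fin n) :
    ∃ i b, Msg.inform j i b ∈ ⋃ s, r.sent ω s := by
  have h := r.entries.not_active_succ ω j
  rw [SyncRule.active_iff] at h
  simp only [le_add_iff_nonneg_left, zero_le, add_tsub_cancel_right, true_and, not_not] at h
  obtain ⟨i, b, h⟩ := h
  exact ⟨i, b, Set.mem_iUnion.2 ⟨n, h⟩⟩

/-! ### Asynchronous executions -/

/-- The properties of the states of an asynchronous execution that are preserved by the delivery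
of messages. The fields `next` and `proceed` say that a ball sends requests of round `i + 1` if and
only if all its requests of round `i` have been declined. -/
structure AsyncState.Inv {n : ℕ} (ω : Tape n) (s : AsyncState n) : Prop where
  request : ∀ {j i l b}, Msg.request j i l b ∈ s.sent →
    1 ≤ i ∧ l < numRequests n i ∧ b = ω (i, j, l)
  block : ∀ {j i l b l'}, Msg.request j i l b ∈ s.sent → l' < numRequests n i →
    Msg.request j i l' (ω (i, j, l')) ∈ s.sent
  sent_of_delivered : ∀ {m}, m ∈ s.delivered → m ∈ s.sent
  nodup : s.delivered.Nodup
  answer : ∀ {j i l b g}, Msg.answer j i l b g ∈ s.sent → Msg.request j i l b ∈ s.delivered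
  answer_unique : ∀ {j i l b}, Msg.answer j i l b true ∈ s.sent →
    Msg.answer j i l b false ∈ s.sent → False
  permit_unique : ∀ {j j' i l l' b}, Msg.answer j i l b true ∈ s.sent →
    Msg.answer j' i l' b true ∈ s.sent → j = j'
  decline : ∀ {j i l b}, Msg.answer j i l b false ∈ s.sent →
    ∃ j' l', Msg.answer j' i l' b true ∈ s.sent
  next : ∀ {j i l b l'}, Msg.request j (i + 1) l b ∈ s.sent → 1 ≤ i → l' < numRequests n i →
    ∃ b', Msg.answer j i l' b' false ∈ s.delivered
  inform : ∀ {j i b}, Msg.inform j i b ∈ s.sent → ∃ l, Msg.answer j i l b true ∈ s.sent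
  inform_unique : ∀ {j i b i' b'}, Msg.inform j i b ∈ s.sent → Msg.inform j i' b' ∈ s.sent →
    i = i' ∧ b = b'
  placed : ∀ {j i l b}, Msg.answer j i l b true ∈ s.delivered → Placed s.sent j
  proceed : ∀ {j i l}, 0 < numRequests n i →
    (∀ l < numRequests n i, ∃ b, Msg.answer j i l b false ∈ s.delivered) →
    l < numRequests n (i + 1) → Msg.request j (i + 1) l (ω (i + 1, j, l)) ∈ s.sent
  answered : ∀ {j i l b}, Msg.request j i l b ∈ s.delivered → ∃ g, Msg.answer j i l b g ∈ s.sent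

namespace AsyncState.Inv

variable {n : ℕ} {ω : Tape n} {s : AsyncState n}

lemma deliver_request (h : s.Inv ω) {j i l b} (hm : Msg.request j i l b ∈ s.sent)
    (hd : Msg.request j i l b ∉ s.delivered) {g : Bool}
    (hg : g = true ↔ ¬ ∃ j' l', Msg.answer j' i l' b true ∈ s.sent) :
    AsyncState.Inv ω ⟨s.sent ∪ {Msg.answer j i l b g}, Msg.request j i l b :: s.delivered⟩ := by
  obtain ⟨h1, h2, h3, h4, h5, h6, h7, h8, h9, h10, h11, h12, h13, h14⟩ := h
  constructor <;> simp only [Set.mem_union, Set.mem_singleton_iff, List.mem_cons, Placed] at *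
  case answered =>
    rintro j' i' l' b' (h | h)
    · cases h
      exact ⟨g, Or.inr rfl⟩
    · obtain ⟨g', h'⟩ := h14 h
      exact ⟨g', Or.inl h'⟩
  all_goals grind

lemma deliver_permit (h : s.Inv ω) {j i l b} (hm : Msg.answer j i l b true ∈ s.sent)
    (hd : Msg.answer j i l b true ∉ s.delivered) :
    AsyncState.Inv ω ⟨s.sent ∪ {m | ¬ Placed s.sent j ∧ m = Msg.inform j i b},
      Msg.answer j i l b true :: s.delivered⟩ := by
  obtain ⟨h1, h2, h3, h4, h5, h6, h7, h8, h9, h10, h11, h12, h13, h14⟩ := h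
  constructor <;> simp only [Set.mem_union, Set.mem_ofPred_eq, List.mem_cons, Placed] at *
  case placed =>
    rintro j' i' l' b' (h | h)
    · cases h
      by_cases hp : ∃ i b, Msg.inform j i b ∈ s.sent
      · obtain ⟨i', b', h⟩ := hp
        exact ⟨i', b', Or.inl h⟩
      · exact ⟨i, b, Or.inr ⟨hp, rfl⟩⟩
    · obtain ⟨i', b', h⟩ := h12 h
      exact ⟨i', b', Or.inl h⟩
  all_goals grind

lemma deliver_inform (h : s.Inv ω) {j i b} (hm : Msg.inform j i b ∈ s.sent)
    (hd : Msg.inform j i b ∉ s.delivered) :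
    AsyncState.Inv ω ⟨s.sent ∪ ∅, Msg.inform j i b :: s.delivered⟩ := by
  obtain ⟨h1, h2, h3, h4, h5, h6, h7, h8, h9, h10, h11, h12, h13, h14⟩ := h
  rw [Set.union_empty]
  constructor <;> simp only [List.mem_cons, Placed] at * <;> grind

lemma deliver_decline (h : s.Inv ω) {j i l b} (hm : Msg.answer j i l b false ∈ s.sent)
    (hd : Msg.answer j i l b false ∉ s.delivered) :
    AsyncState.Inv ω ⟨s.sent ∪ {m | (∀ l' < numRequests n i,
        ∃ b', Msg.answer j i l' b' false ∈ Msg.answer j i l b false :: s.delivered) ∧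
      m ∈ newRequests ω (i + 1) j}, Msg.answer j i l b false :: s.delivered⟩ := by
  obtain ⟨h1, h2, h3, h4, h5, h6, h7, h8, h9, h10, h11, h12, h13, h14⟩ := h
  constructor <;>
    simp only [Set.mem_union, Set.mem_ofPred_eq, List.mem_cons, Placed, newRequests] at * <;>
    grind

end AsyncState.Inv

namespace Scheduler

variable {n : ℕ} (σ : Scheduler n) (ω : Tape n)

lemma inv_step {s : AsyncState n} (h : s.Inv ω) : (σ.step ω s).Inv ω := by
  unfold step
  split_ifs with hs
  · obtain ⟨hm, hd⟩ := σ.next_mem s hs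
    generalize σ.next s = m at hm hd ⊢
    match m with
    | .request j i l b =>
      refine h.deliver_request hm hd ?_
      classical exact decide_eq_true_iff
    | .answer j i l b true => exact h.deliver_permit hm hd
    | .answer j i l b false => exact h.deliver_decline hm hd
    | .inform j i b => exact h.deliver_inform hm hd
  · exact h

lemma inv_state (t : ℕ) : (σ.state ω t).Inv ω := by
  induction t with
  | zero =>
    constructor <;> simp only [state, newRequests, Set.mem_ofPred_eq] <;> grind
  | succ t ih => exact σ.inv_step ω ih

lemma sent_subset_step (s : AsyncState n) : s.sent ⊆ (σ.step ω s).sent := by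
  unfold step
  split_ifs
  · exact Set.subset_union_left
  · exact subset_rfl

lemma delivered_subset_step (s : AsyncState n) : s.delivered ⊆ (σ.step ω s).delivered := by
  unfold step
  split_ifs
  · exact List.subset_cons_self _ _
  · exact List.Subset.refl _

lemma sent_mono : Monotone fun t => (σ.state ω t).sent :=
  monotone_nat_of_le_succ fun _ => σ.sent_subset_step ω _

lemma delivered_mono {t t' : ℕ} (h : t ≤ t') :
    (σ.state ω t).delivered ⊆ (σ.state ω t').delivered := by
  induction t', h using Nat.le_induction with
  | base => exact List.Subset.refl _
  | succ k _ ih => exact List.Subset.trans ih (σ.delivered_subset_step ω _)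

lemma exists_common_state {m m' : Msg n} (h : m ∈ ⋃ t, (σ.state ω t).sent)
    (h' : m' ∈ ⋃ t, (σ.state ω t).sent) :
    ∃ t, m ∈ (σ.state ω t).sent ∧ m' ∈ (σ.state ω t).sent := by
  obtain ⟨t, ht⟩ := Set.mem_iUnion.1 h
  obtain ⟨t', ht'⟩ := Set.mem_iUnion.1 h'
  exact ⟨max t t', σ.sent_mono ω (le_max_left _ _) ht, σ.sent_mono ω (le_max_right _ _) ht'⟩

/-- Up to time `t`, an asynchronous execution only uses the random choices of the requests that
have been sent by time `t`. -/
lemma state_congr {ω ω' : Tape n} {t : ℕ}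
    (h : ∀ i j l, (∃ l b, Msg.request j i l b ∈ (σ.state ω t).sent) → l < numRequests n i →
      ω (i, j, l) = ω' (i, j, l)) : σ.state ω t = σ.state ω' t := by
  have key : ∀ i j (M : Set (Msg n)), newRequests ω i j ⊆ M →
      (∀ i j l, (∃ l b, Msg.request j i l b ∈ M) → l < numRequests n i →
        ω (i, j, l) = ω' (i, j, l)) → newRequests ω i j = newRequests ω' i j := by
    intro i j M hM hω
    ext m
    simp only [newRequests, Set.mem_ofPred_eq]
    refine exists_congr fun l => and_congr_right fun hl => ?_
    rw [hω i j l ⟨l, _, hM ⟨l, hl, rfl⟩⟩ hl]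
  induction t with
  | zero =>
    have : ∀ j, newRequests ω 1 j = newRequests ω' 1 j := fun j =>
      key 1 j {m | ∃ j, m ∈ newRequests ω 1 j} (fun m hm => ⟨j, hm⟩) h
    simp only [state, this]
  | succ t ih =>
    have ih := ih fun i j l ⟨l', b, h'⟩ =>
      h i j l ⟨l', b, σ.sent_mono ω (Nat.le_succ t) h'⟩
    simp only [state, step] at h ⊢
    rw [← ih]
    split_ifs at h ⊢ with hs
    · congr 2
      revert h
      generalize σ.next (σ.state ω t) = m
      intro h
      match m with
      | .request j i l b => rfl
      | .answer j i l b true => rfl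
      | .inform j i b => rfl
      | .answer j i l b false =>
        simp only [reaction] at h ⊢
        ext m
        simp only [Set.mem_ofPred_eq]
        refine and_congr_right fun hd => ?_
        rw [key (i + 1) j _ ?_ h]
        exact fun m hm => Or.inr ⟨hd, hm⟩
    · rfl

lemma mem_sent_succ_request {t i l : ℕ} {j b : Fin n} :
    Msg.request j i l b ∈ (σ.state ω (t + 1)).sent ↔ Msg.request j i l b ∈ (σ.state ω t).sent ∨
      (∃ m ∈ (σ.state ω t).sent, m ∉ (σ.state ω t).delivered) ∧
      ∃ i' l' b', σ.next (σ.state ω t) = Msg.answer j i' l' b' false ∧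
      (∀ l < numRequests n i', ∃ b, Msg.answer j i' l b false ∈
        Msg.answer j i' l' b' false :: (σ.state ω t).delivered) ∧
      i = i' + 1 ∧ l < numRequests n i ∧ b = ω (i, j, l) := by
  simp only [state, step]
  split_ifs with hs
  · simp only [hs, true_and, Set.mem_union]
    refine or_congr_right ?_
    generalize σ.next (σ.state ω t) = m
    match m with
    | .request j i l b => simp [reaction]
    | .answer j i l b true => simp [reaction]
    | .inform j i b => simp [reaction]
    | .answer j' i' l' b' false =>
      simp only [reaction, newRequests, Set.mem_ofPred_eq, Msg.request.injEq, Msg.answer.injEq]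
      constructor
      · rintro ⟨h1, l'', h2, rfl, rfl, rfl, rfl⟩
        exact ⟨i', l', b', ⟨rfl, rfl, rfl, rfl, trivial⟩, h1, rfl, h2, rfl⟩
      · rintro ⟨_, _, _, ⟨rfl, rfl, rfl, rfl, -⟩, h1, rfl, h2, rfl⟩
        exact ⟨h1, l, h2, rfl, rfl, rfl, rfl⟩
  · simp [hs]

end Scheduler

/-- In an asynchronous execution, a ball enters round `i` when it sends the requests of round `i`,
all of which it sends simultaneously. -/
def Scheduler.entries {n : ℕ} (σ : Scheduler n) : EntryProcess n where
  entered ω t i j := ∃ l b, Msg.request j i l b ∈ (σ.state ω t).sent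
  mono := by
    rintro ω t t' i j h ⟨l, b, hl⟩
    exact ⟨l, b, σ.sent_mono ω h hl⟩
  zero := by
    rintro ω ω' i j ⟨l, b, j', l', hl, h⟩
    cases h
    exact ⟨_, _, j, l, hl, rfl⟩
  succ := by
    rintro ω ω' t h i j ⟨l, b, hl⟩
    have hs := σ.state_congr h
    rw [σ.mem_sent_succ_request] at hl
    rcases hl with hl | ⟨h0, i', l', b', h1, h2, h3, h4, h5⟩
    · refine ⟨l, b, ?_⟩
      rw [σ.mem_sent_succ_request, ← hs]
      exact Or.inl hl
    · refine ⟨l, ω' (i, j, l), ?_⟩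
      rw [σ.mem_sent_succ_request, ← hs]
      exact Or.inr ⟨h0, i', l', b', h1, h2, h3, h4, rfl⟩
  one_le := by
    rintro ω t i j ⟨l, b, h⟩
    exact ((σ.inv_state ω t).request h).1
  first ω j := ⟨0, 0, ω (1, j, 0), j, 0, by simp [numRequests_one], rfl⟩
  pred := by
    rintro ω i j hi ⟨t, l, b, h⟩
    have inv := σ.inv_state ω t
    have hn := two_le_of_numRequests_pos hi (pos_of_gt (inv.request h).2.1)
    obtain ⟨b', hb'⟩ := inv.next h hi (one_le_numRequests hn hi)
    exact ⟨t, _, _, inv.sent_of_delivered (inv.answer (inv.sent_of_delivered hb'))⟩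
  collide := by
    rintro ω i j l hi ⟨t, l₀, b₀, h⟩ hl
    have inv := σ.inv_state ω t
    obtain ⟨b, hb⟩ := inv.next h hi hl
    have hb := inv.sent_of_delivered hb
    obtain ⟨j', l', hp⟩ := inv.decline hb
    obtain ⟨-, -, e⟩ := inv.request (inv.sent_of_delivered (inv.answer hb))
    have hr := inv.sent_of_delivered (inv.answer hp)
    obtain ⟨-, hl', e'⟩ := inv.request hr
    refine ⟨j', l', ⟨t, _, _, hr⟩, hl', e'.symm.trans e, ?_⟩
    rintro ⟨t', l₁, b₁, h'⟩
    have inv' := σ.inv_state ω t'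
    obtain ⟨b'', hb''⟩ := inv'.next h' hi hl'
    have hb'' := inv'.sent_of_delivered hb''
    obtain ⟨-, -, e''⟩ := inv'.request (inv'.sent_of_delivered (inv'.answer hb''))
    obtain rfl : b = b'' := e'.trans e''.symm
    obtain ⟨T, hT, hT'⟩ := σ.exists_common_state ω (Set.mem_iUnion.2 ⟨t, hp⟩)
      (Set.mem_iUnion.2 ⟨t', hb''⟩)
    exact (σ.inv_state ω T).answer_unique hT hT'

lemma Scheduler.isTranscript {n : ℕ} (σ : Scheduler n) :
    IsTranscript σ.entries fun ω => ⋃ t, (σ.state ω t).sent := by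
  refine ⟨?_, ?_, ?_, ?_, ?_, ?_⟩
  · intro ω j i l b h
    obtain ⟨t, ht⟩ := Set.mem_iUnion.1 h
    exact ⟨⟨t, l, b, ht⟩, ((σ.inv_state ω t).request ht).2⟩
  · intro ω j i l b g h
    obtain ⟨t, ht⟩ := Set.mem_iUnion.1 h
    have inv := σ.inv_state ω t
    exact Set.mem_iUnion.2 ⟨t, inv.sent_of_delivered (inv.answer ht)⟩
  · intro ω j i l b g g' h h'
    obtain ⟨t, ht, ht'⟩ := σ.exists_common_state ω h h'
    have := (σ.inv_state ω t).answer_unique (j := j) (i := i) (l := l) (b := b)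
    cases g <;> cases g'
    exacts [rfl, (this ht' ht).elim, (this ht ht').elim, rfl]
  · intro ω j j' i l l' b h h'
    obtain ⟨t, ht, ht'⟩ := σ.exists_common_state ω h h'
    exact (σ.inv_state ω t).permit_unique ht ht'
  · intro ω j i b h
    obtain ⟨t, ht⟩ := Set.mem_iUnion.1 h
    obtain ⟨l, hl⟩ := (σ.inv_state ω t).inform ht
    exact ⟨l, Set.mem_iUnion.2 ⟨t, hl⟩⟩
  · intro ω j i i' b b' h h'
    obtain ⟨t, ht, ht'⟩ := σ.exists_common_state ω h h'
    exact (σ.inv_state ω t).inform_unique ht ht'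

/-- There are only finitely many messages in the first `R` rounds with less than `K` requests per
ball and round. -/
lemma finite_setOf_msg (n R K : ℕ) :
    {m : Msg n | m.round ≤ R ∧ ∀ j i l b, (m = Msg.request j i l b ∨
      ∃ g, m = Msg.answer j i l b g) → l < K}.Finite := by
  have h1 := Set.toFinite (Set.range fun a : Fin n × Fin (R + 1) × Fin K × Fin n =>
    Msg.request a.1 a.2.1 a.2.2.1 a.2.2.2)
  have h2 := Set.toFinite (Set.range fun a : Fin n × Fin (R + 1) × Fin K × Fin n × Bool =>
    Msg.answer a.1 a.2.1 a.2.2.1 a.2.2.2.1 a.2.2.2.2)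
  have h3 := Set.toFinite (Set.range fun a : Fin n × Fin (R + 1) × Fin n =>
    Msg.inform a.1 a.2.1 a.2.2)
  refine ((h1.union h2).union h3).subset ?_
  rintro m ⟨hr, hl⟩
  match m with
  | .request j i l b =>
    exact Or.inl (Or.inl ⟨(j, ⟨i, Nat.lt_succ_of_le hr⟩, ⟨l, hl _ _ _ _ (Or.inl rfl)⟩, b), rfl⟩)
  | .answer j i l b g =>
    exact Or.inl (Or.inr
      ⟨(j, ⟨i, Nat.lt_succ_of_le hr⟩, ⟨l, hl _ _ _ _ (Or.inr ⟨g, rfl⟩)⟩, b, g), rfl⟩)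
  | .inform j i b => exact Or.inr ⟨(j, ⟨i, Nat.lt_succ_of_le hr⟩, b), rfl⟩

lemma IsTranscript.finite {n : ℕ} {D : EntryProcess n} {X : Tape n → Set (Msg n)}
    (h : IsTranscript D X) (ω : Tape n) : (X ω).Finite := by
  refine (finite_setOf_msg n n ((Finset.range (n + 1)).sup (numRequests n))).subset fun m hm => ?_
  have hreq : ∀ {j i l b}, Msg.request j i l b ∈ X ω →
      i ≤ n ∧ l < (Finset.range (n + 1)).sup (numRequests n) := by
    intro j i l b hr
    obtain ⟨h1, h2, -⟩ := h.request hr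
    exact ⟨h1.le, h2.trans_le (Finset.le_sup (f := numRequests n)
      (Finset.mem_range.2 (Nat.lt_succ_of_le h1.le)))⟩
  match m with
  | .request j i l b =>
    refine ⟨(hreq hm).1, ?_⟩
    rintro j' i' l' b' (e | ⟨g, e⟩) <;> cases e
    exact (hreq hm).2
  | .answer j i l b g =>
    refine ⟨(hreq (h.answer hm)).1, ?_⟩
    rintro j' i' l' b' (e | ⟨g, e⟩) <;> cases e
    exact (hreq (h.answer hm)).2
  | .inform j i b =>
    obtain ⟨l, hl⟩ := h.inform hm
    refine ⟨(hreq (h.answer hl)).1, ?_⟩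
    rintro j' i' l' b' (e | ⟨g, e⟩) <;> cases e

/-- As there are only finitely many messages, every message is delivered eventually. -/
lemma Scheduler.exists_delivered {n : ℕ} (σ : Scheduler n) (ω : Tape n) {m : Msg n}
    (hm : m ∈ ⋃ t, (σ.state ω t).sent) : ∃ t, m ∈ (σ.state ω t).delivered := by
  by_contra! hnd
  obtain ⟨t₀, ht₀⟩ := Set.mem_iUnion.1 hm
  -- as long as `m` is in transit, another message is delivered in every step
  have hlen : ∀ t, t ≤ (σ.state ω (t₀ + t)).delivered.length := by
    intro t
    induction t with
    | zero => exact Nat.zero_le _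
    | succ t ih =>
      have hs : ∃ m ∈ (σ.state ω (t₀ + t)).sent, m ∉ (σ.state ω (t₀ + t)).delivered :=
        ⟨m, σ.sent_mono ω (Nat.le_add_right _ _) ht₀, hnd _⟩
      rw [← add_assoc]
      simp only [state, step, if_pos hs, List.length_cons]
      omega
  have hfin := σ.isTranscript.finite ω
  have inv := σ.inv_state ω (t₀ + (hfin.toFinset.card + 1))
  classical
  have hsub : (σ.state ω (t₀ + (hfin.toFinset.card + 1))).delivered.toFinset ⊆ hfin.toFinset := by
    intro m hm
    rw [Set.Finite.mem_toFinset]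
    exact Set.mem_iUnion.2 ⟨_, inv.sent_of_delivered (List.mem_toFinset.1 hm)⟩
  have := Finset.card_le_card hsub
  rw [List.toFinset_card_of_nodup inv.nodup] at this
  have := hlen (hfin.toFinset.card + 1)
  omega

/-- In an asynchronous execution every ball is placed: consider the last round in which the ball
takes part. -/
lemma Scheduler.exists_inform {n : ℕ} (σ : Scheduler n) (ω : Tape n) (j : Fin n) :
    ∃ i b, Msg.inform j i b ∈ ⋃ t, (σ.state ω t).sent := by
  by_contra! hnp
  have hperm : ∀ i l b, Msg.answer j i l b true ∉ ⋃ t, (σ.state ω t).sent := by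
    intro i l b h
    obtain ⟨t, ht⟩ := σ.exists_delivered ω h
    obtain ⟨i', b', h'⟩ := (σ.inv_state ω t).placed ht
    exact hnp i' b' (Set.mem_iUnion.2 ⟨t, h'⟩)
  obtain ⟨i, hi, hi'⟩ : ∃ i, σ.entries.Active ω i j ∧ ¬ σ.entries.Active ω (i + 1) j := by
    by_contra! h
    have : ∀ i, σ.entries.Active ω (i + 1) j := fun i => by
      induction i with
      | zero => exact σ.entries.first ω j
      | succ i ih => exact h _ ih
    exact σ.entries.not_active_succ ω j (this n)
  -- as no permission arrives, all requests of round `i` are declined, and the ball proceeds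
  obtain ⟨t, l₀, b₀, h₀⟩ := hi
  have inv := σ.inv_state ω t
  have hl₀ := (inv.request h₀).2.1
  have hdecl : ∀ l < numRequests n i, ∃ t, Msg.answer j i l (ω (i, j, l)) false ∈
      (σ.state ω t).delivered := by
    intro l hl
    obtain ⟨t', ht'⟩ := σ.exists_delivered ω (Set.mem_iUnion.2 ⟨t, inv.block h₀ hl⟩)
    obtain ⟨g, hg⟩ := (σ.inv_state ω t').answered ht'
    cases g with
    | true => exact (hperm _ _ _ (Set.mem_iUnion.2 ⟨t', hg⟩)).elim
    | false => exact σ.exists_delivered ω (Set.mem_iUnion.2 ⟨t', hg⟩)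
  -- a request is declined only if another ball has been permitted
  have hn : 2 ≤ n := by
    obtain ⟨t', ht'⟩ := hdecl l₀ hl₀
    have inv' := σ.inv_state ω t'
    obtain ⟨j', l', h⟩ := inv'.decline (inv'.sent_of_delivered ht')
    have hne : j ≠ j' := by
      rintro rfl
      exact hperm _ _ _ (Set.mem_iUnion.2 ⟨t', h⟩)
    have := Fin.val_ne_of_ne hne
    have := j.isLt
    have := j'.isLt
    omega
  choose! T hT using hdecl
  set T' := (Finset.range (numRequests n i)).sup T
  have h' := (σ.inv_state ω T').proceed (j := j) (l := 0) (pos_of_gt hl₀)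
    (fun l hl => ⟨_, σ.delivered_mono ω (Finset.le_sup (Finset.mem_range.2 hl)) (hT l hl)⟩)
    (one_le_numRequests hn (by omega))
  exact hi' ⟨T', _, _, h'⟩

/-- Both kinds of executions are transcripts of entry processes, and place every ball. -/
lemma exists_isTranscript {n : ℕ} {X : Tape n → Set (Msg n)}
    (hX : X ∈ syncExecutions n ∨ X ∈ asyncExecutions n) :
    (∃ D, IsTranscript D X) ∧ ∀ ω j, ∃ i b, Msg.inform j i b ∈ X ω := by
  rcases hX with ⟨r, rfl⟩ | ⟨σ, rfl⟩
  · exact ⟨⟨_, r.isTranscript⟩, r.exists_inform⟩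
  · exact ⟨⟨_, σ.isTranscript⟩, σ.exists_inform⟩

/-! ### Uniformly random functions on a finite set -/

section FiniteProbability

variable {ι β : Type*} [Fintype ι] [DecidableEq ι] [Fintype β]

/-- Resampling a single coordinate preserves the uniform distribution. -/
lemma sum_sum_update (a : ι) (f : (ι → β) → ℝ) :
    ∑ y : ι → β, ∑ v, f (Function.update y a v) = Fintype.card β * ∑ y, f y := by
  have hinv : Function.Involutive fun p : (ι → β) × β => (Function.update p.1 a p.2, p.1 a) := by
    rintro ⟨y, v⟩
    simp
  have h := Equiv.sum_comp hinv.toPerm fun p => f p.1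
  simp only [Function.Involutive.coe_toPerm, Fintype.sum_prod_type] at h
  rw [h, Finset.mul_sum]
  simp

open Classical in
/-- The probability of an event for a uniformly random function. -/
noncomputable def prob (p : (ι → β) → Prop) : ℝ :=
  (Finset.univ.filter p).card / (Fintype.card (ι → β) : ℝ)

lemma prob_mono {p q : (ι → β) → Prop} (h : ∀ y, p y → q y) : prob p ≤ prob q := by
  unfold prob
  gcongr with y
  exact h y

lemma prob_eq_sum (p : (ι → β) → Prop) [DecidablePred p] :
    prob p = (∑ y, if p y then (1 : ℝ) else 0) / (Fintype.card (ι → β) : ℝ) := by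
  classical
  rw [prob, Finset.sum_boole]
  congr!

lemma prob_or_le (p q : (ι → β) → Prop) : prob (fun y => p y ∨ q y) ≤ prob p + prob q := by
  classical
  rw [prob_eq_sum, prob_eq_sum, prob_eq_sum, ← add_div, ← Finset.sum_add_distrib]
  gcongr with y
  by_cases hp : p y <;> by_cases hq : q y <;> simp [hp, hq]

lemma prob_exists_mem_le {κ : Type*} (s : Finset κ) (p : κ → (ι → β) → Prop) :
    prob (fun y => ∃ k ∈ s, p k y) ≤ ∑ k ∈ s, prob (p k) := by
  classical
  induction s using Finset.induction_on with
  | empty => simp [prob]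
  | insert k s hk ih =>
    rw [Finset.sum_insert hk]
    refine le_trans ?_ ((prob_or_le _ _).trans (by gcongr))
    exact prob_mono fun y => by simp

/-- If each coordinate in `S` has to hit a set of at most `h` values which does not depend on
these coordinates, then the probability is at most `(h / |β|) ^ |S|`. -/
lemma prob_forall_mem_le [Nonempty β] (S : Finset ι) (H : (ι → β) → Finset β)
    (hH : ∀ a ∈ S, ∀ y v, H (Function.update y a v) = H y) (h : ℝ)
    (hcard : ∀ y, ((H y).card : ℝ) ≤ h) :
    prob (fun y : ι → β => ∀ a ∈ S, y a ∈ H y) ≤ (h / Fintype.card β) ^ S.card := by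
  classical
  have hβ : (0 : ℝ) < Fintype.card β := by exact_mod_cast Fintype.card_pos
  have h0 : 0 ≤ h := (Nat.cast_nonneg _).trans (hcard fun _ => Classical.arbitrary β)
  induction S using Finset.induction_on with
  | empty =>
    rw [prob_eq_sum]
    simp
  | insert a S ha ih =>
    have ih := ih fun a' ha' => hH a' (Finset.mem_insert_of_mem ha')
    have hN : (0 : ℝ) < Fintype.card (ι → β) := by exact_mod_cast Fintype.card_pos
    rw [prob_eq_sum] at ih ⊢
    rw [Finset.card_insert_of_notMem ha, pow_succ, div_le_iff₀ hN]
    rw [div_le_iff₀ hN] at ih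
    have key := sum_sum_update a fun y : ι → β =>
      if ∀ a' ∈ insert a S, y a' ∈ H y then (1 : ℝ) else 0
    have hle : ∀ y : ι → β, ∑ v, (if ∀ a' ∈ insert a S, Function.update y a v a' ∈
        H (Function.update y a v) then (1 : ℝ) else 0) ≤
        h * if ∀ a' ∈ S, y a' ∈ H y then (1 : ℝ) else 0 := by
      intro y
      have : ∀ v, (∀ a' ∈ insert a S, Function.update y a v a' ∈ H (Function.update y a v)) ↔
          v ∈ H y ∧ ∀ a' ∈ S, y a' ∈ H y := by
        intro v
        rw [Finset.forall_mem_insert, hH a (Finset.mem_insert_self _ _), Function.update_self]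
        refine and_congr_right fun _ => forall₂_congr fun a' ha' => ?_
        rw [Function.update_of_ne (by rintro rfl; exact ha ha')]
      simp only [this]
      split_ifs with hS
      · rw [mul_one]
        refine le_trans (le_of_eq ?_) (hcard y)
        refine (Finset.sum_congr rfl fun v _ => if_congr (and_iff_left hS) rfl rfl).trans ?_
        rw [Finset.sum_boole, Finset.filter_univ_mem]
      · simp [hS]
    have h1 := (Finset.sum_le_sum (s := Finset.univ) fun y _ => hle y).trans_eq
      (Finset.mul_sum _ _ _).symm
    rw [key, mul_comm, ← le_div_iff₀ hβ] at h1
    refine h1.trans ?_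
    calc _ = (h / Fintype.card β) * ∑ y : ι → β, (if ∀ a' ∈ S, y a' ∈ H y then (1 : ℝ) else 0) := by
          ring
      _ ≤ (h / Fintype.card β) * ((h / Fintype.card β) ^ S.card * Fintype.card (ι → β)) := by gcongr
      _ = _ := by ring

/-! ### The bounded differences inequality -/

/-- Hoeffding's lemma for a finite average, by the convexity of the exponential function. -/
lemma sum_exp_le_of_abs_le [Nonempty β] (x : β → ℝ) {c : ℝ} (hx : ∀ v, |x v| ≤ c)
    (h0 : ∑ v, x v = 0) : ∑ v, Real.exp (x v) ≤ Fintype.card β * Real.exp (c ^ 2 / 2) := by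
  have hc0 : 0 ≤ c := (abs_nonneg _).trans (hx (Classical.arbitrary β))
  rcases hc0.eq_or_lt with rfl | hc
  · have : ∀ v, x v = 0 := fun v => abs_nonpos_iff.1 (hx v)
    simp [this]
  have hle : ∀ v, Real.exp (x v) ≤ Real.cosh c + x v * (Real.sinh c / c) := by
    intro v
    obtain ⟨h1, h2⟩ := abs_le.1 (hx v)
    have := convexOn_exp.2 (Set.mem_univ c) (Set.mem_univ (-c))
      (show 0 ≤ (c + x v) / (2 * c) by apply div_nonneg <;> linarith)
      (show 0 ≤ (c - x v) / (2 * c) by apply div_nonneg <;> linarith) (by field_simp; ring)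
    simp only [smul_eq_mul] at this
    rw [show (c + x v) / (2 * c) * c + (c - x v) / (2 * c) * -c = x v by field_simp; ring] at this
    refine this.trans_eq ?_
    rw [Real.cosh_eq, Real.sinh_eq]
    field_simp
    ring
  calc ∑ v, Real.exp (x v) ≤ ∑ v, (Real.cosh c + x v * (Real.sinh c / c)) :=
        Finset.sum_le_sum fun v _ => hle v
    _ = Fintype.card β * Real.cosh c := by
        rw [Finset.sum_add_distrib, ← Finset.sum_mul, h0]
        simp
    _ ≤ _ := by
        gcongr
        exact Real.cosh_le_exp_half_sq c

/-- The mean of a real function of a uniformly random function. -/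
noncomputable def mean (f : (ι → β) → ℝ) : ℝ := (∑ y, f y) / (Fintype.card (ι → β) : ℝ)

/-- Hoeffding's lemma for a function whose values differ by at most `c`. -/
lemma sum_exp_le_of_sub_le [Nonempty β] (g : β → ℝ) {c : ℝ} (hg : ∀ v w, |g v - g w| ≤ c) :
    ∑ v, Real.exp (g v) ≤
      Fintype.card β * Real.exp ((∑ v, g v) / Fintype.card β + c ^ 2 / 2) := by
  have hβ : (0 : ℝ) < Fintype.card β := by exact_mod_cast Fintype.card_pos
  set m := (∑ v, g v) / Fintype.card β with hm
  have h1 : ∀ v, |g v - m| ≤ c := by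
    intro v
    have : g v - m = (∑ w, (g v - g w)) / Fintype.card β := by
      rw [Finset.sum_sub_distrib, hm]
      simp only [Finset.sum_const, Finset.card_univ, nsmul_eq_mul]
      field_simp
    rw [this, abs_div, abs_of_pos hβ, div_le_iff₀ hβ]
    refine (Finset.abs_sum_le_sum_abs _ _).trans ?_
    refine (Finset.sum_le_sum fun w _ => hg v w).trans_eq ?_
    simp [mul_comm]
  have h2 := sum_exp_le_of_abs_le (fun v => g v - m) h1 (by
    rw [Finset.sum_sub_distrib, hm]
    simp only [Finset.sum_const, Finset.card_univ, nsmul_eq_mul]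
    field_simp
    ring)
  simp only [Real.exp_sub, ← Finset.sum_div] at h2
  rw [div_le_iff₀ (Real.exp_pos _)] at h2
  rw [Real.exp_add]
  linarith

/-- McDiarmid's inequality in exponential form: if resampling the coordinate `a ∈ S` changes `f` by
at most `c a`, and the other coordinates do not matter, then the exponential moments of `f` are
bounded as for a Gaussian variable of variance `∑ c a ^ 2`. -/
lemma sum_exp_le_of_bounded_differences [Nonempty β] (S : Finset ι) (c : ι → ℝ) (t : ℝ) :
    ∀ f : (ι → β) → ℝ, (∀ a ∈ S, ∀ y v, |f (Function.update y a v) - f y| ≤ c a) →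
      (∀ a ∉ S, ∀ y v, f (Function.update y a v) = f y) →
      ∑ y, Real.exp (t * f y) ≤
        Fintype.card (ι → β) * Real.exp (t * mean f + t ^ 2 / 2 * ∑ a ∈ S, c a ^ 2) := by
  have hβ : (0 : ℝ) < Fintype.card β := by exact_mod_cast Fintype.card_pos
  have hN : (0 : ℝ) < Fintype.card (ι → β) := by exact_mod_cast Fintype.card_pos
  induction S using Finset.induction_on with
  | empty =>
    intro f _ hf
    have hconst : ∀ y y', f y = f y' := by
      intro y y'
      have : ∀ T : Finset ι, f (T.piecewise y' y) = f y := by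
        intro T
        induction T using Finset.induction_on with
        | empty => simp
        | insert a T _ ih =>
          rw [Finset.piecewise_insert, hf a (Finset.notMem_empty a), ih]
      simpa using (this Finset.univ).symm
    have hm : ∀ y, mean f = f y := by
      intro y
      rw [mean, Finset.sum_congr rfl fun y' _ => hconst y' y]
      simp only [Finset.sum_const, Finset.card_univ, nsmul_eq_mul]
      field_simp
    rw [Finset.sum_congr rfl fun y _ => by rw [← hm y]]
    simp
  | insert a S ha ih =>
    intro f hd hf
    -- average over the coordinate `a`; Hoeffding's lemma bounds the loss
    set g : (ι → β) → ℝ := fun y => (∑ v, f (Function.update y a v)) / Fintype.card β with hg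
    have hmean : mean g = mean f := by
      rw [mean, mean, hg, ← Finset.sum_div, sum_sum_update]
      field_simp
    have hga : ∀ y v, g (Function.update y a v) = g y := by
      intro y v
      simp [hg]
    have hdiff : ∀ a' ≠ a, ∀ y v C, (∀ y, |f (Function.update y a' v) - f y| ≤ C) →
        |g (Function.update y a' v) - g y| ≤ C := by
      intro a' ha' y v C hC
      rw [hg]
      simp only
      rw [← sub_div, ← Finset.sum_sub_distrib, abs_div, abs_of_pos hβ, div_le_iff₀ hβ]
      refine (Finset.abs_sum_le_sum_abs _ _).trans ?_
      refine (Finset.sum_le_sum fun w _ => ?_).trans_eq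
        (b := ∑ _w : β, C) (by simp [mul_comm])
      rw [Function.update_comm ha']
      exact hC _
    have h1 := ih g
      (fun a' ha' y v => hdiff a' (by rintro rfl; exact ha ha') y v _ fun y =>
        hd a' (Finset.mem_insert_of_mem ha') y v)
      (fun a' ha' y v => by
        by_cases haa : a' = a
        · rw [haa, hga]
        · have := hdiff a' haa y v 0 fun y => by
            rw [hf a' (by simp [haa, ha']), sub_self, abs_zero]
          linarith [abs_nonpos_iff.1 this])
    have h2 : ∀ y : ι → β, ∑ v, Real.exp (t * f (Function.update y a v)) ≤
        Fintype.card β * Real.exp (t * g y + (t * c a) ^ 2 / 2) := by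
      intro y
      have := sum_exp_le_of_sub_le (fun v => t * f (Function.update y a v)) (c := |t| * c a) (by
        intro v w
        rw [← mul_sub, abs_mul]
        gcongr
        have := hd a (Finset.mem_insert_self _ _) (Function.update y a w) v
        rwa [Function.update_idem] at this)
      rw [← Finset.mul_sum] at this
      convert this using 3
      rw [hg, mul_pow, mul_pow, sq_abs]
      ring
    have h3 := Finset.sum_le_sum fun y (_ : y ∈ (Finset.univ : Finset (ι → β))) => h2 y
    rw [sum_sum_update a fun y => Real.exp (t * f y), ← Finset.mul_sum] at h3
    have h4 := le_of_mul_le_mul_left h3 hβ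
    simp only [Real.exp_add, ← Finset.sum_mul] at h4
    refine h4.trans ?_
    rw [hmean] at h1
    calc _ ≤ (Fintype.card (ι → β) * Real.exp (t * mean f + t ^ 2 / 2 * ∑ a ∈ S, c a ^ 2)) *
          Real.exp ((t * c a) ^ 2 / 2) := by gcongr
      _ = _ := by
        rw [mul_assoc, ← Real.exp_add, Finset.sum_insert ha]
        ring_nf

/-- McDiarmid's inequality. -/
lemma prob_mean_add_lt_le [Nonempty β] (S : Finset ι) (c : ℝ) (f : (ι → β) → ℝ)
    (hd : ∀ a ∈ S, ∀ y v, |f (Function.update y a v) - f y| ≤ c)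
    (hf : ∀ a ∉ S, ∀ y v, f (Function.update y a v) = f y) {V s : ℝ} (hV : 0 < V)
    (hS : S.card * c ^ 2 ≤ V) (hs : 0 ≤ s) :
    prob (fun y => mean f + s < f y) ≤ Real.exp (-(s ^ 2 / (2 * V))) := by
  classical
  have hN : (0 : ℝ) < Fintype.card (ι → β) := by exact_mod_cast Fintype.card_pos
  -- the parameter that optimizes the bound on the exponential moment
  set t := s / V with ht
  have ht0 : 0 ≤ t := by positivity
  have h1 := sum_exp_le_of_bounded_differences S (fun _ => c) t f hd hf
  have h2 : (∑ y, if mean f + s < f y then (1 : ℝ) else 0) * Real.exp (t * (mean f + s)) ≤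
      ∑ y, Real.exp (t * f y) := by
    rw [Finset.sum_mul]
    refine Finset.sum_le_sum fun y _ => ?_
    split_ifs with h
    · rw [one_mul]
      gcongr
    · simp [Real.exp_nonneg]
  rw [prob_eq_sum, div_le_iff₀ hN, ← mul_le_mul_iff_left₀ (Real.exp_pos (t * (mean f + s)))]
  refine (h2.trans h1).trans ?_
  rw [mul_comm (Real.exp _), mul_assoc, ← Real.exp_add]
  refine mul_le_mul_of_nonneg_left (Real.exp_le_exp.2 ?_) hN.le
  rw [Finset.sum_const, nsmul_eq_mul]
  have h3 : t ^ 2 / 2 * (S.card * c ^ 2) ≤ t ^ 2 / 2 * V := by gcongr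
  have h4 : t ^ 2 / 2 * V = s ^ 2 / (2 * V) := by
    rw [ht]
    field_simp
  have h5 : t * s = s ^ 2 / V := by
    rw [ht]
    ring
  have h6 : s ^ 2 / V = s ^ 2 / (2 * V) + s ^ 2 / (2 * V) := by
    field_simp
    ring
  nlinarith

lemma mean_sum_boole_le {κ : Type*} (T : Finset κ) (p : κ → (ι → β) → Prop)
    [∀ k, DecidablePred (p k)] {x : ℝ} (h : ∀ k ∈ T, prob (p k) ≤ x) :
    mean (fun y => ∑ k ∈ T, if p k y then (1 : ℝ) else 0) ≤ T.card * x := by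
  rw [mean, Finset.sum_comm, Finset.sum_div]
  refine (Finset.sum_le_sum fun k hk => ?_).trans_eq (b := ∑ _k ∈ T, x) (by simp)
  rw [← prob_eq_sum]
  exact h k hk

end FiniteProbability

/-! ### Sorting the balls of a round -/

lemma sqrt_logb_le {n : ℕ} (hn : 1 ≤ n) : √(Real.logb 2 n) ≤ n := by
  have h1 : (1 : ℝ) ≤ n := by exact_mod_cast hn
  refine Real.sqrt_le_iff.2 ⟨by positivity, ?_⟩
  rw [Real.logb_le_iff_le_rpow (by norm_num) (by positivity)]
  calc (n : ℝ) ≤ 2 ^ n := by exact_mod_cast Nat.lt_two_pow_self.le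
    _ = (2 : ℝ) ^ (n : ℝ) := by rw [Real.rpow_natCast]
    _ ≤ _ := Real.rpow_le_rpow_of_exponent_le (by norm_num) (by nlinarith)

lemma numRequests_le {n : ℕ} (hn : 1 ≤ n) : ∀ i, numRequests n i ≤ n
  | 0 => by simp [numRequests, kSeq]
  | 1 => by rwa [numRequests_one]
  | i + 2 => by
    have : kSeq n (i + 2) ≤ n := (min_le_right _ _).trans (sqrt_logb_le hn)
    exact Nat.floor_le_of_le this

/-- The coordinates of the random choices that are relevant for an execution: the first `n`
requests of every ball in the rounds up to `n`. Round `0` is included for convenience. -/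
abbrev Coord (n : ℕ) : Type := Fin (n + 1) × Fin n × Fin n

/-- Finite tables of random choices, with one row for every round. A row consists of `n` blocks,
each of which holds the bins contacted by one ball. -/
abbrev Slots (n : ℕ) : Type := Coord n → Fin n

namespace EntryProcess

variable {n : ℕ} (D : EntryProcess n) (prio : Fin n → ℕ)

/-- The time when ball `j` enters round `i`, and `⊤` if this does not happen. -/
noncomputable def entryTime (ω : Tape n) (i : ℕ) (j : Fin n) : ℕ∞ :=
  ⨅ (t : ℕ) (_ : D.entered ω t i j), (t : ℕ∞)

lemma entryTime_le_iff {ω : Tape n} {t i : ℕ} {j : Fin n} :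
    D.entryTime ω i j ≤ t ↔ D.entered ω t i j := by
  refine ⟨fun h => ?_, fun h => iInf₂_le t h⟩
  by_contra hn
  have : ((t + 1 : ℕ) : ℕ∞) ≤ D.entryTime ω i j := le_iInf₂ fun t' ht' => by
    by_contra hlt
    exact hn (D.mono (by simp only [Nat.cast_le] at hlt; omega) ht')
  have := this.trans h
  rw [Nat.cast_le] at this
  omega

lemma entryTime_congr {ω ω' : Tape n} {t : ℕ}
    (h : ∀ s ≤ t, ∀ i j, D.entered ω s i j ↔ D.entered ω' s i j) {i : ℕ} {j : Fin n}
    (ht : D.entered ω t i j) : D.entryTime ω i j = D.entryTime ω' i j := by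
  refine le_antisymm ?_ ?_
  · refine le_iInf₂ fun s hs => ?_
    rcases le_total s t with hst | hst
    · exact D.entryTime_le_iff.2 ((h s hst i j).2 hs)
    · exact (D.entryTime_le_iff.2 ht).trans (Nat.cast_le.2 hst)
  · have ht' := (h t le_rfl i j).1 ht
    refine le_iInf₂ fun s hs => ?_
    rcases le_total s t with hst | hst
    · exact D.entryTime_le_iff.2 ((h s hst i j).1 hs)
    · exact (D.entryTime_le_iff.2 ht').trans (Nat.cast_le.2 hst)

/-- In each round, the balls are sorted by their priorities (balls of low value come first), balls
of the same priority by the times when they enter the round, and ties are broken arbitrarily. -/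
noncomputable def key (ω : Tape n) (i : ℕ) (j : Fin n) : ℕ ×ₗ (ℕ∞ ×ₗ Fin n) :=
  toLex (prio j, toLex (D.entryTime ω i j, j))

lemma key_lt_key_iff {ω : Tape n} {i : ℕ} {j j' : Fin n} :
    D.key prio ω i j' < D.key prio ω i j ↔ prio j' < prio j ∨ prio j' = prio j ∧
      (D.entryTime ω i j' < D.entryTime ω i j ∨
        D.entryTime ω i j' = D.entryTime ω i j ∧ j' < j) := by
  simp [key, Prod.Lex.toLex_lt_toLex]

lemma key_injective (ω : Tape n) (i : ℕ) : Function.Injective (D.key prio ω i) := by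
  intro j j' h
  simpa [key] using congrArg (fun a => (ofLex (ofLex a).2).2) h

lemma card_key_lt (ω : Tape n) (i : ℕ) (j : Fin n) :
    (Finset.univ.filter fun j' => D.key prio ω i j' < D.key prio ω i j).card < n := by
  have := Finset.card_lt_card (Finset.filter_ssubset (s := Finset.univ)
    (p := fun j' => D.key prio ω i j' < D.key prio ω i j) |>.2 ⟨j, Finset.mem_univ j, lt_irrefl _⟩)
  simpa using this

/-- The position of ball `j` in the order of round `i`. -/
noncomputable def rank (ω : Tape n) (i : ℕ) (j : Fin n) : Fin n :=
  ⟨_, D.card_key_lt prio ω i j⟩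

lemma rank_bijective (ω : Tape n) (i : ℕ) : Function.Bijective (D.rank prio ω i) := by
  rw [Fintype.bijective_iff_injective_and_card]
  refine ⟨?_, rfl⟩
  have hmono : ∀ j j', D.key prio ω i j < D.key prio ω i j' →
      D.rank prio ω i j ≠ D.rank prio ω i j' := by
    intro j j' h
    refine ne_of_lt (Fin.lt_def.2 ?_)
    simp only [rank]
    refine Finset.card_lt_card ⟨fun a ha => ?_, fun hs => ?_⟩
    · simp only [Finset.mem_filter, Finset.mem_univ, true_and] at ha ⊢
      exact ha.trans h
    · have := hs (x := j) (by simpa using h)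
      simp at this
  intro j j' h
  by_contra hne
  rcases lt_or_gt_of_ne ((D.key_injective prio ω i).ne hne) with h' | h'
  · exact hmono _ _ h' h
  · exact hmono _ _ h' h.symm

/-- `rank` as a permutation. -/
noncomputable def rankEquiv (ω : Tape n) (i : ℕ) : Fin n ≃ Fin n :=
  Equiv.ofBijective _ (D.rank_bijective prio ω i)

/-- The rearranged random choices: in every row, the blocks of the balls are sorted by `rank`. As
the adversary only decides in which order the balls enter the rounds, this removes its influence on
the random choices. -/
noncomputable def slots (ω : Tape n) : Slots n :=
  fun a => ω (a.1, (D.rankEquiv prio ω a.1).symm a.2.1, a.2.2)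

lemma slots_rank (ω : Tape n) (i : Fin (n + 1)) (j l : Fin n) :
    D.slots prio ω (i, D.rank prio ω i j, l) = ω (i, j, l) := by
  have : (D.rankEquiv prio ω i).symm (D.rank prio ω i j) = j :=
    (D.rankEquiv prio ω i).symm_apply_apply j
  simp [slots, this]

/-- The position of a ball is known as soon as the ball enters the round: balls that enter later do
not matter. -/
lemma rank_congr {ω ω' : Tape n} {t : ℕ}
    (h : ∀ s ≤ t, ∀ i j, D.entered ω s i j ↔ D.entered ω' s i j) {i : ℕ} {j : Fin n}
    (ht : D.entered ω t i j) : D.rank prio ω i j = D.rank prio ω' i j := by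
  have hj := D.entryTime_congr h ht
  have hjt := D.entryTime_le_iff.2 ht
  simp only [rank, Fin.mk.injEq]
  refine congrArg Finset.card (Finset.filter_congr fun j' _ => ?_)
  rw [key_lt_key_iff, key_lt_key_iff]
  refine or_congr_right (and_congr_right fun _ => ?_)
  by_cases hj' : D.entered ω t i j'
  · rw [D.entryTime_congr h hj', hj]
  · have hj'' := hj'
    rw [h t le_rfl] at hj''
    rw [← entryTime_le_iff, not_le] at hj' hj''
    have h1 := hjt.trans_lt hj'
    have h2 := (hj ▸ hjt).trans_lt hj''
    simp [h1.not_gt, h2.not_gt, h1.ne', h2.ne']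

/-- The entries are determined by the random choices made upon the entries. -/
lemma entered_congr {ω ω' : Tape n}
    (h : ∀ t, (∀ s ≤ t, ∀ i j, D.entered ω s i j ↔ D.entered ω' s i j) →
      ∀ i j l, D.entered ω t i j → l < numRequests n i → ω (i, j, l) = ω' (i, j, l)) (t : ℕ) :
    ∀ i j, D.entered ω t i j ↔ D.entered ω' t i j := by
  suffices ∀ t, ∀ s ≤ t, ∀ i j, D.entered ω s i j ↔ D.entered ω' s i j from this t t le_rfl
  intro t
  induction t with
  | zero =>
    intro s hs i j
    obtain rfl : s = 0 := by omega
    exact ⟨D.zero, D.zero⟩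
  | succ t ih =>
    intro s hs i j
    rcases hs.lt_or_eq with hs | rfl
    · exact ih s (by omega) i j
    · have ht := h t ih
      exact ⟨D.succ ht, D.succ fun i j l hi hl => (ht i j l ((ih t le_rfl i j).2 hi) hl).symm⟩

end EntryProcess

/-- The relevant part of a tape. -/
def tapeRestrict {n : ℕ} (ω : Tape n) : Slots n := fun a => ω (a.1, a.2.1, a.2.2)

/-- The extension of a table to a tape; its values at the irrelevant coordinates do not matter. -/
def tapeExtend {n : ℕ} (x : Slots n) : Tape n := fun a =>
  if h : a.1 < n + 1 ∧ a.2.2 < n then x (⟨a.1, h.1⟩, a.2.1, ⟨a.2.2, h.2⟩) else a.2.1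

lemma tapeExtend_apply {n : ℕ} (x : Slots n) (i : Fin (n + 1)) (j l : Fin n) :
    tapeExtend x (i, j, l) = x (i, j, l) := by
  simp only [tapeExtend, i.isLt, l.isLt, and_self, dite_true]

namespace EntryProcess

variable {n : ℕ} (D : EntryProcess n) (prio : Fin n → ℕ)

/-- The entries only depend on the relevant part of the tape. -/
lemma entered_tapeExtend (ω : Tape n) (t i : ℕ) (j : Fin n) :
    D.entered ω t i j ↔ D.entered (tapeExtend (tapeRestrict ω)) t i j := by
  refine D.entered_congr (fun t _ i j l hi hl => ?_) t i j
  have h1 : i < n + 1 := Nat.lt_succ_of_le (Active.le (D := D) ⟨t, hi⟩)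
  have h2 : l < n := hl.trans_le (numRequests_le j.pos i)
  exact (tapeExtend_apply (tapeRestrict ω) ⟨i, h1⟩ j ⟨l, h2⟩).symm

lemma active_tapeExtend (ω : Tape n) (i : ℕ) (j : Fin n) :
    D.Active ω i j ↔ D.Active (tapeExtend (tapeRestrict ω)) i j :=
  exists_congr fun t => D.entered_tapeExtend ω t i j

lemma rank_eq_of_entered {ω ω' : Tape n} (h : ∀ t i j, D.entered ω t i j ↔ D.entered ω' t i j)
    (i : ℕ) (j : Fin n) : D.rank prio ω i j = D.rank prio ω' i j := by
  have : ∀ i j, D.entryTime ω i j = D.entryTime ω' i j := by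
    intro i j
    simp only [entryTime, h]
  simp only [rank, Fin.mk.injEq]
  refine congrArg Finset.card (Finset.filter_congr fun j' _ => ?_)
  rw [key_lt_key_iff, key_lt_key_iff, this, this]

lemma slots_tapeExtend (ω : Tape n) :
    D.slots prio ω = D.slots prio (tapeExtend (tapeRestrict ω)) := by
  ext1 ⟨i, p, l⟩
  obtain ⟨j, rfl⟩ := (D.rank_bijective prio ω i).2 p
  rw [slots_rank, D.rank_eq_of_entered prio (D.entered_tapeExtend ω), slots_rank, tapeExtend_apply]
  rfl

/-- An execution can be reconstructed from the rearranged random choices: when a ball enters a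
round, its position is determined by the past, so the block with its new random choices is known. -/
lemma slots_tapeExtend_injective :
    Function.Injective fun x : Slots n => D.slots prio (tapeExtend x) := by
  intro x x' h
  have hent := D.entered_congr (ω := tapeExtend x) (ω' := tapeExtend x') fun t ht i j l hi hl => by
    have h1 : i < n + 1 := Nat.lt_succ_of_le (Active.le (D := D) ⟨t, hi⟩)
    have h2 : l < n := hl.trans_le (numRequests_le j.pos i)
    have h3 := D.slots_rank prio (tapeExtend x) ⟨i, h1⟩ j ⟨l, h2⟩
    have h4 := D.slots_rank prio (tapeExtend x') ⟨i, h1⟩ j ⟨l, h2⟩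
    have h5 := D.rank_congr prio ht hi
    simp only at h3 h4 h
    rw [← h3, ← h4, h5, h]
  ext1 ⟨i, j, l⟩
  have h3 := D.slots_rank prio (tapeExtend x) i j l
  have h4 := D.slots_rank prio (tapeExtend x') i j l
  simp only at h
  rw [D.rank_eq_of_entered prio hent, h, h4, tapeExtend_apply, tapeExtend_apply] at h3
  exact h3.symm

end EntryProcess

/-! ### The law of the rearranged random choices -/

section Law

variable {n : ℕ}

lemma measurable_tapeRestrict : Measurable (tapeRestrict (n := n)) :=
  measurable_pi_lambda _ fun _ => measurable_pi_apply _

lemma measurableSet_tapeRestrict (p : Slots n → Prop) :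
    MeasurableSet {ω : Tape n | p (tapeRestrict ω)} :=
  measurable_tapeRestrict (Set.toFinite {x | p x}).measurableSet

instance [NeZero n] : IsProbabilityMeasure (tapeLaw n) := by
  unfold tapeLaw
  infer_instance

/-- All tables have the same probability. -/
lemma exists_tapeLaw_eq [NeZero n] :
    ∃ c : ℝ≥0∞, ∀ x : Slots n, tapeLaw n {ω | tapeRestrict ω = x} = c := by
  classical
  let e : Coord n → ℕ × Fin n × ℕ := fun a => (a.1, a.2.1, a.2.2)
  refine ⟨∏ a ∈ Finset.univ.image e, (n : ℝ≥0∞)⁻¹, fun x => ?_⟩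
  have : {ω : Tape n | tapeRestrict ω = x} =
      Set.pi (Finset.univ.image e) fun a => {tapeExtend x a} := by
    ext ω
    simp only [Set.mem_ofPred_eq, funext_iff, Set.mem_pi, Finset.coe_image, Finset.coe_univ,
      Set.image_univ, Set.forall_mem_range, Set.mem_singleton_iff]
    refine forall_congr' fun a => ?_
    rw [show tapeExtend x (e a) = x a from tapeExtend_apply x _ _ _]
    rfl
  rw [this, tapeLaw, Measure.infinitePi_pi]
  · refine Finset.prod_congr rfl fun a _ => ?_
    rw [ProbabilityTheory.uniformOn_univ]
    simp
  · exact fun _ _ => measurableSet_singleton _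

/-- The rearranged random choices are uniformly distributed: since the rearrangement of finite
tables is injective, it is a bijection. -/
lemma tapeLaw_slots [NeZero n] (D : EntryProcess n) (prio : Fin n → ℕ) (p : Slots n → Prop) :
    (tapeLaw n).real {ω | p (D.slots prio ω)} = prob p := by
  classical
  obtain ⟨c, hc⟩ := exists_tapeLaw_eq (n := n)
  have hsum : ∀ q : Slots n → Prop, tapeLaw n {ω | q (tapeRestrict ω)} =
      (Finset.univ.filter q).card * c := by
    intro q
    have : {ω : Tape n | q (tapeRestrict ω)} =
        ⋃ x ∈ Finset.univ.filter q, {ω | tapeRestrict ω = x} := by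
      ext ω
      simp
    rw [this, measure_biUnion_finset]
    · simp [hc]
    · intro x _ x' _ hne
      refine Set.disjoint_left.2 fun ω h h' => hne ?_
      exact h.symm.trans h'
    · exact fun x _ => measurableSet_tapeRestrict fun y => y = x
  have hone : (Fintype.card (Slots n) : ℝ≥0∞) * c = 1 := by
    have := hsum fun _ => True
    simpa using this.symm
  have hbij : Function.Bijective fun x : Slots n => D.slots prio (tapeExtend x) :=
    Finite.injective_iff_bijective.1 (D.slots_tapeExtend_injective prio)
  have hcard : (Finset.univ.filter fun x : Slots n => p (D.slots prio (tapeExtend x))).card =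
      (Finset.univ.filter p).card := by
    refine Finset.card_bij (fun x _ => D.slots prio (tapeExtend x)) (fun x hx => by simpa using hx)
      (fun x _ x' _ h => hbij.1 h) fun y hy => ?_
    obtain ⟨x, rfl⟩ := hbij.2 y
    exact ⟨x, by simpa using hy, rfl⟩
  have h1 : tapeLaw n {ω | p (D.slots prio ω)} = (Finset.univ.filter p).card * c := by
    rw [← hcard, ← hsum]
    congr 1
    ext ω
    simp only [Set.mem_ofPred_eq]
    rw [D.slots_tapeExtend]
  have hc' : c = (Fintype.card (Slots n) : ℝ≥0∞)⁻¹ :=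
    ENNReal.eq_inv_of_mul_eq_one_left (by rwa [mul_comm])
  rw [measureReal_def, h1, prob, hc', ENNReal.toReal_mul, ENNReal.toReal_inv, div_eq_mul_inv]
  simp only [ENNReal.toReal_natCast]

lemma measurableSet_slots (D : EntryProcess n) (prio : Fin n → ℕ) (p : Slots n → Prop) :
    MeasurableSet {ω | p (D.slots prio ω)} := by
  have := measurableSet_tapeRestrict fun x => p (D.slots prio (tapeExtend x))
  simpa only [← D.slots_tapeExtend] using this

lemma measurableSet_active (D : EntryProcess n) (i : ℕ) (j : Fin n) :
    MeasurableSet {ω | D.Active ω i j} := by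
  have := measurableSet_tapeRestrict fun x => D.Active (tapeExtend x) i j
  simpa only [← D.active_tapeExtend] using this

end Law

/-! ### Collisions in the rearranged tables -/

section Collisions

variable {n : ℕ}

/-- Each of the first `K` entries of block `t` in row `i` also occurs among the first `K` entries
of another one of the first `M` blocks. -/
def Covered (i : Fin (n + 1)) (M K : ℕ) (t : Fin n) (y : Slots n) : Prop :=
  ∀ l : Fin n, (l : ℕ) < K → ∃ t' l' : Fin n, t' ≠ t ∧ (t' : ℕ) < M ∧ (l' : ℕ) < K ∧
    y (i, t', l') = y (i, t, l)

open Classical in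
/-- The number of covered blocks among the first `M` blocks. -/
noncomputable def coveredCount (i : Fin (n + 1)) (M K : ℕ) (y : Slots n) : ℕ :=
  (Finset.univ.filter fun t : Fin n => (t : ℕ) < M ∧ Covered i M K t y).card

lemma card_filter_val_lt_le (M : ℕ) :
    (Finset.univ.filter fun t : Fin n => (t : ℕ) < M).card ≤ M := by
  rw [Fin.card_filter_val_lt]
  exact min_le_right _ _

/-- Given the other blocks, each of the `K` entries of block `t` has to hit a set of at most `M K`
bins. -/
lemma prob_covered_le [NeZero n] (i : Fin (n + 1)) (M : ℕ) {K : ℕ} (hK : K ≤ n) (t : Fin n) :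
    prob (Covered i M K t) ≤ (M * K / n : ℝ) ^ K := by
  classical
  let S : Finset (Coord n) :=
    (Finset.univ.filter fun l : Fin n => (l : ℕ) < K).image fun l => (i, t, l)
  let B : Finset (Fin n × Fin n) :=
    (Finset.univ.filter fun t' : Fin n => (t' : ℕ) < M) ×ˢ
      (Finset.univ.filter fun l : Fin n => (l : ℕ) < K)
  let H : Slots n → Finset (Fin n) := fun y =>
    (B.filter fun a => a.1 ≠ t).image fun a => y (i, a.1, a.2)
  have hS : S.card = K := by
    rw [Finset.card_image_of_injective _ fun l l' h => by simpa using h, Fin.card_filter_val_lt,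
      min_eq_right hK]
  have h := prob_forall_mem_le S H (fun a ha y v => by
      obtain ⟨l, -, rfl⟩ := Finset.mem_image.1 ha
      refine Finset.image_congr fun b hb => ?_
      have hb : b.1 ≠ t := (Finset.mem_filter.1 hb).2
      exact Function.update_of_ne (fun e => hb (congrArg (fun a => a.2.1) e)) _ _)
    (M * K) (fun y => by
      have : (H y).card ≤ M * K := by
        refine Finset.card_image_le.trans ((Finset.card_filter_le _ _).trans ?_)
        rw [Finset.card_product]
        exact Nat.mul_le_mul (card_filter_val_lt_le M) (card_filter_val_lt_le K)
      exact_mod_cast this)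
  rw [hS, Fintype.card_fin] at h
  refine (prob_mono fun y hy => ?_).trans h
  intro a ha
  obtain ⟨l, hl, rfl⟩ := Finset.mem_image.1 ha
  obtain ⟨t', l', h1, h2, h3, h4⟩ := hy l (Finset.mem_filter.1 hl).2
  refine Finset.mem_image.2 ⟨(t', l'), ?_, h4⟩
  simp [B, h1, h2, h3]

/-- If `y a` is changed to `v`, then besides the block of `a` itself only one block can become
covered: such a block contains `v`, and is the only one to do so before the change. -/
lemma coveredCount_update_le (i : Fin (n + 1)) (M K : ℕ) (a : Coord n) (y : Slots n) (v : Fin n) :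
    coveredCount i M K (Function.update y a v) ≤ coveredCount i M K y + 2 := by
  classical
  set y' := Function.update y a v with hy'
  obtain ⟨i₀, t₀, l₀⟩ := a
  have hne : ∀ t l, t ≠ t₀ → y' (i, t, l) = y (i, t, l) := fun t l h =>
    Function.update_of_ne (by simp [h]) _ _
  let A : Finset (Fin n) := Finset.univ.filter fun t : Fin n => (t : ℕ) < M ∧ Covered i M K t y
  let A' : Finset (Fin n) := Finset.univ.filter fun t : Fin n => (t : ℕ) < M ∧ Covered i M K t y'
  have key : ∀ t ∈ A' \ insert t₀ A, ∃ l : Fin n, (l : ℕ) < K ∧ (t : ℕ) < M ∧ y (i, t, l) = v ∧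
      ∀ t' l' : Fin n, t' ≠ t → (t' : ℕ) < M → (l' : ℕ) < K → y (i, t', l') ≠ v := by
    intro t ht
    simp only [A, A', Finset.mem_sdiff, Finset.mem_filter, Finset.mem_univ, true_and,
      Finset.mem_insert, not_or, not_and] at ht
    obtain ⟨⟨h1, h2⟩, h3, h4⟩ := ht
    have h4 := h4 h1
    unfold Covered at h4
    push Not at h4
    obtain ⟨l, hl, h4⟩ := h4
    obtain ⟨t', l', h5, h6, h7, h8⟩ := h2 l hl
    rw [hne t l h3] at h8
    have h9 : y' (i, t', l') ≠ y (i, t', l') := fun h => h4 t' l' h5 h6 h7 (h ▸ h8)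
    have h10 : (i, t', l') = (i₀, t₀, l₀) := by
      by_contra hh
      exact h9 (Function.update_of_ne hh _ _)
    have h11 : y (i, t, l) = v := by
      rw [← h8, h10]
      exact Function.update_self _ _ _
    exact ⟨l, hl, h1, h11, h11 ▸ h4⟩
  have hone : (A' \ insert t₀ A).card ≤ 1 := by
    refine Finset.card_le_one.2 fun t ht t' ht' => ?_
    by_contra htt
    obtain ⟨l, h1, h2, h3, -⟩ := key t ht
    obtain ⟨-, -, -, -, h4⟩ := key t' ht'
    exact h4 t l htt h2 h1 h3
  have h1 : A'.card ≤ (A' \ insert t₀ A).card + (insert t₀ A).card :=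
    Finset.card_le_card_sdiff_add_card
  have h2 := Finset.card_insert_le t₀ A
  have h3 : coveredCount i M K y' = A'.card := by simp only [coveredCount, A']
  have h4 : coveredCount i M K y = A.card := by simp only [coveredCount, A]
  omega

/-- Concentration of the number of covered blocks. -/
lemma prob_lt_coveredCount_le [NeZero n] (i : Fin (n + 1)) {M K : ℕ} (hK : K ≤ n)
    (hMK : M * K ≤ n) {s : ℝ} (hs : 0 ≤ s) :
    prob (fun y : Slots n => M * (M * K / n : ℝ) ^ K + s < coveredCount i M K y) ≤
      Real.exp (-(s ^ 2 / (8 * n))) := by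
  classical
  have hn : (0 : ℝ) < n := by exact_mod_cast NeZero.pos n
  let S : Finset (Coord n) := ((Finset.univ.filter fun t' : Fin n => (t' : ℕ) < M) ×ˢ
      (Finset.univ.filter fun l : Fin n => (l : ℕ) < K)).image fun a => (i, a.1, a.2)
  have hS : S.card ≤ n := by
    refine Finset.card_image_le.trans ?_
    rw [Finset.card_product]
    exact (Nat.mul_le_mul (card_filter_val_lt_le M) (card_filter_val_lt_le K)).trans hMK
  have h := prob_mean_add_lt_le S 2 (fun y : Slots n => (coveredCount i M K y : ℝ))
    (fun a _ y v => by
      have h1 := coveredCount_update_le i M K a y v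
      have h2 := coveredCount_update_le i M K a (Function.update y a v) (y a)
      rw [Function.update_idem, Function.update_eq_self] at h2
      have h1 : (coveredCount i M K (Function.update y a v) : ℝ) ≤ coveredCount i M K y + 2 := by
        exact_mod_cast h1
      have h2 : (coveredCount i M K y : ℝ) ≤ coveredCount i M K (Function.update y a v) + 2 := by
        exact_mod_cast h2
      rw [abs_le]
      constructor <;> linarith)
    (fun a ha y v => by
      congr 1
      have hne : ∀ t l : Fin n, (t : ℕ) < M → (l : ℕ) < K →
          Function.update y a v (i, t, l) = y (i, t, l) := by
        intro t l ht hl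
        refine Function.update_of_ne ?_ _ _
        rintro rfl
        exact ha (Finset.mem_image.2 ⟨(t, l), by simp [ht, hl], rfl⟩)
      refine congrArg Finset.card (Finset.filter_congr fun t _ => and_congr_right fun ht => ?_)
      refine forall₂_congr fun l hl => exists₂_congr fun t' l' => and_congr_right fun _ =>
        and_congr_right fun ht' => and_congr_right fun hl' => ?_
      rw [hne _ _ ht hl, hne _ _ ht' hl'])
    (V := 4 * n) (s := s) (by positivity)
    (by
      have : (S.card : ℝ) ≤ n := by exact_mod_cast hS
      linarith) hs
  refine le_trans (prob_mono fun y hy => ?_) (h.trans_eq (by ring_nf))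
  refine lt_of_le_of_lt ?_ hy
  gcongr
  have hm := mean_sum_boole_le (Finset.univ.filter fun t : Fin n => (t : ℕ) < M)
    (fun t => Covered i M K t) (x := (M * K / n : ℝ) ^ K) fun t _ => prob_covered_le i M hK t
  have heq : (fun y : Slots n => (coveredCount i M K y : ℝ)) = fun y =>
      ∑ t ∈ Finset.univ.filter fun t : Fin n => (t : ℕ) < M,
        if Covered i M K t y then (1 : ℝ) else 0 := by
    ext y
    rw [Finset.sum_boole, Finset.filter_filter, coveredCount]
  rw [heq]
  refine hm.trans ?_
  gcongr
  exact card_filter_val_lt_le M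

/-- With high probability, uniformly random requests of `n` balls reach a constant fraction of the
bins. -/
lemma prob_card_image_le [NeZero n] (i : Fin (n + 1)) (l : Fin n) {h : ℝ} (hh : 0 ≤ h) :
    prob (fun y : Slots n => ((Finset.univ.image fun t => y (i, t, l)).card : ℝ) ≤ h) ≤
      2 ^ n * (h / n) ^ n := by
  classical
  let S : Finset (Coord n) := Finset.univ.image fun t : Fin n => (i, t, l)
  have hS : S.card = n := by
    rw [Finset.card_image_of_injective _ fun t t' h => by simpa using h, Finset.card_fin]
  let T : Finset (Finset (Fin n)) := Finset.univ.filter fun B => (B.card : ℝ) ≤ h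
  have h1 : ∀ B ∈ T, prob (fun y : Slots n => ∀ a ∈ S, y a ∈ B) ≤ (h / n) ^ n := by
    intro B hB
    have := prob_forall_mem_le S (fun _ => B) (fun _ _ _ _ => rfl) h fun _ =>
      (Finset.mem_filter.1 hB).2
    rwa [hS, Fintype.card_fin] at this
  calc _ ≤ prob (fun y : Slots n => ∃ B ∈ T, ∀ a ∈ S, y a ∈ B) := by
        refine prob_mono fun y hy => ⟨Finset.univ.image fun t => y (i, t, l), ?_, ?_⟩
        · exact Finset.mem_filter.2 ⟨Finset.mem_univ _, hy⟩
        · intro a ha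
          obtain ⟨t, -, rfl⟩ := Finset.mem_image.1 ha
          exact Finset.mem_image.2 ⟨t, Finset.mem_univ _, rfl⟩
    _ ≤ ∑ B ∈ T, prob (fun y : Slots n => ∀ a ∈ S, y a ∈ B) := prob_exists_mem_le T _
    _ ≤ T.card * (h / n) ^ n := by
        rw [← nsmul_eq_mul]
        exact Finset.sum_le_card_nsmul _ _ _ h1
    _ ≤ _ := by
        gcongr
        have : T.card ≤ 2 ^ n := by
          refine (Finset.card_le_univ T).trans_eq ?_
          rw [Fintype.card_finset, Fintype.card_fin]
        exact_mod_cast this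

/-- Union bound for the event that at least `r` of the random choices in `A` coincide with `b`. -/
lemma prob_le_card_filter_eq_le [NeZero n] (A : Finset (Coord n)) (b : Fin n) (r : ℕ) :
    prob (fun y : Slots n => r ≤ (A.filter fun a => y a = b).card) ≤
      A.card.choose r * (1 / n : ℝ) ^ r := by
  classical
  have h1 : ∀ B ∈ A.powersetCard r, prob (fun y : Slots n => ∀ a ∈ B, y a ∈ ({b} : Finset _)) ≤
      (1 / n : ℝ) ^ r := by
    intro B hB
    have := prob_forall_mem_le (ι := Coord n) B (fun _ => {b}) (fun _ _ _ _ => rfl) 1 fun _ => by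
      simp
    rwa [(Finset.mem_powersetCard.1 hB).2, Fintype.card_fin] at this
  calc _ ≤ prob (fun y : Slots n => ∃ B ∈ A.powersetCard r, ∀ a ∈ B, y a ∈ ({b} : Finset _)) := by
        refine prob_mono fun y hy => ?_
        obtain ⟨B, hB, hBr⟩ := Finset.exists_subset_card_eq hy
        refine ⟨B, Finset.mem_powersetCard.2 ⟨hB.trans (Finset.filter_subset _ _), hBr⟩, ?_⟩
        intro a ha
        simpa using (Finset.mem_filter.1 (hB ha)).2
    _ ≤ ∑ B ∈ A.powersetCard r, prob (fun y : Slots n => ∀ a ∈ B, y a ∈ ({b} : Finset _)) :=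
        prob_exists_mem_le _ _
    _ ≤ (A.powersetCard r).card * (1 / n : ℝ) ^ r := by
        rw [← nsmul_eq_mul]
        exact Finset.sum_le_card_nsmul _ _ _ h1
    _ = _ := by rw [Finset.card_powersetCard]

lemma prob_eq_apply_le [NeZero n] (a : Coord n) (b : Fin n) :
    prob (fun y : Slots n => y a = b) ≤ 1 / n := by
  have := prob_forall_mem_le (ι := Coord n) {a} (fun _ => {b}) (fun _ _ _ _ => rfl) 1 fun _ => by
    simp
  simpa using this

end Collisions

/-! ### The sequence of the numbers of requests -/

section KSeq

variable {n : ℕ}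

lemma kSeq_le_sqrt (hn : 2 ≤ n) : ∀ {i : ℕ}, 1 ≤ i → kSeq n i ≤ √(Real.logb 2 n)
  | 1, _ => one_le_sqrt_logb hn
  | _ + 2, _ => min_le_right _ _

lemma kSeq_succ {i : ℕ} (hi : 1 ≤ i) : kSeq n (i + 1) =
    min (kSeq n i * Real.exp ((numRequests n i : ℝ) / 5)) √(Real.logb 2 n) := by
  obtain ⟨i, rfl⟩ : ∃ i', i = i' + 1 := ⟨i - 1, by omega⟩
  rfl

lemma numRequests_le_kSeq (hn : 2 ≤ n) {i : ℕ} (hi : 1 ≤ i) : (numRequests n i : ℝ) ≤ kSeq n i :=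
  Nat.floor_le (zero_le_one.trans (one_le_kSeq hn hi))

lemma kSeq_lt (i : ℕ) : kSeq n i < numRequests n i + 1 := Nat.lt_floor_add_one _

lemma six_fifths_le_exp : (6 / 5 : ℝ) ≤ Real.exp (1 / 5) := by
  linarith [Real.add_one_le_exp (1 / 5 : ℝ)]

lemma exp_fifth_le : Real.exp (1 / 5) ≤ 12215 / 10000 := by
  have h1 : Real.exp (1 / 5) ^ 5 = Real.exp 1 := by
    rw [← Real.exp_nat_mul]
    norm_num
  by_contra! h
  have h2 : (12215 / 10000 : ℝ) ^ 5 < Real.exp (1 / 5) ^ 5 := by gcongr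
  rw [h1] at h2
  have := Real.exp_one_lt_d9
  norm_num at h2
  linarith

lemma min_le_kSeq_succ (hn : 2 ≤ n) {i : ℕ} (hi : 1 ≤ i) :
    min (6 / 5 * kSeq n i) √(Real.logb 2 n) ≤ kSeq n (i + 1) := by
  rw [kSeq_succ hi]
  refine min_le_min_right _ ?_
  have h1 : (1 : ℝ) ≤ numRequests n i := by exact_mod_cast one_le_numRequests hn hi
  have h2 : (6 / 5 : ℝ) ≤ Real.exp ((numRequests n i : ℝ) / 5) :=
    six_fifths_le_exp.trans (Real.exp_le_exp.2 (by linarith))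
  have h3 := one_le_kSeq hn hi
  nlinarith

lemma kSeq_succ_eq_sqrt (hn : 2 ≤ n) {i : ℕ} (hi : 1 ≤ i)
    (h : kSeq n i = √(Real.logb 2 n)) : kSeq n (i + 1) = √(Real.logb 2 n) := by
  refine le_antisymm (kSeq_le_sqrt hn (by omega)) (le_trans (le_min ?_ le_rfl)
    (min_le_kSeq_succ hn hi))
  rw [h]
  linarith [one_le_sqrt_logb hn]

lemma min_pow_le_kSeq (hn : 2 ≤ n) (i : ℕ) :
    min ((6 / 5 : ℝ) ^ i) √(Real.logb 2 n) ≤ kSeq n (i + 1) := by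
  induction i with
  | zero => simp [kSeq]
  | succ i ih =>
    refine le_trans (le_min ?_ (min_le_right _ _)) (min_le_kSeq_succ hn (by omega))
    have h0 := Real.sqrt_nonneg (Real.logb 2 n)
    rcases min_le_iff.1 ih with h | h
    · refine (min_le_left _ _).trans ?_
      rw [pow_succ]
      linarith
    · refine (min_le_right _ _).trans ?_
      linarith

lemma one_le_tower (k : ℕ) : 1 ≤ tower k := by
  cases k with
  | zero => exact le_rfl
  | succ k => exact Nat.one_le_two_pow

lemma succ_le_tower (k : ℕ) : k + 1 ≤ tower k := by
  induction k with
  | zero => exact le_rfl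
  | succ k ih => exact ih.trans_lt Nat.lt_two_pow_self

lemma le_tower_logStar (n : ℕ) : n ≤ tower (logStar n) :=
  Nat.sInf_mem (s := {k : ℕ | n ≤ tower k}) ⟨n, (Nat.le_succ n).trans (succ_le_tower n)⟩

lemma logStar_le (n : ℕ) : logStar n ≤ Nat.log 2 n + 1 := by
  refine Nat.sInf_le (s := {k : ℕ | n ≤ tower k}) ?_
  change n ≤ 2 ^ tower (Nat.log 2 n)
  exact (Nat.lt_pow_succ_log_self (by norm_num) n).le.trans
    (Nat.pow_le_pow_right (by norm_num) (succ_le_tower _))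

lemma two_le_logStar {n : ℕ} (hn : 3 ≤ n) : 2 ≤ logStar n := by
  by_contra h
  have h1 := le_tower_logStar n
  have : logStar n = 0 ∨ logStar n = 1 := by omega
  rcases this with h | h <;> rw [h] at h1 <;> simp [tower] at h1 <;> omega

/-- From the tenth round on, the numbers of requests grow like a tower function until they reach
their maximum. -/
lemma min_tower_le_kSeq (hn : 2 ≤ n) (i : ℕ) :
    min (5 * tower i : ℝ) √(Real.logb 2 n) ≤ kSeq n (i + 10) := by
  induction i with
  | zero =>
    refine le_trans (min_le_min_right _ ?_) (min_pow_le_kSeq hn 9)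
    norm_num [tower]
  | succ i ih =>
    rw [show i + 1 + 10 = i + 10 + 1 by ring]
    have hL := one_le_sqrt_logb hn
    rcases min_le_iff.1 ih with h | h
    · rw [kSeq_succ (by omega)]
      refine min_le_min_right _ ?_
      have h1 : 5 * tower i ≤ numRequests n (i + 10) := Nat.le_floor (by exact_mod_cast h)
      have h1' : (5 * tower i : ℝ) ≤ numRequests n (i + 10) := by exact_mod_cast h1
      have h2 : (2 : ℝ) ^ tower i ≤ Real.exp ((numRequests n (i + 10) : ℝ) / 5) := by
        calc (2 : ℝ) ^ tower i ≤ Real.exp 1 ^ tower i := by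
              gcongr
              linarith [Real.exp_one_gt_d9]
          _ = Real.exp (tower i) := by rw [← Real.exp_nat_mul, mul_one]
          _ ≤ _ := Real.exp_le_exp.2 (by linarith)
      have h3 : (1 : ℝ) ≤ tower i := by exact_mod_cast one_le_tower i
      have h4 : (5 : ℝ) ≤ kSeq n (i + 10) := by linarith
      simp only [tower, Nat.cast_pow, Nat.cast_ofNat]
      gcongr
    · refine (min_le_right _ _).trans ?_
      rw [kSeq_succ_eq_sqrt hn (by omega) (le_antisymm (kSeq_le_sqrt hn (by omega)) h)]

/-- The first round in which the number of requests has its maximal value. -/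
noncomputable def capRound (n : ℕ) : ℕ := sInf {i : ℕ | 1 ≤ i ∧ kSeq n i = √(Real.logb 2 n)}

lemma kSeq_logStar_eq (hn : 2 ≤ n) : kSeq n (logStar n + 10) = √(Real.logb 2 n) := by
  refine le_antisymm (kSeq_le_sqrt hn (by omega)) (le_trans (le_min ?_ le_rfl)
    (min_tower_le_kSeq hn _))
  have h1 : (n : ℝ) ≤ tower (logStar n) := by exact_mod_cast le_tower_logStar n
  have := sqrt_logb_le (n := n) (by omega)
  have h0 : (0 : ℝ) ≤ n := Nat.cast_nonneg n
  linarith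

lemma capRound_mem (hn : 2 ≤ n) : 1 ≤ capRound n ∧ kSeq n (capRound n) = √(Real.logb 2 n) :=
  Nat.sInf_mem (s := {i : ℕ | 1 ≤ i ∧ kSeq n i = √(Real.logb 2 n)})
    ⟨_, by omega, kSeq_logStar_eq hn⟩

lemma capRound_le (hn : 2 ≤ n) : capRound n ≤ logStar n + 10 :=
  Nat.sInf_le ⟨by omega, kSeq_logStar_eq hn⟩

lemma kSeq_eq_of_capRound_le (hn : 2 ≤ n) {i : ℕ} (hi : capRound n ≤ i) :
    kSeq n i = √(Real.logb 2 n) := by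
  have h := capRound_mem hn
  induction i, hi using Nat.le_induction with
  | base => exact h.2
  | succ i hi ih => exact kSeq_succ_eq_sqrt hn (h.1.trans hi) ih

/-- Before it reaches its maximum, the sequence grows at least geometrically. -/
lemma six_fifths_mul_kSeq_le (hn : 2 ≤ n) {i : ℕ} (hi : 1 ≤ i) (hi' : i + 1 < capRound n) :
    6 / 5 * kSeq n i ≤ kSeq n (i + 1) := by
  have h := min_le_kSeq_succ hn hi
  rcases min_le_iff.1 h with h | h
  · exact h
  · exact absurd (Nat.sInf_le (s := {i : ℕ | 1 ≤ i ∧ kSeq n i = √(Real.logb 2 n)})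
      ⟨by omega, le_antisymm (kSeq_le_sqrt hn (by omega)) h⟩) (not_le.2 hi')

lemma sum_kSeq_le (hn : 2 ≤ n) {m : ℕ} (hm : 1 ≤ m) (hm' : m < capRound n) :
    ∑ i ∈ Finset.Icc 1 m, kSeq n i ≤ 6 * kSeq n m := by
  induction m, hm using Nat.le_induction with
  | base => simp [kSeq]
  | succ m hm ih =>
    rw [Finset.sum_Icc_succ_top (by omega)]
    have := ih (by omega)
    have := six_fifths_mul_kSeq_le hn hm hm'
    linarith

/-- The number of requests of a ball in the rounds up to `capRound n + 2`. -/
lemma sum_kSeq_capRound_le (hn : 2 ≤ n) :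
    ∑ i ∈ Finset.Icc 1 (capRound n + 2), kSeq n i ≤ 9 * √(Real.logb 2 n) := by
  obtain ⟨h1, h2⟩ := capRound_mem hn
  rw [Finset.sum_Icc_succ_top (by omega), Finset.sum_Icc_succ_top (by omega),
    kSeq_eq_of_capRound_le hn (by omega : capRound n ≤ capRound n + 1),
    kSeq_eq_of_capRound_le hn (by omega : capRound n ≤ capRound n + 1 + 1)]
  have h0 := one_le_sqrt_logb hn
  suffices ∑ i ∈ Finset.Icc 1 (capRound n), kSeq n i ≤ 7 * √(Real.logb 2 n) by linarith
  rcases h1.eq_or_lt with h | h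
  · rw [← h]
    simp only [Finset.Icc_self, Finset.sum_singleton, kSeq]
    linarith
  · obtain ⟨m, hm⟩ : ∃ m, capRound n = m + 1 := ⟨capRound n - 1, by omega⟩
    rw [hm, Finset.sum_Icc_succ_top (by omega), ← hm, h2]
    have := sum_kSeq_le hn (by omega : 1 ≤ m) (by omega)
    have := kSeq_le_sqrt hn (by omega : 1 ≤ m)
    linarith

end KSeq

/-! ### Bounds on the numbers of unplaced balls -/

section Occupancy

variable {n : ℕ}

/-- The error in the bounds `occ`: it accounts for a deviation of `n ^ (3 / 4)` balls, each of which
sends at most `√(log n)` requests. -/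
noncomputable def err (n : ℕ) : ℝ := √(Real.logb 2 n) / (n : ℝ) ^ (1 / 4 : ℝ)

/-- A bound on the ratio of `k(i)` times the number of balls in round `i` to `n`. If `x` is this
ratio, then a ball fails in round `i` with probability at most about `x ^ ⌊k(i)⌋`, whereas `k` grows
by the factor `exp (⌊k(i)⌋ / 5)`. The recursion is of use once `exp (1 / 5) * x < 1`, which is
guaranteed from the second round on, since in the first round more than `2 / 5` of the bins are
reached. -/
noncomputable def occ (n : ℕ) : ℕ → ℝ
  | 0 => 1
  | 1 => 1
  | 2 => 37 / 50
  | i + 3 => (Real.exp (1 / 5) * occ n (i + 2)) ^ numRequests n (i + 2) * occ n (i + 2) + err n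

/-- A bound on the number of balls in round `i`. -/
noncomputable def ballBound (n i : ℕ) : ℕ := ⌊n * occ n i / kSeq n i⌋₊

lemma err_nonneg (n : ℕ) : 0 ≤ err n := by unfold err; positivity

lemma occ_succ {i : ℕ} (hi : 2 ≤ i) : occ n (i + 1) =
    (Real.exp (1 / 5) * occ n i) ^ numRequests n i * occ n i + err n := by
  obtain ⟨i, rfl⟩ : ∃ i', i = i' + 2 := ⟨i - 2, by omega⟩
  rfl

lemma occ_nonneg (n : ℕ) (i : ℕ) : 0 ≤ occ n i := by
  have : ∀ i, 0 ≤ occ n (i + 2) := fun i => by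
    induction i with
    | zero => norm_num [occ]
    | succ i ih =>
      rw [show i + 1 + 2 = i + 2 + 1 by ring, occ_succ (by omega)]
      have := err_nonneg n
      positivity
  rcases i with _ | _ | i
  · norm_num [occ]
  · norm_num [occ]
  · exact this i

lemma occ_le (hn : 2 ≤ n) (he : err n ≤ 1 / 2500) (i : ℕ) :
    occ n (i + 2) ≤ 3 / 4 * (19 / 20) ^ i + 25 * err n := by
  have h0 := err_nonneg n
  induction i with
  | zero =>
    norm_num [occ]
    linarith
  | succ i ih =>
    rw [show i + 1 + 2 = i + 2 + 1 by ring, occ_succ (by omega)]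
    have h1 : occ n (i + 2) ≤ 19 / 25 := by
      have : (19 / 20 : ℝ) ^ i ≤ 1 := pow_le_one₀ (by norm_num) (by norm_num)
      linarith
    have h2 := occ_nonneg n (i + 2)
    have h3 : Real.exp (1 / 5) * occ n (i + 2) ≤ 93 / 100 := by
      have := exp_fifth_le
      calc _ ≤ (12215 / 10000 : ℝ) * (19 / 25) := by gcongr
        _ ≤ _ := by norm_num
    have h4 : (Real.exp (1 / 5) * occ n (i + 2)) ^ numRequests n (i + 2) ≤ 93 / 100 := by
      refine le_trans (pow_le_of_le_one (by positivity) (by linarith) ?_) h3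
      have := one_le_numRequests hn (by omega : 1 ≤ i + 2)
      omega
    calc _ ≤ 93 / 100 * occ n (i + 2) + err n := by gcongr
      _ ≤ 93 / 100 * (3 / 4 * (19 / 20) ^ i + 25 * err n) + err n := by gcongr
      _ ≤ _ := by
        have : (0 : ℝ) ≤ (19 / 20) ^ i := by positivity
        rw [pow_succ]
        linarith

lemma occ_le_const (hn : 2 ≤ n) (he : err n ≤ 1 / 2500) {i : ℕ} (hi : 2 ≤ i) :
    occ n i ≤ 19 / 25 := by
  obtain ⟨i, rfl⟩ : ∃ i', i = i' + 2 := ⟨i - 2, by omega⟩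
  have h := occ_le hn he i
  have : (19 / 20 : ℝ) ^ i ≤ 1 := pow_le_one₀ (by norm_num) (by norm_num)
  linarith

lemma exp_mul_occ_le (hn : 2 ≤ n) (he : err n ≤ 1 / 2500) {i : ℕ} (hi : 2 ≤ i) :
    Real.exp (1 / 5) * occ n i ≤ 93 / 100 := by
  have h1 := occ_le_const hn he hi
  have h2 := occ_nonneg n i
  have := exp_fifth_le
  calc _ ≤ (12215 / 10000 : ℝ) * (19 / 25) := by gcongr
    _ ≤ _ := by norm_num

lemma occ_le_one (hn : 2 ≤ n) (he : err n ≤ 1 / 2500) : ∀ i : ℕ, occ n i ≤ 1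
  | 0 => le_rfl
  | 1 => le_rfl
  | i + 2 => (occ_le_const hn he (by omega)).trans (by norm_num)

lemma sum_occ_le (hn : 2 ≤ n) (he : err n ≤ 1 / 2500) (m : ℕ) :
    ∑ i ∈ Finset.Icc 1 (m + 2), occ n i ≤ 16 + 25 * (m + 1) * err n := by
  suffices ∑ i ∈ Finset.Icc 1 (m + 2), occ n i ≤
      16 - 15 * (19 / 20) ^ (m + 1) + 25 * (m + 1) * err n by
    have : (0 : ℝ) ≤ (19 / 20) ^ (m + 1) := by positivity
    linarith
  induction m with
  | zero =>
    have := err_nonneg n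
    rw [Finset.sum_Icc_succ_top (by omega)]
    norm_num [occ]
    linarith
  | succ m ih =>
    rw [show m + 1 + 2 = m + 2 + 1 by ring, Finset.sum_Icc_succ_top (by omega)]
    have h := occ_le hn he (m + 1)
    rw [show m + 1 + 2 = m + 2 + 1 by ring] at h
    push_cast
    rw [pow_succ _ (m + 1)]
    linarith

lemma ballBound_mul_le (hn : 2 ≤ n) {i : ℕ} (hi : 1 ≤ i) :
    (ballBound n i : ℝ) * kSeq n i ≤ n * occ n i := by
  have hk := one_le_kSeq hn hi
  have h := Nat.floor_le (a := n * occ n i / kSeq n i)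
    (by have := occ_nonneg n i; positivity)
  rwa [le_div_iff₀ (by linarith)] at h

lemma ballBound_mul_numRequests_le (hn : 2 ≤ n) {i : ℕ} (hi : 1 ≤ i) :
    (ballBound n i : ℝ) * numRequests n i ≤ n * occ n i :=
  le_trans (by gcongr; exact numRequests_le_kSeq hn hi) (ballBound_mul_le hn hi)

lemma ballBound_mul_numRequests_div_le (hn : 2 ≤ n) {i : ℕ} (hi : 1 ≤ i) :
    (ballBound n i * numRequests n i / n : ℝ) ≤ occ n i := by
  rw [div_le_iff₀ (by positivity), mul_comm (occ n i)]
  exact ballBound_mul_numRequests_le hn hi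

lemma ballBound_mul_numRequests_le_nat (hn : 2 ≤ n) (he : err n ≤ 1 / 2500) {i : ℕ} (hi : 1 ≤ i) :
    ballBound n i * numRequests n i ≤ n := by
  have h := ballBound_mul_numRequests_le hn hi
  have h1 := occ_le_one hn he i
  have : (ballBound n i * numRequests n i : ℝ) ≤ n :=
    h.trans (mul_le_of_le_one_right (by positivity) h1)
  exact_mod_cast this

lemma ballBound_one (n : ℕ) : ballBound n 1 = n := by
  simp [ballBound, occ, kSeq]

/-- The factor `3 / 5` leaves room for the growth of `k`, as `3 / 5 * exp (1 / 5) ≤ 37 / 50`. -/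
lemma le_ballBound_two (hn : 2 ≤ n) {m : ℕ} (hm : (m : ℝ) ≤ 3 / 5 * n) : m ≤ ballBound n 2 := by
  refine Nat.le_floor ?_
  have hk := one_le_kSeq hn (i := 2) (by omega)
  rw [le_div_iff₀ (by linarith)]
  have h2 : kSeq n 2 ≤ 12215 / 10000 := by
    have : kSeq n 2 ≤ kSeq n 1 * Real.exp ((numRequests n 1 : ℝ) / 5) := min_le_left _ _
    rw [numRequests_one, show kSeq n 1 = 1 from rfl, Nat.cast_one, one_mul] at this
    exact this.trans exp_fifth_le
  simp only [occ]
  calc (m : ℝ) * kSeq n 2 ≤ (3 / 5 * n) * (12215 / 10000) := by gcongr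
    _ ≤ n * (37 / 50) := by
      have : (0 : ℝ) ≤ n := by positivity
      linarith

/-- If at most the expected number of balls plus a small error remains unplaced, then the bound on
the number of balls in the next round is satisfied. -/
lemma le_ballBound_succ (hn : 2 ≤ n) {i m : ℕ} (hi : 2 ≤ i)
    (hm : (m : ℝ) ≤ ballBound n i * (ballBound n i * numRequests n i / n : ℝ) ^ numRequests n i +
      (n : ℝ) ^ (3 / 4 : ℝ)) : m ≤ ballBound n (i + 1) := by
  refine Nat.le_floor ?_
  have hk := one_le_kSeq hn (i := i + 1) (by omega)
  have hk' := one_le_kSeq hn (i := i) (by omega)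
  have hn0 : (0 : ℝ) < n := by positivity
  rw [le_div_iff₀ (by linarith), occ_succ hi]
  have h1 : kSeq n (i + 1) ≤ kSeq n i * Real.exp (1 / 5) ^ numRequests n i := by
    rw [← Real.exp_nat_mul, kSeq_succ (by omega)]
    refine (min_le_left _ _).trans_eq ?_
    ring_nf
  have h2 := kSeq_le_sqrt hn (i := i + 1) (by omega)
  have h3 : (n : ℝ) ^ (3 / 4 : ℝ) * √(Real.logb 2 n) = n * err n := by
    have : (n : ℝ) ^ (3 / 4 : ℝ) * (n : ℝ) ^ (1 / 4 : ℝ) = n := by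
      rw [← Real.rpow_add hn0]
      norm_num
    have h4 : (0 : ℝ) < (n : ℝ) ^ (1 / 4 : ℝ) := by positivity
    rw [err, ← mul_div_assoc, eq_div_iff h4.ne', mul_right_comm, this]
  have h5 := ballBound_mul_numRequests_div_le hn (i := i) (by omega)
  have h6 := ballBound_mul_le hn (i := i) (by omega)
  have h7 := occ_nonneg n i
  calc (m : ℝ) * kSeq n (i + 1) ≤ (ballBound n i *
        (ballBound n i * numRequests n i / n : ℝ) ^ numRequests n i +
          (n : ℝ) ^ (3 / 4 : ℝ)) * kSeq n (i + 1) := by gcongr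
    _ = ballBound n i * (ballBound n i * numRequests n i / n : ℝ) ^ numRequests n i *
        kSeq n (i + 1) + (n : ℝ) ^ (3 / 4 : ℝ) * kSeq n (i + 1) := by ring
    _ ≤ ballBound n i * occ n i ^ numRequests n i *
        (kSeq n i * Real.exp (1 / 5) ^ numRequests n i) +
        (n : ℝ) ^ (3 / 4 : ℝ) * √(Real.logb 2 n) := by gcongr
    _ = (Real.exp (1 / 5) * occ n i) ^ numRequests n i * (ballBound n i * kSeq n i) +
        n * err n := by
      rw [h3, mul_pow]
      ring
    _ ≤ (Real.exp (1 / 5) * occ n i) ^ numRequests n i * (n * occ n i) + n * err n := by gcongr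
    _ = _ := by ring

end Occupancy

/-! ### Asymptotics -/

section Asymptotics

/-- The estimates are made in terms of `L = √(log n)`, that is, `n = 2 ^ L ^ 2`. -/
lemma two_rpow_sqrt_logb_sq {n : ℕ} (hn : 1 ≤ n) :
    (2 : ℝ) ^ (√(Real.logb 2 n) ^ 2) = n := by
  have h1 : (1 : ℝ) ≤ n := by exact_mod_cast hn
  rw [Real.sq_sqrt (Real.logb_nonneg (by norm_num) h1),
    Real.rpow_logb (by norm_num) (by norm_num) (by linarith)]

lemma tendsto_sqrt_logb : Tendsto (fun n : ℕ => √(Real.logb 2 n)) atTop atTop :=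
  Real.tendsto_sqrt_atTop.comp
    ((Real.tendsto_logb_atTop (by norm_num)).comp tendsto_natCast_atTop_atTop)

lemma le_two_rpow_sq {L : ℝ} (hL : 30 ≤ L) : L ≤ 2 ^ (L ^ 2 / 20) := by
  rw [Real.rpow_def_of_pos (by norm_num)]
  refine le_trans ?_ (Real.add_one_le_exp _)
  have := Real.log_two_gt_d9
  have h1 : (0.69 : ℝ) * (L ^ 2 / 20) ≤ Real.log 2 * (L ^ 2 / 20) := by
    gcongr
    linarith
  nlinarith

lemma two_rpow_le {x y : ℝ} (h : x ≤ y) : (2 : ℝ) ^ x ≤ 2 ^ y :=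
  Real.rpow_le_rpow_of_exponent_le (by norm_num) h

lemma two_rpow_add_le {x y : ℝ} (h : x + 1 ≤ y) : (2 : ℝ) ^ x + 2 ^ x ≤ 2 ^ y := by
  have : (2 : ℝ) ^ x + 2 ^ x = 2 ^ (x + 1) := by
    rw [Real.rpow_add (by norm_num)]
    norm_num
    ring
  rw [this]
  exact two_rpow_le h

variable {n : ℕ}

lemma err_le (hn : 2 ≤ n) (hL : 30 ≤ √(Real.logb 2 n)) :
    err n ≤ 2 ^ (-(√(Real.logb 2 n) ^ 2 / 5)) := by
  set L := √(Real.logb 2 n) with hLdef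
  have h := two_rpow_sqrt_logb_sq (n := n) (by omega)
  rw [← hLdef] at h
  have h1 : (n : ℝ) ^ (1 / 4 : ℝ) = 2 ^ (L ^ 2 / 4) := by
    rw [← h, ← Real.rpow_mul (by norm_num)]
    ring_nf
  rw [err, ← hLdef, h1, div_le_iff₀ (by positivity), ← Real.rpow_add (by norm_num)]
  refine (le_two_rpow_sq hL).trans (two_rpow_le ?_)
  linarith

lemma mul_err_le (hn : 2 ≤ n) (hL : 200 ≤ √(Real.logb 2 n)) :
    2500 * (√(Real.logb 2 n) ^ 2 + 20) * err n ≤ 1 := by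
  have h := err_le hn (by linarith)
  set L := √(Real.logb 2 n) with hLdef
  have h0 := err_nonneg n
  have h1 : (2500 * (L ^ 2 + 20) : ℝ) ≤ 2 ^ (L ^ 2 / 5) := by
    have h2 := le_two_rpow_sq (L := L) (by linarith)
    have h3 : L ^ 4 ≤ 2 ^ (L ^ 2 / 5) := by
      calc L ^ 4 ≤ ((2 : ℝ) ^ (L ^ 2 / 20)) ^ 4 := by gcongr
        _ = _ := by
          rw [← Real.rpow_natCast, ← Real.rpow_mul (by norm_num)]
          norm_num
          ring_nf
    refine le_trans ?_ h3
    nlinarith [mul_self_nonneg (L ^ 2 - 40000), sq_nonneg L]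
  calc _ ≤ (2 : ℝ) ^ (L ^ 2 / 5) * 2 ^ (-(L ^ 2 / 5)) := by gcongr
    _ = 1 := by
      rw [← Real.rpow_add (by norm_num), add_neg_cancel, Real.rpow_zero]

lemma err_le_const (hn : 2 ≤ n) (hL : 200 ≤ √(Real.logb 2 n)) : err n ≤ 1 / 2500 := by
  have h := mul_err_le hn hL
  have h0 := err_nonneg n
  nlinarith [sq_nonneg (√(Real.logb 2 n))]

lemma natLog_le (hn : 1 ≤ n) : (Nat.log 2 n : ℝ) ≤ √(Real.logb 2 n) ^ 2 := by
  have h1 : (1 : ℝ) ≤ n := by exact_mod_cast hn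
  rw [Real.sq_sqrt (Real.logb_nonneg (by norm_num) h1)]
  exact_mod_cast Real.natLog_le_logb n 2

lemma capRound_add_two_le (hn : 2 ≤ n) :
    (capRound n + 2 : ℝ) ≤ √(Real.logb 2 n) ^ 2 + 13 := by
  have h1 := capRound_le hn
  have h2 := logStar_le n
  have h3 := natLog_le (n := n) (by omega)
  have h4 : (capRound n + 2 : ℝ) ≤ Nat.log 2 n + 13 := by
    exact_mod_cast (by omega : capRound n + 2 ≤ Nat.log 2 n + 13)
  linarith

lemma two_le_capRound (hn : 2 ≤ n) (hL : 200 ≤ √(Real.logb 2 n)) : 2 ≤ capRound n := by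
  have h := capRound_mem hn
  by_contra hlt
  have : capRound n = 1 := by omega
  rw [this] at h
  have h2 := h.2
  simp only [kSeq] at h2
  linarith

lemma capRound_add_two_le_self (hn : 2 ≤ n) (hL : 200 ≤ √(Real.logb 2 n)) :
    capRound n + 2 ≤ n := by
  have h1 := capRound_add_two_le hn
  have h2 := two_rpow_sqrt_logb_sq (n := n) (by omega)
  have h3 := le_two_rpow_sq (L := √(Real.logb 2 n)) (by linarith)
  set L := √(Real.logb 2 n)
  have h4 : L ^ 3 ≤ n := by
    calc L ^ 3 ≤ ((2 : ℝ) ^ (L ^ 2 / 20)) ^ 3 := by gcongr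
      _ = 2 ^ (L ^ 2 / 20 * 3) := by
        rw [← Real.rpow_natCast, ← Real.rpow_mul (by norm_num)]
        norm_num
      _ ≤ 2 ^ (L ^ 2) := two_rpow_le (by nlinarith)
      _ = n := h2
  have h5 : (capRound n + 2 : ℝ) ≤ n := by nlinarith
  exact_mod_cast h5

lemma sum_occ_capRound_le (hn : 2 ≤ n) (hL : 200 ≤ √(Real.logb 2 n)) :
    ∑ i ∈ Finset.Icc 1 (capRound n + 2), occ n i ≤ 17 := by
  have h := sum_occ_le hn (err_le_const hn hL) (capRound n)
  have h1 := mul_err_le hn hL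
  have h2 := capRound_add_two_le hn
  have h0 := err_nonneg n
  have : 25 * (capRound n + 1 : ℝ) * err n ≤
      2500 * (√(Real.logb 2 n) ^ 2 + 20) * err n := by
    gcongr ?_ * _
    nlinarith [sq_nonneg (√(Real.logb 2 n))]
  linarith

lemma le_numRequests_of_capRound_le (hn : 2 ≤ n) {i : ℕ} (hi : capRound n ≤ i) :
    √(Real.logb 2 n) - 1 ≤ numRequests n i := by
  have h := kSeq_lt (n := n) i
  rw [kSeq_eq_of_capRound_le hn hi] at h
  linarith

lemma pow_numRequests_le (hn : 2 ≤ n) {i : ℕ} (hi : capRound n ≤ i) {x a : ℝ} (hx : 0 ≤ x)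
    (ha : a ≤ 0) (hxa : x ≤ 2 ^ a) :
    x ^ numRequests n i ≤ 2 ^ (a * (√(Real.logb 2 n) - 1)) := by
  calc x ^ numRequests n i ≤ ((2 : ℝ) ^ a) ^ numRequests n i := by gcongr
    _ = 2 ^ (a * numRequests n i) := by rw [← Real.rpow_natCast, ← Real.rpow_mul (by norm_num)]
    _ ≤ _ := two_rpow_le (by nlinarith [le_numRequests_of_capRound_le hn hi])

/-- With `L` requests per ball, the fraction of unplaced balls drops from a constant to
`exp (-Ω(L))`. -/
lemma occ_capRound_succ_le (hn : 2 ≤ n) (hL : 200 ≤ √(Real.logb 2 n)) :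
    occ n (capRound n + 1) ≤ 2 ^ (-(√(Real.logb 2 n) / 15)) := by
  have h2 := two_le_capRound hn hL
  have he := err_le_const hn hL
  rw [occ_succ h2]
  have h3 := exp_mul_occ_le hn he h2
  have h4 := occ_nonneg n (capRound n)
  have h5 := occ_le_one hn he (capRound n)
  have h6 : (93 / 100 : ℝ) ≤ 2 ^ (-(1 / 10) : ℝ) := by
    rw [Real.rpow_neg (by norm_num), le_inv_comm₀ (by norm_num) (by positivity)]
    rw [← Real.rpow_le_rpow_iff (z := 10) (by positivity) (by positivity) (by norm_num),
      ← Real.rpow_mul (by norm_num)]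
    norm_num
  have h7 := pow_numRequests_le hn le_rfl (by positivity) (by norm_num) (h3.trans h6)
  have h8 := err_le hn (by linarith)
  set L := √(Real.logb 2 n)
  calc _ ≤ (2 : ℝ) ^ (-(1 / 10) * (L - 1)) * 1 + 2 ^ (-(L ^ 2 / 5)) := by gcongr
    _ ≤ 2 ^ (-(1 / 10) * (L - 1)) + 2 ^ (-(1 / 10) * (L - 1)) := by
      rw [mul_one]
      gcongr
      · norm_num
      · nlinarith
    _ ≤ _ := two_rpow_add_le (by linarith)

/-- In the next round, the fraction of unplaced balls drops from `exp (-Ω(L))` to `exp (-Ω(L ^ 2))`,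
which is a power of `1 / n`. In a third such round, the failure probability of a ball is
`exp (-Ω(L ^ 3))`. -/
lemma occ_capRound_add_two_le (hn : 2 ≤ n) (hL : 200 ≤ √(Real.logb 2 n)) :
    occ n (capRound n + 2) ≤ 2 ^ (-(√(Real.logb 2 n) ^ 2 / 25)) := by
  have h2 := two_le_capRound hn hL
  have he := err_le_const hn hL
  rw [show capRound n + 2 = capRound n + 1 + 1 by ring, occ_succ (by omega)]
  have h3 := occ_capRound_succ_le hn hL
  have h4 := occ_nonneg n (capRound n + 1)
  have h5 := occ_le_one hn he (capRound n + 1)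
  have h8 := err_le hn (by linarith)
  have h6 : Real.exp (1 / 5) ≤ 2 ^ (1 / 3 : ℝ) := by
    refine exp_fifth_le.trans ?_
    rw [← Real.rpow_le_rpow_iff (z := 3) (by positivity) (by positivity) (by norm_num),
      ← Real.rpow_mul (by norm_num)]
    norm_num
  have h7 : Real.exp (1 / 5) * occ n (capRound n + 1) ≤ 2 ^ (1 / 3 - √(Real.logb 2 n) / 15) := by
    rw [sub_eq_add_neg, Real.rpow_add (by norm_num)]
    gcongr
  have h9 := pow_numRequests_le hn (i := capRound n + 1) (by omega) (by positivity)
    (by linarith) h7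
  set L := √(Real.logb 2 n)
  calc _ ≤ (2 : ℝ) ^ ((1 / 3 - L / 15) * (L - 1)) * 1 + 2 ^ (-(L ^ 2 / 5)) := by gcongr
    _ ≤ 2 ^ (-(L ^ 2 / 20)) + 2 ^ (-(L ^ 2 / 20)) := by
      rw [mul_one]
      gcongr
      · norm_num
      · nlinarith
      · norm_num
      · nlinarith
    _ ≤ _ := two_rpow_add_le (by nlinarith)

/-- A bound on the probability that the estimates of the analysis fail, with one summand for each
field of `GoodSlots`. -/
noncomputable def failProb (n : ℕ) : ℝ :=
  2 ^ n * (2 / 5 * n / n : ℝ) ^ n + n * Real.exp (-(((n : ℝ) ^ (3 / 4 : ℝ)) ^ 2 / (8 * n))) +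
    n * occ n (capRound n + 2) ^ numRequests n (capRound n + 2)

lemma failProb_nonneg (n : ℕ) : 0 ≤ failProb n := by
  have := occ_nonneg n (capRound n + 2)
  unfold failProb
  positivity

lemma eventually_le_div_of_tendsto {f : ℕ → ℝ} {c : ℝ}
    (h : Tendsto (fun n : ℕ => (n : ℝ) ^ c * f n) atTop (nhds 0)) {a : ℝ} (ha : 0 < a) :
    ∀ᶠ n : ℕ in atTop, f n ≤ a * (1 / (n : ℝ) ^ c) := by
  filter_upwards [h.eventually_lt_const ha, eventually_ge_atTop 1] with n hn h1
  have : (0 : ℝ) < (n : ℝ) ^ c := by positivity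
  rw [← mul_div_assoc, le_div_iff₀ this]
  linarith

/-- The estimates hold with high probability. -/
lemma eventually_failProb_le (c : ℝ) : ∀ᶠ n : ℕ in atTop, failProb n ≤ 1 / (n : ℝ) ^ c := by
  have h1 : ∀ᶠ n : ℕ in atTop, 2 ^ n * (2 / 5 * n / n : ℝ) ^ n ≤ 1 / 3 * (1 / (n : ℝ) ^ c) := by
    refine eventually_le_div_of_tendsto ?_ (by norm_num)
    have h := (tendsto_rpow_mul_exp_neg_mul_atTop_nhds_zero c (Real.log (5 / 4))
      (Real.log_pos (by norm_num))).comp (tendsto_natCast_atTop_atTop (R := ℝ))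
    refine h.congr' ?_
    filter_upwards [eventually_ge_atTop 1] with n hn
    have h0 : (n : ℝ) ≠ 0 := by positivity
    simp only [Function.comp_apply]
    congr 1
    rw [mul_div_assoc, div_self h0, mul_one, ← mul_pow, neg_mul, mul_comm, Real.exp_neg,
      Real.exp_nat_mul, Real.exp_log (by norm_num), ← inv_pow]
    norm_num
  have h2 : ∀ᶠ n : ℕ in atTop, n * Real.exp (-(((n : ℝ) ^ (3 / 4 : ℝ)) ^ 2 / (8 * n))) ≤
      1 / 3 * (1 / (n : ℝ) ^ c) := by
    refine eventually_le_div_of_tendsto ?_ (by norm_num)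
    have h := (tendsto_rpow_mul_exp_neg_mul_atTop_nhds_zero (2 * (c + 1)) (1 / 8)
      (by norm_num)).comp (Real.tendsto_sqrt_atTop.comp (tendsto_natCast_atTop_atTop (R := ℝ)))
    refine h.congr' ?_
    filter_upwards [eventually_ge_atTop 1] with n hn
    have h0 : (0 : ℝ) < n := by positivity
    simp only [Function.comp_apply]
    rw [← mul_assoc]
    congr 1
    · rw [Real.sqrt_eq_rpow, ← Real.rpow_mul h0.le, ← Real.rpow_add_one h0.ne']
      ring_nf
    · congr 1
      rw [← Real.rpow_natCast, ← Real.rpow_mul h0.le, Real.sqrt_eq_rpow]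
      have : (n : ℝ) ^ (3 / 4 * ((2 : ℕ) : ℝ)) = n ^ (1 / 2 : ℝ) * n := by
        rw [← Real.rpow_add_one h0.ne']
        norm_num
      rw [this]
      field_simp
  have h3 : ∀ᶠ n : ℕ in atTop, n * occ n (capRound n + 2) ^ numRequests n (capRound n + 2) ≤
      1 / 3 * (1 / (n : ℝ) ^ c) := by
    filter_upwards [eventually_ge_atTop 3, tendsto_sqrt_logb.eventually_ge_atTop 200,
      tendsto_sqrt_logb.eventually_ge_atTop (25 * (c + 2) + 1)] with n hn hL hLc
    have h4 := pow_numRequests_le (by omega : 2 ≤ n) (i := capRound n + 2) (by omega)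
      (occ_nonneg n _) (neg_nonpos.2 (by positivity)) (occ_capRound_add_two_le (by omega) hL)
    have h5 := two_rpow_sqrt_logb_sq (n := n) (by omega)
    set L := √(Real.logb 2 n)
    have h3 : (3 : ℝ) ≤ n := by exact_mod_cast hn
    have h0 : (0 : ℝ) < n := by positivity
    have h6 : (2 : ℝ) ^ (-(L ^ 2 / 25) * (L - 1)) ≤ (n : ℝ) ^ (-(c + 2)) := by
      rw [← h5, ← Real.rpow_mul (by norm_num)]
      exact two_rpow_le (by nlinarith [sq_nonneg L])
    calc _ ≤ n * (n : ℝ) ^ (-(c + 2)) := by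
          gcongr
          exact h4.trans h6
      _ = 1 / n * (1 / (n : ℝ) ^ c) := by
        rw [Real.rpow_neg h0.le, show c + 2 = c + 1 + 1 by ring, Real.rpow_add_one h0.ne',
          Real.rpow_add_one h0.ne']
        field_simp
      _ ≤ _ := by gcongr
  filter_upwards [h1, h2, h3] with n h1 h2 h3
  unfold failProb
  linarith

end Asymptotics

/-! ### The typical course of an execution -/

/-- The properties of the rearranged random choices from which all bounds on the course of the
execution follow: the requests of the first round reach at least `2 n / 5` bins, in the following
rounds the numbers of covered blocks are not much larger than expected, and in round
`capRound n + 2` there are no covered blocks. -/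
structure GoodSlots {n : ℕ} (y : Slots n) : Prop where
  first : ∀ (i : Fin (n + 1)) (l : Fin n), (i : ℕ) = 1 → (l : ℕ) = 0 →
    2 / 5 * n < ((Finset.univ.image fun t => y (i, t, l)).card : ℝ)
  middle : ∀ i : Fin (n + 1), 2 ≤ (i : ℕ) → (i : ℕ) ≤ capRound n + 1 →
    (coveredCount i (ballBound n i) (numRequests n i) y : ℝ) ≤
      ballBound n i * (ballBound n i * numRequests n i / n : ℝ) ^ numRequests n i +
        (n : ℝ) ^ (3 / 4 : ℝ)
  last : ∀ i : Fin (n + 1), (i : ℕ) = capRound n + 2 → ∀ t : Fin n,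
    ¬ Covered i (ballBound n i) (numRequests n i) t y

lemma prob_not_goodSlots_le {n : ℕ} [NeZero n] (hn : 2 ≤ n) (hL : 200 ≤ √(Real.logb 2 n)) :
    prob (fun y : Slots n => ¬ GoodSlots y) ≤ failProb n := by
  classical
  have hR := capRound_add_two_le_self hn hL
  have he := err_le_const hn hL
  have hn0 : (0 : ℝ) < n := by positivity
  let i₁ : Fin (n + 1) := ⟨1, by omega⟩
  let l₁ : Fin n := ⟨0, by omega⟩
  let i₂ : Fin (n + 1) := ⟨capRound n + 2, by omega⟩
  let T : Finset (Fin (n + 1)) :=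
    Finset.univ.filter fun i => 2 ≤ (i : ℕ) ∧ (i : ℕ) ≤ capRound n + 1
  have hT : T.card ≤ n := by
    have : T ⊆ Finset.univ.erase 0 := fun i hi => by
      simp only [T, Finset.mem_filter] at hi
      refine Finset.mem_erase.2 ⟨?_, Finset.mem_univ _⟩
      rintro rfl
      simp at hi
    simpa using Finset.card_le_card this
  let p : Fin (n + 1) → Slots n → Prop := fun i y =>
    ballBound n i * (ballBound n i * numRequests n i / n : ℝ) ^ numRequests n i +
      (n : ℝ) ^ (3 / 4 : ℝ) < coveredCount i (ballBound n i) (numRequests n i) y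
  have hsub : ∀ y : Slots n, ¬ GoodSlots y →
      (((Finset.univ.image fun t => y (i₁, t, l₁)).card : ℝ) ≤ 2 / 5 * n ∨ ∃ i ∈ T, p i y) ∨
        ∃ t ∈ (Finset.univ : Finset (Fin n)),
          Covered i₂ (ballBound n (capRound n + 2)) (numRequests n (capRound n + 2)) t y := by
    intro y hy
    by_contra! h
    obtain ⟨⟨h1, h2⟩, h3⟩ := h
    refine hy ⟨fun i l hi hl => ?_, fun i hi hi' => ?_, fun i hi t => ?_⟩
    · obtain rfl : i = i₁ := Fin.ext hi
      obtain rfl : l = l₁ := Fin.ext hl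
      exact h1
    · exact not_lt.1 (h2 i (Finset.mem_filter.2 ⟨Finset.mem_univ _, hi, hi'⟩))
    · obtain rfl : i = i₂ := Fin.ext hi
      exact h3 t (Finset.mem_univ _)
  refine (prob_mono hsub).trans ((prob_or_le _ _).trans ?_)
  refine add_le_add ((prob_or_le _ _).trans (add_le_add ?_ ?_)) ?_
  · exact prob_card_image_le i₁ l₁ (by positivity)
  · refine (prob_exists_mem_le T p).trans ?_
    refine (Finset.sum_le_card_nsmul T _
      (Real.exp (-(((n : ℝ) ^ (3 / 4 : ℝ)) ^ 2 / (8 * n)))) fun i hi => ?_).trans ?_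
    · exact prob_lt_coveredCount_le i (numRequests_le (by omega) i)
        (ballBound_mul_numRequests_le_nat hn he (by have := (Finset.mem_filter.1 hi).2.1; omega))
        (by positivity)
    · rw [nsmul_eq_mul]
      gcongr
  · refine (prob_exists_mem_le _ _).trans ?_
    refine (Finset.sum_le_card_nsmul _ _ _ fun t _ =>
      (prob_covered_le i₂ _ (numRequests_le (by omega) _) t).trans
        (pow_le_pow_left₀ (by positivity)
          (ballBound_mul_numRequests_div_le hn (by omega)) _)).trans_eq ?_
    simp

namespace EntryProcess

variable {n : ℕ} (D : EntryProcess n)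

/-- The execution takes a typical course. All balls have the same priority. -/
def Good (ω : Tape n) : Prop := GoodSlots (D.slots (fun _ => 0) ω)

lemma tapeLaw_not_good_le [NeZero n] (hn : 2 ≤ n) (hL : 200 ≤ √(Real.logb 2 n)) :
    (tapeLaw n).real {ω | ¬ D.Good ω} ≤ failProb n :=
  (tapeLaw_slots D (fun _ => 0) fun y => ¬ GoodSlots y).trans_le (prob_not_goodSlots_le hn hL)

variable {D} {ω : Tape n} {prio : Fin n → ℕ} {i : ℕ}

/-- If all balls of higher priority are active, the active balls are the first ones in the order. -/
lemma rank_lt_card_active {j : Fin n} (hj : D.Active ω i j)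
    (hprio : ∀ j', prio j' < prio j → D.Active ω i j') :
    (D.rank prio ω i j : ℕ) < (D.active ω i).card := by
  simp only [rank]
  refine Finset.card_lt_card ⟨fun j' hj' => ?_, fun hs => ?_⟩
  · simp only [Finset.mem_filter, Finset.mem_univ, true_and, key_lt_key_iff] at hj'
    rw [mem_active]
    rcases hj' with h | ⟨-, h⟩
    · exact hprio j' h
    · have h1 : D.entryTime ω i j' ≤ D.entryTime ω i j := by
        rcases h with h | h
        · exact h.le
        · exact h.1.le
      obtain ⟨t, ht⟩ := hj
      exact ⟨t, D.entryTime_le_iff.1 (h1.trans (D.entryTime_le_iff.2 ht))⟩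
  · have := hs ((D.mem_active ω).2 hj)
    simp at this

/-- A ball that is not placed in round `i` corresponds to a covered block: every bin it contacts is
also contacted by another ball, the one that is permitted. -/
lemma covered_of_active_succ {i : Fin (n + 1)} (hi : 1 ≤ (i : ℕ)) {M : ℕ}
    (hM : (D.active ω i).card ≤ M)
    (hprio : ∀ j j', D.Active ω i j → prio j' < prio j → D.Active ω i j') {j : Fin n}
    (hj : D.Active ω (i + 1) j) :
    Covered i M (numRequests n i) (D.rank prio ω i j) (D.slots prio ω) := by
  intro l hl
  obtain ⟨j', l', h1, h2, h3, h4⟩ := D.collide hi hj hl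
  have hl' : l' < n := h2.trans_le (numRequests_le j.pos i)
  refine ⟨D.rank prio ω i j', ⟨l', hl'⟩, fun h => h4 ?_, ?_, h2, ?_⟩
  · rw [(D.rank_bijective prio ω i).1 h]
    exact hj
  · exact (rank_lt_card_active h1 fun j'' => hprio j' j'' h1).trans_le hM
  · rw [slots_rank, slots_rank]
    exact h3

lemma card_active_succ_le_coveredCount {i : Fin (n + 1)} (hi : 1 ≤ (i : ℕ)) {M : ℕ}
    (hM : (D.active ω i).card ≤ M) :
    (D.active ω (i + 1)).card ≤ coveredCount i M (numRequests n i) (D.slots (fun _ => 0) ω) := by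
  refine Finset.card_le_card_of_injOn (D.rank (fun _ => 0) ω i) (fun j hj => ?_)
    (D.rank_bijective _ ω i).1.injOn
  have hj := (D.mem_active ω).1 hj
  simp only [Finset.coe_filter, Finset.mem_univ, true_and, Set.mem_ofPred_eq]
  exact ⟨(rank_lt_card_active (D.pred hi hj) fun _ h => absurd h (lt_irrefl _)).trans_le hM,
    covered_of_active_succ hi hM (fun _ _ _ h => absurd h (lt_irrefl _)) hj⟩

/-- In the first round, every bin that is reached by a request accommodates a ball. -/
lemma card_active_two_add_le {i : Fin (n + 1)} {l : Fin n} (hi : (i : ℕ) = 1) (hl : (l : ℕ) = 0) :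
    (D.active ω 2).card +
      (Finset.univ.image fun t => D.slots (fun _ => 0) ω (i, t, l)).card ≤ n := by
  classical
  have hex : ∀ b ∈ Finset.univ.image fun t => D.slots (fun _ => 0) ω (i, t, l),
      ∃ j, j ∉ D.active ω 2 ∧ ω (1, j, 0) = b := by
    intro b hb
    obtain ⟨t, -, rfl⟩ := Finset.mem_image.1 hb
    obtain ⟨j, rfl⟩ := (D.rank_bijective (fun _ => 0) ω i).2 t
    rw [slots_rank, hi, hl]
    by_cases hj : D.Active ω 2 j
    · obtain ⟨j', l', -, h2, h3, h4⟩ := D.collide le_rfl hj (numRequests_one n).symm.le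
      rw [numRequests_one] at h2
      obtain rfl : l' = 0 := by omega
      exact ⟨j', fun h => h4 ((D.mem_active ω).1 h), h3⟩
    · exact ⟨j, fun h => hj ((D.mem_active ω).1 h), rfl⟩
  choose! f hf using hex
  have h1 : (Finset.univ.image fun t => D.slots (fun _ => 0) ω (i, t, l)).card ≤
      ((D.active ω 2)ᶜ).card :=
    Finset.card_le_card_of_injOn f (fun b hb => by simpa using (hf b hb).1) fun b hb b' hb' h => by
      rw [← (hf b hb).2, ← (hf b' hb').2, h]
  rw [Finset.card_compl, Fintype.card_fin] at h1
  have h2 := Finset.card_le_univ (D.active ω 2)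
  rw [Fintype.card_fin] at h2
  omega

/-- In a typical execution, `ballBound` bounds the numbers of balls that take part in the rounds. -/
lemma Good.card_active_le (hg : D.Good ω) (hn : 2 ≤ n) (hL : 200 ≤ √(Real.logb 2 n)) (hi : 1 ≤ i)
    (hi' : i ≤ capRound n + 2) : (D.active ω i).card ≤ ballBound n i := by
  have hR := capRound_add_two_le_self hn hL
  induction i, hi using Nat.le_induction with
  | base =>
    rw [ballBound_one]
    simpa using Finset.card_le_univ (D.active ω 1)
  | succ i hi ih =>
    have ih := ih (by omega)
    rcases hi.eq_or_lt with rfl | hi1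
    · refine le_ballBound_two hn ?_
      have h1 := card_active_two_add_le (D := D) (ω := ω) (i := ⟨1, by omega⟩)
        (l := ⟨0, by omega⟩) rfl rfl
      have h2 := hg.first ⟨1, by omega⟩ ⟨0, by omega⟩ rfl rfl
      have h3 : ((D.active ω 2).card : ℝ) + ((Finset.univ.image fun t =>
          D.slots (fun _ => 0) ω (⟨1, by omega⟩, t, ⟨0, by omega⟩)).card : ℝ) ≤ n := by
        exact_mod_cast h1
      linarith
    · refine le_ballBound_succ hn hi1 (le_trans ?_ (hg.middle ⟨i, by omega⟩ hi1 (by simp; omega)))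
      exact_mod_cast card_active_succ_le_coveredCount (i := ⟨i, by omega⟩) hi ih

/-- In a typical execution, all balls are placed by the end of round `capRound n + 2`. -/
lemma Good.le_of_active (hg : D.Good ω) (hn : 2 ≤ n) (hL : 200 ≤ √(Real.logb 2 n)) {j : Fin n}
    (hj : D.Active ω i j) : i ≤ capRound n + 2 := by
  have hR := capRound_add_two_le_self hn hL
  by_contra hi
  have h1 : D.Active ω (capRound n + 2 + 1) j := hj.of_le (by omega) (by omega)
  exact hg.last ⟨capRound n + 2, by omega⟩ rfl _ (covered_of_active_succ
    (i := ⟨capRound n + 2, by omega⟩) (prio := fun _ => 0) (by simp)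
    (hg.card_active_le hn hL (by simp) le_rfl) (fun _ _ _ h => absurd h (lt_irrefl _)) h1)

variable (D)

/-- The probability that a ball is not placed in round `i` although only few balls take part in it:
the ball under consideration gets the first block of the table. -/
lemma tapeLaw_active_succ_and_le [NeZero n] {i : ℕ} (hi : 1 ≤ i) (M : ℕ) (j : Fin n) :
    (tapeLaw n).real {ω | D.Active ω (i + 1) j ∧ (D.active ω i).card ≤ M} ≤
      (M * numRequests n i / n : ℝ) ^ numRequests n i := by
  by_cases hin : i ≤ n
  swap
  · have : {ω | D.Active ω (i + 1) j ∧ (D.active ω i).card ≤ M} = ∅ := by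
      ext ω
      simp only [Set.mem_ofPred_eq, Set.mem_empty_iff_false, iff_false, not_and]
      intro h
      have := h.le
      omega
    rw [this, measureReal_empty]
    positivity
  let prio : Fin n → ℕ := fun j' => if j' = j then 0 else 1
  have hprio : ∀ {j' j''}, prio j'' < prio j' → j'' = j := by
    intro j' j'' h
    by_contra hne
    simp only [prio, if_neg hne] at h
    split_ifs at h <;> omega
  have hrank : ∀ ω, D.rank prio ω i j = ⟨0, j.pos⟩ := by
    intro ω
    simp only [rank, Fin.mk.injEq, Finset.card_eq_zero, Finset.filter_eq_empty_iff,
      Finset.mem_univ, true_imp_iff, key_lt_key_iff]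
    rintro j' (h | ⟨h, h'⟩)
    · simp [prio] at h
    · have : j' = j := by
        by_contra hne
        simp [prio, hne] at h
      subst this
      simp at h'
  refine le_trans ?_ (prob_covered_le (⟨i, by omega⟩ : Fin (n + 1)) M
    (numRequests_le j.pos i) ⟨0, j.pos⟩)
  rw [← tapeLaw_slots D prio]
  refine measureReal_mono fun ω hω => ?_
  have h1 : D.Active ω i j := D.pred hi hω.1
  have := covered_of_active_succ (i := ⟨i, by omega⟩) (prio := prio) hi hω.2
    (fun j' j'' _ h => hprio h ▸ h1) hω.1
  simp only [hrank] at this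
  exact this

/-- The essential part of the bound on the probability that a given ball takes part in round
`i`. -/
noncomputable def activeBound (n : ℕ) : ℕ → ℝ
  | 0 => 0
  | 1 => 1
  | i + 2 => if i ≤ capRound n then occ n (i + 1) ^ numRequests n (i + 1) else 0

lemma tapeLaw_active_le [NeZero n] (hn : 2 ≤ n) (hL : 200 ≤ √(Real.logb 2 n)) (i : ℕ)
    (j : Fin n) : (tapeLaw n).real {ω | D.Active ω i j} ≤ activeBound n i + failProb n := by
  have hf := failProb_nonneg n
  match i with
  | 0 =>
    have : {ω | D.Active ω 0 j} = ∅ := by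
      ext ω
      simp only [Set.mem_ofPred_eq, Set.mem_empty_iff_false, iff_false]
      intro h
      have := h.one_le
      omega
    rw [this, measureReal_empty]
    simpa [activeBound]
  | 1 => exact measureReal_le_one.trans (by simpa [activeBound])
  | i + 2 =>
    have hbad := D.tapeLaw_not_good_le hn hL
    rw [activeBound]
    split_ifs with hi
    · refine (measureReal_mono (s₂ := {ω | D.Active ω (i + 2) j ∧
        (D.active ω (i + 1)).card ≤ ballBound n (i + 1)} ∪ {ω | ¬ D.Good ω}) fun ω hω => ?_).trans
        ((measureReal_union_le _ _).trans (add_le_add ?_ hbad))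
      · by_cases hg : D.Good ω
        · exact Or.inl ⟨hω, hg.card_active_le hn hL (by omega) (by omega)⟩
        · exact Or.inr hg
      · refine (D.tapeLaw_active_succ_and_le (by omega) _ j).trans ?_
        exact pow_le_pow_left₀ (by positivity) (ballBound_mul_numRequests_div_le hn (by omega)) _
    · rw [zero_add]
      refine (measureReal_mono fun ω hω hg => ?_).trans hbad
      have := Good.le_of_active hg hn hL hω
      omega

lemma natCast_mul_pow_le (K : ℕ) : (K : ℝ) * (93 / 100) ^ (K - 1) ≤ 15 := by
  have h1 : (K : ℝ) * (93 / 100) ^ (K - 1) ≤ ∑ i ∈ Finset.range K, (93 / 100 : ℝ) ^ i := by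
    have := Finset.card_nsmul_le_sum (Finset.range K) (fun i => (93 / 100 : ℝ) ^ i)
      ((93 / 100) ^ (K - 1)) fun i hi =>
        pow_le_pow_of_le_one (by norm_num) (by norm_num) (by rw [Finset.mem_range] at hi; omega)
    simpa using this
  refine h1.trans ?_
  rw [geom_sum_eq (by norm_num), div_le_iff_of_neg (by norm_num)]
  have : (0 : ℝ) ≤ (93 / 100) ^ K := by positivity
  linarith

/-- The growth of the number of requests in a round is outweighed by the probability that a ball
remains unplaced in the previous round. -/
lemma numRequests_succ_mul_pow_le (hn : 2 ≤ n) (he : err n ≤ 1 / 2500) {i : ℕ} (hi : 2 ≤ i) :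
    numRequests n (i + 1) * occ n i ^ numRequests n i ≤ 40 * occ n i := by
  have h0 := occ_nonneg n i
  have hK := one_le_numRequests hn (by omega : 1 ≤ i)
  have h1 : (numRequests n (i + 1) : ℝ) ≤ kSeq n i * Real.exp (1 / 5) ^ numRequests n i := by
    refine (numRequests_le_kSeq hn (by omega)).trans ?_
    rw [← Real.exp_nat_mul, kSeq_succ (by omega)]
    refine (min_le_left _ _).trans_eq ?_
    ring_nf
  have h2 : kSeq n i ≤ 2 * numRequests n i := by
    have := kSeq_lt (n := n) i
    have hK' : (1 : ℝ) ≤ numRequests n i := by exact_mod_cast hK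
    linarith
  have h3 := exp_mul_occ_le hn he hi
  have h4 := natCast_mul_pow_le (numRequests n i)
  have h5 := exp_fifth_le
  have h6 : (Real.exp (1 / 5) * occ n i) ^ numRequests n i ≤
      (93 / 100) ^ (numRequests n i - 1) * (12215 / 10000 * occ n i) := by
    obtain ⟨K, hK'⟩ : ∃ K, numRequests n i = K + 1 := ⟨numRequests n i - 1, by omega⟩
    rw [hK', pow_succ, Nat.add_sub_cancel]
    gcongr
  calc _ ≤ kSeq n i * Real.exp (1 / 5) ^ numRequests n i * occ n i ^ numRequests n i := by gcongr
    _ = kSeq n i * (Real.exp (1 / 5) * occ n i) ^ numRequests n i := by rw [mul_pow]; ring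
    _ ≤ (2 * numRequests n i) *
        ((93 / 100) ^ (numRequests n i - 1) * (12215 / 10000 * occ n i)) := by gcongr
    _ = (numRequests n i * (93 / 100 : ℝ) ^ (numRequests n i - 1)) *
        (2 * (12215 / 10000 * occ n i)) := by
      ring
    _ ≤ 15 * (2 * (12215 / 10000 * occ n i)) := by gcongr
    _ ≤ _ := by linarith

/-- The expected number of requests of a ball is bounded. -/
lemma sum_numRequests_mul_activeBound_le (hn : 2 ≤ n) (hL : 200 ≤ √(Real.logb 2 n)) :
    ∑ i : Fin (n + 1), numRequests n i * activeBound n i ≤ 700 := by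
  have he := err_le_const hn hL
  have hR := capRound_add_two_le_self hn hL
  have h2 : ∀ i : ℕ, numRequests n (i + 2) * activeBound n (i + 2) ≤
      if i ≤ capRound n then 40 * occ n (i + 1) else 0 := by
    intro i
    rw [activeBound]
    split_ifs with hi
    · rcases i with _ | i
      -- `occ n 1 = 1` gives no decay, but a ball sends at most two requests in the second round
      · have : (numRequests n 2 : ℝ) ≤ 2 := by
          refine (numRequests_le_kSeq hn (by omega)).trans ?_
          have : kSeq n 2 ≤ kSeq n 1 * Real.exp ((numRequests n 1 : ℝ) / 5) := min_le_left _ _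
          rw [numRequests_one, show kSeq n 1 = 1 from rfl, Nat.cast_one, one_mul] at this
          linarith [exp_fifth_le]
        simp only [zero_add, numRequests_one, occ]
        norm_num
        have h : numRequests n 2 ≤ 2 := by exact_mod_cast this
        omega
      · exact numRequests_succ_mul_pow_le hn he (by omega)
    · simp
  rw [Fin.sum_univ_eq_sum_range fun i => (numRequests n i : ℝ) * activeBound n i]
  obtain ⟨m, rfl⟩ : ∃ m, n = m + 1 := ⟨n - 1, by omega⟩
  rw [Finset.sum_range_succ', Finset.sum_range_succ']
  have h3 : ∑ i ∈ Finset.range m, (numRequests (m + 1) (i + 1 + 1) : ℝ) *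
      activeBound (m + 1) (i + 1 + 1) ≤ 40 * 17 := by
    refine (Finset.sum_le_sum fun i _ => h2 i).trans ?_
    rw [← Finset.sum_filter, ← Finset.mul_sum]
    gcongr
    refine le_trans ?_ (sum_occ_capRound_le hn hL)
    rw [← Finset.sum_image (f := occ (m + 1)) (g := fun i => i + 1)
      (fun a _ b _ h => by simpa using h)]
    refine Finset.sum_le_sum_of_subset_of_nonneg (fun i hi => ?_) fun i _ _ => occ_nonneg _ i
    obtain ⟨i', hi', rfl⟩ := Finset.mem_image.1 hi
    have := (Finset.mem_filter.1 hi').2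
    exact Finset.mem_Icc.2 ⟨by omega, by omega⟩
  have h4 : (numRequests (m + 1) (0 + 1) : ℝ) * activeBound (m + 1) (0 + 1) = 1 := by
    simp [numRequests_one, activeBound]
  have h5 : (numRequests (m + 1) 0 : ℝ) * activeBound (m + 1) 0 = 0 := by simp [activeBound]
  rw [h4, h5]
  linarith

end EntryProcess

/-! ### Counting messages by requests -/

namespace EntryProcess

variable {n : ℕ} (D : EntryProcess n)

open Classical in
/-- The coordinates of the requests that are sent. -/
noncomputable def sentCoords (ω : Tape n) : Finset (Coord n) :=
  {a | D.Active ω a.1 a.2.1 ∧ (a.2.2 : ℕ) < numRequests n a.1}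

@[simp] lemma mem_sentCoords {ω : Tape n} {a : Coord n} :
    a ∈ D.sentCoords ω ↔ D.Active ω a.1 a.2.1 ∧ (a.2.2 : ℕ) < numRequests n a.1 := by
  simp [sentCoords]

lemma card_filter_round_le (ω : Tape n) (i : ℕ) :
    ((D.sentCoords ω).filter fun a => (a.1 : ℕ) = i).card ≤
      (D.active ω i).card * numRequests n i := by
  rw [← Finset.card_range (numRequests n i), ← Finset.card_product]
  refine Finset.card_le_card_of_injOn (fun a => (a.2.1, (a.2.2 : ℕ))) (fun a ha => ?_) ?_
  · simp only [Finset.coe_filter, mem_sentCoords, Set.mem_ofPred_eq] at ha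
    obtain ⟨⟨h1, h2⟩, rfl⟩ := ha
    simpa using ⟨h1, h2⟩
  · rintro ⟨i, j, l⟩ ha ⟨i', j', l'⟩ ha' h
    simp only [Finset.coe_filter, Set.mem_ofPred_eq] at ha ha'
    simp only [Prod.mk.injEq] at h ⊢
    exact ⟨Fin.ext (ha.2.trans ha'.2.symm), h.1, Fin.ext h.2⟩

open Classical in
lemma card_filter_ball_round_le (ω : Tape n) (i : ℕ) (j : Fin n) :
    (((D.sentCoords ω).filter fun a => a.2.1 = j).filter fun a => (a.1 : ℕ) = i).card ≤
      if D.Active ω i j then numRequests n i else 0 := by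
  have h : (((D.sentCoords ω).filter fun a => a.2.1 = j).filter fun a => (a.1 : ℕ) = i).card ≤
      (Finset.range (if D.Active ω i j then numRequests n i else 0)).card := by
    refine Finset.card_le_card_of_injOn (fun a => (a.2.2 : ℕ)) (fun a ha => ?_) ?_
    · simp only [Finset.coe_filter, Finset.mem_filter, mem_sentCoords, Set.mem_ofPred_eq] at ha
      obtain ⟨⟨⟨h1, h2⟩, rfl⟩, rfl⟩ := ha
      simpa [h1] using h2
    · rintro ⟨i, j, l⟩ ha ⟨i', j', l'⟩ ha' h
      simp only [Finset.coe_filter, Finset.mem_filter, Set.mem_ofPred_eq] at ha ha'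
      simp only [Prod.mk.injEq]
      exact ⟨Fin.ext (ha.2.trans ha'.2.symm), ha.1.2.trans ha'.1.2.symm, Fin.ext h⟩
  simpa using h

variable {D} {ω : Tape n}

lemma Good.card_filter_round_le (hg : D.Good ω) (hn : 2 ≤ n) (hL : 200 ≤ √(Real.logb 2 n)) (i : ℕ) :
    ((D.sentCoords ω).filter fun a => (a.1 : ℕ) = i).card ≤ n := by
  refine (D.card_filter_round_le ω i).trans ?_
  rcases (D.active ω i).eq_empty_or_nonempty with h | ⟨j, hj⟩
  · simp [h]
  · rw [mem_active] at hj
    exact (Nat.mul_le_mul_right _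
      (hg.card_active_le hn hL hj.one_le (hg.le_of_active hn hL hj))).trans
      (ballBound_mul_numRequests_le_nat hn (err_le_const hn hL) hj.one_le)

lemma Good.mem_Icc (hg : D.Good ω) (hn : 2 ≤ n) (hL : 200 ≤ √(Real.logb 2 n)) {a : Coord n}
    (ha : a ∈ D.sentCoords ω) : (a.1 : ℕ) ∈ Finset.Icc 1 (capRound n + 2) := by
  have h := (D.mem_sentCoords.1 ha).1
  exact Finset.mem_Icc.2 ⟨h.one_le, hg.le_of_active hn hL h⟩

lemma sum_ballBound_mul_numRequests_le (hn : 2 ≤ n) (hL : 200 ≤ √(Real.logb 2 n)) :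
    ∑ i ∈ Finset.Icc 1 (capRound n + 2), ballBound n i * numRequests n i ≤ 17 * n := by
  have h : (∑ i ∈ Finset.Icc 1 (capRound n + 2), ballBound n i * numRequests n i : ℝ) ≤
      ∑ i ∈ Finset.Icc 1 (capRound n + 2), n * occ n i :=
    Finset.sum_le_sum fun i hi => ballBound_mul_numRequests_le hn (Finset.mem_Icc.1 hi).1
  rw [← Finset.mul_sum] at h
  have h2 := h.trans (mul_le_mul_of_nonneg_left (sum_occ_capRound_le hn hL) (Nat.cast_nonneg n))
  rw [mul_comm] at h2
  exact_mod_cast h2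

lemma Good.card_sentCoords_le (hg : D.Good ω) (hn : 2 ≤ n) (hL : 200 ≤ √(Real.logb 2 n)) :
    (D.sentCoords ω).card ≤ 17 * n := by
  rw [Finset.card_eq_sum_card_fiberwise fun a ha => hg.mem_Icc hn hL ha]
  refine le_trans (Finset.sum_le_sum fun i hi => (D.card_filter_round_le ω i).trans ?_)
    (sum_ballBound_mul_numRequests_le hn hL)
  rw [Finset.mem_Icc] at hi
  exact Nat.mul_le_mul_right _ (hg.card_active_le hn hL hi.1 hi.2)

lemma Good.card_filter_ball_le (hg : D.Good ω) (hn : 2 ≤ n) (hL : 200 ≤ √(Real.logb 2 n))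
    (j : Fin n) :
    (((D.sentCoords ω).filter fun a => a.2.1 = j).card : ℝ) ≤ 9 * √(Real.logb 2 n) := by
  rw [Finset.card_eq_sum_card_fiberwise (t := Finset.Icc 1 (capRound n + 2)) fun a ha =>
    hg.mem_Icc hn hL (Finset.mem_filter.1 ha).1]
  push_cast
  refine le_trans (Finset.sum_le_sum fun i hi => ?_) (sum_kSeq_capRound_le hn)
  refine le_trans ?_ (numRequests_le_kSeq hn (Finset.mem_Icc.1 hi).1)
  have := D.card_filter_ball_round_le ω i j
  exact_mod_cast this.trans (by split_ifs <;> simp)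

/-- The requests of a ball, sorted by the rounds. -/
lemma card_filter_ball_le (j : Fin n) :
    ((D.sentCoords ω).filter fun a => a.2.1 = j).card ≤
      ∑ i : Fin (n + 1), {ω | D.Active ω i j}.indicator (fun _ => numRequests n i) ω := by
  rw [Finset.card_eq_sum_card_fiberwise (t := Finset.univ) (f := fun a : Coord n => a.1) (by simp)]
  refine Finset.sum_le_sum fun i _ => ?_
  have := D.card_filter_ball_round_le ω i j
  classical
  simpa only [Fin.val_inj, Set.indicator_apply, Set.mem_ofPred_eq] using this

/-- The coordinates of those parts of the tables that are used in a typical execution. -/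
noncomputable def frontCoords (n : ℕ) : Finset (Coord n) :=
  {a | (a.1 : ℕ) ∈ Finset.Icc 1 (capRound n + 2) ∧ (a.2.1 : ℕ) < ballBound n a.1 ∧
    (a.2.2 : ℕ) < numRequests n a.1}

lemma card_frontCoords_le (hn : 2 ≤ n) (hL : 200 ≤ √(Real.logb 2 n)) :
    (frontCoords n).card ≤ 17 * n := by
  rw [Finset.card_eq_sum_card_fiberwise (s := frontCoords n) (f := fun a => (a.1 : ℕ))
    (t := Finset.Icc 1 (capRound n + 2)) fun a ha => by
      simp only [frontCoords, Finset.coe_filter, Set.mem_ofPred_eq] at ha; exact ha.2.1]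
  refine le_trans (Finset.sum_le_sum fun i hi => ?_) (sum_ballBound_mul_numRequests_le hn hL)
  rw [← Finset.card_range (ballBound n i), ← Finset.card_range (numRequests n i),
    ← Finset.card_product]
  refine Finset.card_le_card_of_injOn (fun a => ((a.2.1 : ℕ), (a.2.2 : ℕ))) (fun a ha => ?_) ?_
  · simp only [frontCoords, Finset.coe_filter, Finset.mem_filter, Set.mem_ofPred_eq] at ha
    obtain ⟨⟨-, -, h1, h2⟩, rfl⟩ := ha
    simpa using ⟨h1, h2⟩
  · rintro ⟨i, j, l⟩ ha ⟨i', j', l'⟩ ha' h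
    simp only [Finset.coe_filter, Set.mem_ofPred_eq] at ha ha'
    simp only [Prod.mk.injEq] at h ⊢
    exact ⟨Fin.ext (ha.2.trans ha'.2.symm), Fin.ext h.1, Fin.ext h.2⟩

open Classical in
/-- The requests to a bin correspond to entries of the rearranged tables, which are independent of
the choices of the adversary. -/
lemma card_filter_bin_le (hn : 2 ≤ n) (hL : 200 ≤ √(Real.logb 2 n)) (b : Fin n) :
    ((D.sentCoords ω).filter fun a => ω (a.1, a.2.1, a.2.2) = b).card ≤
      (Finset.univ.filter fun a => D.slots (fun _ => 0) ω a = b ∧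
        (D.Good ω → a ∈ frontCoords n)).card := by
  refine Finset.card_le_card_of_injOn (fun a => (a.1, D.rank (fun _ => 0) ω a.1 a.2.1, a.2.2))
    (fun a ha => ?_) ?_
  · simp only [Finset.coe_filter, Set.mem_ofPred_eq] at ha
    simp only [Finset.coe_filter, Finset.mem_univ, true_and, Set.mem_ofPred_eq, slots_rank]
    refine ⟨ha.2, fun hg => ?_⟩
    have h1 := hg.mem_Icc hn hL ha.1
    have h2 := D.mem_sentCoords.1 ha.1
    have h3 := rank_lt_card_active (prio := fun _ => 0) h2.1 fun _ h => absurd h (lt_irrefl _)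
    rw [Finset.mem_Icc] at h1
    simp only [frontCoords, Finset.mem_filter, Finset.mem_univ, true_and, Finset.mem_Icc]
    exact ⟨h1, h3.trans_le (hg.card_active_le hn hL h1.1 h1.2), h2.2⟩
  · rintro ⟨i, j, l⟩ - ⟨i', j', l'⟩ - h
    simp only [Prod.mk.injEq] at h ⊢
    obtain ⟨rfl, h, rfl⟩ := h
    exact ⟨rfl, (D.rank_bijective _ ω i).1 h, rfl⟩

end EntryProcess

/-- The message belongs to a request with the number given by the last component of `a`. -/
def Msg.HasIndex {n : ℕ} : Msg n → Coord n → Prop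
  | .request _ _ l _, a => l = a.2.2
  | .answer _ _ l _ _, a => l = a.2.2
  | .inform _ _ _, _ => True

namespace IsTranscript

variable {n : ℕ} {D : EntryProcess n} {X : Tape n → Set (Msg n)}

/-- Every message belongs to a request. -/
lemma exists_mem_sentCoords (hX : IsTranscript D X) (hn : 2 ≤ n) {ω : Tape n} {m : Msg n}
    (hm : m ∈ X ω) : ∃ a ∈ D.sentCoords ω, a.2.1 = m.ball ∧ (a.1 : ℕ) = m.round ∧
      ω (a.1, a.2.1, a.2.2) = m.bin ∧ m.HasIndex a := by
  have key : ∀ {j i l b}, Msg.request j i l b ∈ X ω → ∃ a ∈ D.sentCoords ω, a.2.1 = j ∧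
      (a.1 : ℕ) = i ∧ ω (a.1, a.2.1, a.2.2) = b ∧ l = a.2.2 := by
    intro j i l b h
    obtain ⟨h1, h2, h3⟩ := hX.request h
    have h4 := h1.le
    have h5 := numRequests_le (n := n) (by omega) i
    exact ⟨(⟨i, by omega⟩, j, ⟨l, by omega⟩), by simpa using ⟨h1, h2⟩, rfl, rfl, h3.symm, rfl⟩
  cases m with
  | request j i l b => exact key hm
  | answer j i l b g => exact key (hX.answer hm)
  | inform j i b =>
    obtain ⟨l, h⟩ := hX.inform hm
    obtain ⟨a, ha, h1, h2, h3, -⟩ := key (hX.answer h)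
    exact ⟨a, ha, h1, h2, h3, trivial⟩

lemma encard_step_le (hX : IsTranscript D X) (hn : 2 ≤ n) (ω : Tape n) (s : ℕ)
    (q : Fin n → ℕ → Fin n → Prop)
    [DecidablePred fun a : Coord n => q a.2.1 a.1 (ω (a.1, a.2.1, a.2.2))] :
    {m ∈ X ω | q m.ball m.round m.bin ∧ m.step = s}.encard ≤
      ((D.sentCoords ω).filter fun a => q a.2.1 a.1 (ω (a.1, a.2.1, a.2.2))).card := by
  -- within a step, different messages belong to different requests
  have h : ∀ m : Msg n, ∃ a : Coord n, m ∈ X ω → a ∈ D.sentCoords ω ∧ a.2.1 = m.ball ∧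
      (a.1 : ℕ) = m.round ∧ ω (a.1, a.2.1, a.2.2) = m.bin ∧ m.HasIndex a := by
    intro m
    by_cases hm : m ∈ X ω
    · obtain ⟨a, ha⟩ := hX.exists_mem_sentCoords hn hm
      exact ⟨a, fun _ => ha⟩
    · have : NeZero n := ⟨by omega⟩
      exact ⟨(0, 0, 0), fun h => absurd h hm⟩
  choose f hf using h
  rw [← Set.encard_coe_eq_coe_finsetCard]
  refine Set.encard_le_encard_of_injOn (f := f) ?_ ?_
  · rintro m ⟨hm, hq, -⟩
    obtain ⟨h1, h2, h3, h4, -⟩ := hf m hm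
    simp only [Finset.coe_filter, Set.mem_ofPred_eq]
    exact ⟨h1, by rwa [h4, h2, h3]⟩
  · rintro m ⟨hm, -, hs⟩ m' ⟨hm', -, hs'⟩ h
    obtain ⟨-, h2, h3, h4, h5⟩ := hf m hm
    obtain ⟨-, h2', h3', h4', h5'⟩ := hf m' hm'
    rw [← h] at h2' h3' h4' h5'
    have e1 := h2.symm.trans h2'
    have e2 := h3.symm.trans h3'
    have e3 := h4.symm.trans h4'
    cases m <;> cases m' <;> simp only [Msg.step] at hs hs' <;>
      first
      | omega
      | skip
    all_goals
      simp only [Msg.ball, Msg.round, Msg.bin] at e1 e2 e3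
      simp only [Msg.HasIndex] at h5 h5'
      try obtain rfl := h5.trans h5'.symm
      subst e1 e2 e3
    · rfl
    · rw [hX.answer_unique hm hm']
    · rfl

lemma count_step_le (hX : IsTranscript D X) (hn : 2 ≤ n) (ω : Tape n) (s : ℕ)
    (q : Fin n → ℕ → Fin n → Prop)
    [DecidablePred fun a : Coord n => q a.2.1 a.1 (ω (a.1, a.2.1, a.2.2))] :
    count {m ∈ X ω | q m.ball m.round m.bin ∧ m.step = s} ≤
      ((D.sentCoords ω).filter fun a => q a.2.1 a.1 (ω (a.1, a.2.1, a.2.2))).card := by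
  have h := ENat.toENNReal_mono (hX.encard_step_le hn ω s q)
  simpa [count] using h

/-- Every request causes at most three messages: itself, the answer, and the notification of the
bin. -/
lemma count_le (hX : IsTranscript D X) (hn : 2 ≤ n) (ω : Tape n)
    (q : Fin n → ℕ → Fin n → Prop)
    [DecidablePred fun a : Coord n => q a.2.1 a.1 (ω (a.1, a.2.1, a.2.2))] :
    count {m ∈ X ω | q m.ball m.round m.bin} ≤
      3 * ((D.sentCoords ω).filter fun a => q a.2.1 a.1 (ω (a.1, a.2.1, a.2.2))).card := by
  have hsub : {m ∈ X ω | q m.ball m.round m.bin} ⊆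
      ({m ∈ X ω | q m.ball m.round m.bin ∧ m.step = 1} ∪
        {m ∈ X ω | q m.ball m.round m.bin ∧ m.step = 2}) ∪
        {m ∈ X ω | q m.ball m.round m.bin ∧ m.step = 3} := by
    rintro m ⟨hm, hq⟩
    cases m
    · exact Or.inl (Or.inl ⟨hm, hq, rfl⟩)
    · exact Or.inl (Or.inr ⟨hm, hq, rfl⟩)
    · exact Or.inr ⟨hm, hq, rfl⟩
  have h := (Set.encard_le_encard hsub).trans ((Set.encard_union_le _ _).trans
    (add_le_add_left (Set.encard_union_le _ _) _))
  have h' := h.trans (add_le_add (add_le_add (hX.encard_step_le hn ω 1 q)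
    (hX.encard_step_le hn ω 2 q)) (hX.encard_step_le hn ω 3 q))
  have h2 := ENat.toENNReal_mono h'
  simp only [ENat.toENNReal_add, ENat.toENNReal_coe] at h2
  refine h2.trans (le_of_eq ?_)
  ring

end IsTranscript

variable {n : ℕ} {D : EntryProcess n} {X : Tape n → Set (Msg n)} {ω : Tape n}

/-! ### Typical executions -/

namespace IsTranscript

lemma active_round (hX : IsTranscript D X) {m : Msg n} (hm : m ∈ X ω) :
    D.Active ω m.round m.ball := by
  cases m with
  | request j i l b => exact (hX.request hm).1
  | answer j i l b g => exact (hX.request (hX.answer hm)).1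
  | inform j i b =>
    obtain ⟨l, h⟩ := hX.inform hm
    exact (hX.request (hX.answer h)).1

lemma round_le (hX : IsTranscript D X) (hg : D.Good ω) (hn : 2 ≤ n)
    (hL : 200 ≤ √(Real.logb 2 n)) {m : Msg n} (hm : m ∈ X ω) : m.round ≤ logStar n + 12 := by
  have h1 := hg.le_of_active hn hL (hX.active_round hm)
  have h2 := capRound_le hn
  omega

lemma numRounds_le (hX : IsTranscript D X) (hg : D.Good ω) (hn : 2 ≤ n)
    (hL : 200 ≤ √(Real.logb 2 n)) : numRounds (X ω) ≤ logStar n + (12 : ℕ) :=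
  iSup₂_le fun m hm => by exact_mod_cast hX.round_le hg hn hL hm

/-- A bin permits at most one request per round, so its load is at most the number of rounds. -/
lemma load_le (hX : IsTranscript D X) (hg : D.Good ω) (hn : 2 ≤ n)
    (hL : 200 ≤ √(Real.logb 2 n)) (b : Fin n) : load (X ω) b ≤ logStar n + (12 : ℕ) := by
  have h : ∀ j : Fin n, ∃ i, (∃ i, Msg.inform j i b ∈ X ω) → Msg.inform j i b ∈ X ω := fun j => by
    by_cases hj : ∃ i, Msg.inform j i b ∈ X ω
    · exact ⟨hj.choose, fun _ => hj.choose_spec⟩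
    · exact ⟨0, fun h => absurd h hj⟩
  choose f hf using h
  have h1 : load (X ω) b ≤ ((Finset.Icc 1 (logStar n + 12) : Finset ℕ) : Set ℕ).encard := by
    refine Set.encard_le_encard_of_injOn (f := f) (fun j hj => ?_) fun j hj j' hj' h => ?_
    · have h1 := hX.round_le hg hn hL (hf j hj)
      have h2 := (hX.active_round (hf j hj)).one_le
      simp only [Msg.round] at h1 h2
      simpa using ⟨h2, h1⟩
    · obtain ⟨l, hl⟩ := hX.inform (hf j hj)
      obtain ⟨l', hl'⟩ := hX.inform (hf j' hj')
      rw [← h] at hl'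
      exact hX.permit_unique hl hl'
  rw [Set.encard_coe_eq_coe_finsetCard] at h1
  simpa using h1

lemma count_round_step_le (hX : IsTranscript D X) (hg : D.Good ω) (hn : 2 ≤ n)
    (hL : 200 ≤ √(Real.logb 2 n)) (i s : ℕ) :
    count {m ∈ X ω | m.round = i ∧ m.step = s} ≤ n :=
  (hX.count_step_le hn ω s fun _ i' _ => i' = i).trans
    (by exact_mod_cast hg.card_filter_round_le hn hL i)

lemma count_total_le (hX : IsTranscript D X) (hg : D.Good ω) (hn : 2 ≤ n)
    (hL : 200 ≤ √(Real.logb 2 n)) : count (X ω) ≤ ENNReal.ofReal (51 * n) := by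
  have h1 := hX.count_le hn ω fun _ _ _ => True
  simp only [and_true, Set.ofPred_mem_eq, Finset.filter_true] at h1
  have h2 : 3 * (D.sentCoords ω).card ≤ 51 * n := by
    have := hg.card_sentCoords_le hn hL
    omega
  refine h1.trans ?_
  rw [show (51 * n : ℝ) = ((51 * n : ℕ) : ℝ) by push_cast; rfl, ENNReal.ofReal_natCast]
  exact_mod_cast h2

lemma count_ballMsgs_le (hX : IsTranscript D X) (hn : 2 ≤ n) (ω : Tape n) (j : Fin n) :
    count (ballMsgs (X ω) j) ≤ 3 * ((D.sentCoords ω).filter fun a => a.2.1 = j).card :=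
  hX.count_le hn ω fun j' _ _ => j' = j

lemma count_ballMsgs_le_sqrt (hX : IsTranscript D X) (hg : D.Good ω) (hn : 2 ≤ n)
    (hL : 200 ≤ √(Real.logb 2 n)) (j : Fin n) :
    count (ballMsgs (X ω) j) ≤ ENNReal.ofReal (27 * √(Real.logb 2 n)) := by
  refine (hX.count_ballMsgs_le hn ω j).trans ?_
  have h := hg.card_filter_ball_le hn hL j
  rw [show (3 : ℝ≥0∞) * ((D.sentCoords ω).filter fun a => a.2.1 = j).card =
    ((3 * ((D.sentCoords ω).filter fun a => a.2.1 = j).card : ℕ) : ℝ≥0∞) by push_cast; rfl,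
    ← ENNReal.ofReal_natCast]
  refine ENNReal.ofReal_le_ofReal ?_
  push_cast
  linarith

lemma counterBits_le (hX : IsTranscript D X) (hg : D.Good ω) (hn : 3 ≤ n)
    (hL : 200 ≤ √(Real.logb 2 n)) (j : Fin n) :
    counterBits (sentByBall (X ω) j) ≤ ENNReal.ofReal (5 * Real.logb 2 (logStar n)) := by
  refine iSup₂_le fun m hm => ?_
  rw [← ENNReal.ofReal_natCast]
  refine ENNReal.ofReal_le_ofReal ?_
  have h1 := hX.round_le hg (by omega) hL hm.1.1
  have h2 := two_le_logStar hn
  have h2' : (2 : ℝ) ≤ logStar n := by exact_mod_cast h2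
  have h3 : 1 ≤ Real.logb 2 (logStar n) := by
    rw [Real.le_logb_iff_rpow_le (by norm_num) (by linarith)]
    simpa using h2'
  rcases hk : Nat.size m.round with _ | k
  · simp only [Nat.cast_zero]
    linarith
  have h4 : 2 ^ k ≤ m.round := Nat.lt_size.1 (by omega)
  -- `log* n + 12 ≤ 8 log* n` as `2 ≤ log* n`
  have h5 : (2 : ℝ) ^ k ≤ 2 ^ 3 * logStar n := by
    have : 2 ^ k ≤ 2 ^ 3 * logStar n := by omega
    exact_mod_cast this
  have h6 : (k : ℝ) ≤ 3 + Real.logb 2 (logStar n) := by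
    have h7 := Real.logb_le_logb_of_le (b := 2) (by norm_num) (by positivity) h5
    rw [Real.logb_mul (by norm_num) (by linarith), Real.logb_pow, Real.logb_pow,
      Real.logb_self_eq_one (by norm_num)] at h7
    push_cast at h7
    linarith
  push_cast
  linarith

end IsTranscript

lemma EntryProcess.one_sub_failProb_le [NeZero n] (D : EntryProcess n) (hn : 2 ≤ n)
    (hL : 200 ≤ √(Real.logb 2 n)) {P : Tape n → Prop} (hP : ∀ ω, D.Good ω → P ω) :
    1 - failProb n ≤ (tapeLaw n).real {ω | P ω} := by
  have h1 := D.tapeLaw_not_good_le hn hL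
  have h2 : MeasurableSet {ω | ¬ D.Good ω} :=
    measurableSet_slots D (fun _ => 0) fun y => ¬ GoodSlots y
  have h3 := probReal_compl_eq_one_sub (μ := tapeLaw n) h2
  have h4 : (tapeLaw n).real {ω | ¬ D.Good ω}ᶜ ≤ (tapeLaw n).real {ω | P ω} :=
    measureReal_mono (fun ω hω => hP ω (by simpa using hω))
  linarith

/-! ### Expectations -/

lemma lintegral_le_ofReal_sum {Ω ι : Type*} [MeasurableSpace Ω] (μ : Measure Ω) [IsFiniteMeasure μ]
    (s : Finset ι) (c : ι → ℕ) {S : ι → Set Ω} (hS : ∀ i ∈ s, MeasurableSet (S i)) {f : Ω → ℝ≥0∞}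
    (a : ℕ) (hf : ∀ ω, f ω ≤ a * (∑ i ∈ s, (S i).indicator (fun _ => c i) ω : ℕ)) :
    ∫⁻ ω, f ω ∂μ ≤ ENNReal.ofReal (a * ∑ i ∈ s, c i * μ.real (S i)) := by
  have h1 : ∀ ω, f ω ≤ a * ∑ i ∈ s, (S i).indicator (fun _ => (c i : ℝ≥0∞)) ω := fun ω => by
    refine (hf ω).trans_eq ?_
    rw [Nat.cast_sum]
    congr 1
    refine Finset.sum_congr rfl fun i _ => ?_
    by_cases h : ω ∈ S i <;> simp [h]
  refine (lintegral_mono h1).trans_eq ?_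
  rw [lintegral_const_mul' _ _ (by simp), lintegral_finsetSum' _ fun i hi =>
    (measurable_const.indicator (hS i hi)).aemeasurable,
    ENNReal.ofReal_mul (by positivity), ENNReal.ofReal_natCast,
    ENNReal.ofReal_sum_of_nonneg fun i _ => by positivity]
  congr 1
  refine Finset.sum_congr rfl fun i hi => ?_
  rw [lintegral_indicator_const (hS i hi), ENNReal.ofReal_mul (by positivity),
    ENNReal.ofReal_natCast, ofReal_measureReal]

/-- The expected number of requests of a ball, including atypical executions, in which a ball still
sends at most `(n + 1) * n` requests. -/
lemma sum_numRequests_mul_tapeLaw_active_le [NeZero n] (D : EntryProcess n) (hn : 2 ≤ n)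
    (hL : 200 ≤ √(Real.logb 2 n)) (hf : failProb n ≤ 1 / (n : ℝ) ^ (3 : ℝ)) (j : Fin n) :
    ∑ i : Fin (n + 1), (numRequests n i : ℝ) * (tapeLaw n).real {ω | D.Active ω i j} ≤ 702 := by
  have h0 : (0 : ℝ) < n := by positivity
  have hn' : (2 : ℝ) ≤ n := by exact_mod_cast hn
  have h1 : ∑ i : Fin (n + 1), (numRequests n i : ℝ) * (tapeLaw n).real {ω | D.Active ω i j} ≤
      ∑ i : Fin (n + 1),
        ((numRequests n i : ℝ) * EntryProcess.activeBound n i + n * failProb n) := by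
    refine Finset.sum_le_sum fun i _ => ?_
    have h2 := mul_le_mul_of_nonneg_left (D.tapeLaw_active_le hn hL i j)
      (Nat.cast_nonneg (numRequests n i))
    have h3 : (numRequests n i : ℝ) * failProb n ≤ n * failProb n :=
      mul_le_mul_of_nonneg_right (by exact_mod_cast numRequests_le (by omega) _) (failProb_nonneg n)
    linarith
  rw [Finset.sum_add_distrib, Finset.sum_const, Finset.card_univ, Fintype.card_fin,
    nsmul_eq_mul] at h1
  have h2 := EntryProcess.sum_numRequests_mul_activeBound_le hn hL
  have h3 : ((n + 1 : ℕ) : ℝ) * (n * failProb n) ≤ 2 := by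
    have : ((n + 1 : ℕ) : ℝ) * (n * failProb n) ≤ (n + 1) * (n * (1 / (n : ℝ) ^ (3 : ℝ))) := by
      push_cast
      gcongr
    refine this.trans ?_
    rw [show (3 : ℝ) = (3 : ℕ) by norm_num, Real.rpow_natCast]
    field_simp
    nlinarith
  linarith

namespace IsTranscript

lemma lintegral_count_ballMsgs_le [NeZero n] (hX : IsTranscript D X) (hn : 2 ≤ n)
    (hL : 200 ≤ √(Real.logb 2 n)) (hf : failProb n ≤ 1 / (n : ℝ) ^ (3 : ℝ)) (j : Fin n) :
    ∫⁻ ω, count (ballMsgs (X ω) j) ∂(tapeLaw n) ≤ ENNReal.ofReal 2106 := by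
  refine (lintegral_le_ofReal_sum (tapeLaw n) Finset.univ (fun i : Fin (n + 1) => numRequests n i)
    (S := fun i => {ω | D.Active ω i j}) (fun i _ => measurableSet_active D i j) 3
    fun ω => ?_).trans (ENNReal.ofReal_le_ofReal ?_)
  · refine (hX.count_ballMsgs_le hn ω j).trans ?_
    have := EntryProcess.card_filter_ball_le (D := D) (ω := ω) j
    push_cast
    gcongr
    exact_mod_cast this
  · have := sum_numRequests_mul_tapeLaw_active_le D hn hL hf j
    push_cast
    linarith

/-- A ball that reaches round `i` sends at least `i` requests. -/
lemma round_le_sum (hX : IsTranscript D X) (hn : 2 ≤ n) {m : Msg n} (hm : m ∈ X ω) :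
    m.round ≤ ∑ i : Fin (n + 1),
      {ω | D.Active ω i m.ball}.indicator (fun _ => numRequests n i) ω := by
  have h := hX.active_round hm
  rw [Fin.sum_univ_eq_sum_range
    (fun i => {ω | D.Active ω i m.ball}.indicator (fun _ => numRequests n i) ω)]
  calc m.round = ∑ _i ∈ Finset.Icc 1 m.round, 1 := by simp
    _ ≤ ∑ i ∈ Finset.Icc 1 m.round,
        {ω | D.Active ω i m.ball}.indicator (fun _ => numRequests n i) ω :=
      Finset.sum_le_sum fun i hi => by
        rw [Finset.mem_Icc] at hi
        rw [Set.indicator_of_mem (by exact h.of_le hi.1 hi.2)]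
        exact one_le_numRequests hn hi.1
    _ ≤ _ := Finset.sum_le_sum_of_subset fun i hi => by
        have := h.le
        rw [Finset.mem_Icc] at hi
        rw [Finset.mem_range]
        omega

lemma lintegral_counterBits_le [NeZero n] (hX : IsTranscript D X) (hn : 2 ≤ n)
    (hL : 200 ≤ √(Real.logb 2 n)) (hf : failProb n ≤ 1 / (n : ℝ) ^ (3 : ℝ)) (j : Fin n) :
    ∫⁻ ω, counterBits (sentByBall (X ω) j) ∂(tapeLaw n) ≤ ENNReal.ofReal 702 := by
  refine (lintegral_le_ofReal_sum (tapeLaw n) Finset.univ (fun i : Fin (n + 1) => numRequests n i)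
    (S := fun i => {ω | D.Active ω i j}) (fun i _ => measurableSet_active D i j) 1
    fun ω => ?_).trans (ENNReal.ofReal_le_ofReal ?_)
  · rw [Nat.cast_one, one_mul]
    refine iSup₂_le fun m hm => ?_
    have h1 : Nat.size m.round ≤ m.round := Nat.size_le.2 Nat.lt_two_pow_self
    have h2 := hX.round_le_sum hn hm.1.1
    rw [hm.1.2] at h2
    exact_mod_cast h1.trans h2
  · have := sum_numRequests_mul_tapeLaw_active_le D hn hL hf j
    push_cast
    linarith

open Classical in
lemma count_binMsgs_le (hX : IsTranscript D X) (hn : 2 ≤ n) (hL : 200 ≤ √(Real.logb 2 n))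
    (ω : Tape n) (b : Fin n) :
    count (binMsgs (X ω) b) ≤ 3 * (Finset.univ.filter fun a => D.slots (fun _ => 0) ω a = b ∧
        (D.Good ω → a ∈ EntryProcess.frontCoords n)).card := by
  refine (hX.count_le hn ω fun _ _ b' => b' = b).trans ?_
  refine mul_le_mul_right ?_ _
  exact_mod_cast EntryProcess.card_filter_bin_le (D := D) hn hL b

lemma lintegral_count_binMsgs_le [NeZero n] (hX : IsTranscript D X) (hn : 2 ≤ n)
    (hL : 200 ≤ √(Real.logb 2 n)) (hf : failProb n ≤ 1 / (n : ℝ) ^ (3 : ℝ)) (b : Fin n) :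
    ∫⁻ ω, count (binMsgs (X ω) b) ∂(tapeLaw n) ≤ ENNReal.ofReal 57 := by
  classical
  have h0 : (0 : ℝ) < n := by positivity
  have hn' : (2 : ℝ) ≤ n := by exact_mod_cast hn
  refine (lintegral_le_ofReal_sum (tapeLaw n) Finset.univ (fun _ : Coord n => 1)
    (S := fun a => {ω | D.slots (fun _ => 0) ω a = b ∧
      (D.Good ω → a ∈ EntryProcess.frontCoords n)})
    (fun a _ => measurableSet_slots D (fun _ => 0) fun y => y a = b ∧
      (GoodSlots y → a ∈ EntryProcess.frontCoords n)) 3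
    fun ω => ?_).trans (ENNReal.ofReal_le_ofReal ?_)
  · refine (hX.count_binMsgs_le hn hL ω b).trans (le_of_eq ?_)
    rw [Finset.card_filter]
    simp only [Set.indicator_apply, Set.mem_ofPred_eq, Nat.cast_ofNat]
  · have h1 : ∀ a : Coord n, (tapeLaw n).real {ω | D.slots (fun _ => 0) ω a = b ∧
        (D.Good ω → a ∈ EntryProcess.frontCoords n)} ≤
        (if a ∈ EntryProcess.frontCoords n then 1 / (n : ℝ) else 0) + failProb n := fun a => by
      have hp := failProb_nonneg n
      split_ifs with ha
      · refine le_trans (measureReal_mono fun ω hω => hω.1) (le_add_of_le_of_nonneg ?_ hp)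
        exact (tapeLaw_slots D (fun _ => 0) fun y => y a = b).trans_le (prob_eq_apply_le a b)
      · rw [zero_add]
        exact le_trans (measureReal_mono fun ω hω hg => ha (hω.2 hg)) (D.tapeLaw_not_good_le hn hL)
    have h2 := Finset.sum_le_sum fun a (_ : a ∈ (Finset.univ : Finset (Coord n))) => h1 a
    rw [Finset.sum_add_distrib, Finset.sum_ite_mem, Finset.univ_inter, Finset.sum_const,
      Finset.sum_const, Finset.card_univ, nsmul_eq_mul, nsmul_eq_mul] at h2
    have h3 : (((EntryProcess.frontCoords n).card : ℕ) : ℝ) * (1 / n) ≤ 17 := by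
      rw [mul_one_div, div_le_iff₀ h0]
      exact_mod_cast EntryProcess.card_frontCoords_le hn hL
    have h4 : (Fintype.card (Coord n) : ℝ) * failProb n ≤ 2 := by
      refine (mul_le_mul_of_nonneg_left hf (Nat.cast_nonneg _)).trans ?_
      rw [show (3 : ℝ) = (3 : ℕ) by norm_num, Real.rpow_natCast]
      simp only [Fintype.card_prod, Fintype.card_fin]
      push_cast
      field_simp
      nlinarith
    simp only [Nat.cast_one, one_mul]
    push_cast
    linarith

end IsTranscript

/-! ### The maximum number of messages of a bin -/

/-- With high probability, no bin is contacted `r` times from the part of the tables that is used,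
where `r` is about `log n / log log n`. -/
lemma eventually_mul_choose_le {c : ℝ} (hc : 0 < c) : ∀ᶠ n : ℕ in atTop, ∀ A : ℕ, A ≤ 17 * n →
    n * ((A.choose ⌈2 * (c + 2) * (Real.logb 2 n / Real.logb 2 (Real.logb 2 n))⌉₊ : ℝ) *
      (1 / n : ℝ) ^ ⌈2 * (c + 2) * (Real.logb 2 n / Real.logb 2 (Real.logb 2 n))⌉₊) ≤
      1 / (n : ℝ) ^ (c + 1) := by
  have hT : Tendsto (fun n : ℕ => Real.logb 2 n) atTop atTop :=
    (Real.tendsto_logb_atTop (by norm_num)).comp tendsto_natCast_atTop_atTop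
  have hT2 : Tendsto (fun n : ℕ => Real.logb 2 (Real.logb 2 n)) atTop atTop :=
    (Real.tendsto_logb_atTop (by norm_num)).comp hT
  have hlog2 : 0 < Real.log 2 := Real.log_pos (by norm_num)
  have hlo := (isLittleO_log_rpow_atTop (r := 1 / 2) (by norm_num)).bound
    (show 0 < Real.log 2 / 47 by positivity)
  filter_upwards [eventually_ge_atTop 2, hT.eventually_ge_atTop 1, hT2.eventually_ge_atTop 1,
    hT.eventually hlo] with n hn h1 h2 h3 A hA
  set ℓ := Real.logb 2 (n : ℝ) with hℓ
  set r := ⌈2 * (c + 2) * (ℓ / Real.logb 2 ℓ)⌉₊ with hr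
  have hn0 : (0 : ℝ) < n := by positivity
  have hlogℓ : Real.logb 2 ℓ = Real.log ℓ / Real.log 2 := rfl
  have hlogn : Real.log n = ℓ * Real.log 2 := by
    rw [hℓ, Real.logb, div_mul_cancel₀ _ hlog2.ne']
  have hlogpos : 0 < Real.log ℓ := by
    rw [hlogℓ, le_div_iff₀ hlog2] at h2
    linarith
  have h4 : 47 * Real.logb 2 ℓ ≤ √ℓ := by
    rw [Real.norm_of_nonneg hlogpos.le, Real.norm_of_nonneg (by positivity),
      ← Real.sqrt_eq_rpow] at h3
    rw [hlogℓ]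
    field_simp at h3 ⊢
    linarith
  have hsq : √ℓ * √ℓ = ℓ := Real.mul_self_sqrt (by linarith)
  have hrx : 2 * (c + 2) * (ℓ / Real.logb 2 ℓ) ≤ r := Nat.le_ceil _
  have h5 : 47 * √ℓ ≤ ℓ / Real.logb 2 ℓ := by
    rw [le_div_iff₀ (by linarith)]
    nlinarith [Real.sqrt_nonneg ℓ]
  have h6 : 47 * √ℓ ≤ r := by
    refine h5.trans (le_trans ?_ hrx)
    have : 0 ≤ ℓ / Real.logb 2 ℓ := by positivity
    nlinarith
  have hs0 : 0 < √ℓ := Real.sqrt_pos.2 (by linarith)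
  have hr0 : (0 : ℝ) < r := by linarith
  -- `17 e < 47`, hence `17 ^ r / r! ≤ (17 e / r) ^ r ≤ √ℓ ^ (-r)`
  have h7 : (A.choose r : ℝ) * (1 / n : ℝ) ^ r ≤ (1 / √ℓ) ^ r := by
    have e1 := Nat.choose_le_pow_div (α := ℝ) r A
    have e2 := Real.pow_div_factorial_le_exp (x := (r : ℝ)) hr0.le r
    have e3 : (A : ℝ) ≤ 17 * n := by exact_mod_cast hA
    have e4 : (0 : ℝ) < r.factorial := by positivity
    have e5 : (r : ℝ) ^ r ≤ Real.exp 1 ^ r * r.factorial := by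
      rw [div_le_iff₀ e4] at e2
      rwa [← Real.exp_nat_mul, mul_one]
    calc (A.choose r : ℝ) * (1 / n : ℝ) ^ r ≤ (17 * n) ^ r / r.factorial * (1 / n : ℝ) ^ r := by
          gcongr
          exact e1.trans (by gcongr)
      _ = 17 ^ r / r.factorial := by
          rw [div_mul_eq_mul_div, ← mul_pow]
          congr 2
          field_simp
      _ ≤ (1 / √ℓ) ^ r := by
          rw [div_pow, one_pow, div_le_div_iff₀ e4 (by positivity), one_mul]
          have e6 : (17 * Real.exp 1 * √ℓ) ^ r ≤ (r : ℝ) ^ r := by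
            gcongr
            have := Real.exp_one_lt_d9
            nlinarith
          have e7 := e6.trans e5
          rw [mul_pow, mul_pow] at e7
          have e8 : (0 : ℝ) < Real.exp 1 ^ r := by positivity
          refine le_of_mul_le_mul_left ?_ e8
          linarith
  have h8 : (1 / √ℓ) ^ r = Real.exp (-(r * (Real.log ℓ / 2))) := by
    rw [← Real.log_sqrt (by linarith), Real.exp_neg, Real.exp_nat_mul, Real.exp_log hs0, div_pow,
      one_pow, one_div]
  have h9 : (c + 2) * Real.log n ≤ r * (Real.log ℓ / 2) := by
    have : 2 * (c + 2) * (ℓ / Real.logb 2 ℓ) * (Real.log ℓ / 2) = (c + 2) * Real.log n := by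
      rw [hlogn, hlogℓ]
      field_simp
    rw [← this]
    gcongr
  calc n * ((A.choose r : ℝ) * (1 / n : ℝ) ^ r)
      ≤ n * Real.exp (-((c + 2) * Real.log n)) := by
        gcongr
        rw [h8] at h7
        exact h7.trans (Real.exp_le_exp.2 (neg_le_neg h9))
    _ = 1 / (n : ℝ) ^ (c + 1) := by
        rw [Real.rpow_def_of_pos hn0, one_div, ← Real.exp_neg]
        conv_lhs => rw [← Real.exp_log hn0]
        rw [Real.log_exp, ← Real.exp_add]
        ring_nf

lemma IsTranscript.one_sub_le_count_binMsgs [NeZero n] (hX : IsTranscript D X) (hn : 2 ≤ n)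
    (hL : 200 ≤ √(Real.logb 2 n)) {x : ℝ} {p : ℝ}
    (hp : n * (((EntryProcess.frontCoords n).card.choose ⌈x⌉₊ : ℝ) * (1 / n : ℝ) ^ ⌈x⌉₊) ≤ p) :
    1 - (failProb n + p) ≤ (tapeLaw n).real
      {ω | ∀ b, count (binMsgs (X ω) b) ≤ ENNReal.ofReal (3 * x)} := by
  classical
  let q : Slots n → Prop := fun y => ¬ GoodSlots y ∨ ∃ b ∈ (Finset.univ : Finset (Fin n)),
    ⌈x⌉₊ ≤ ((EntryProcess.frontCoords n).filter fun a => y a = b).card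
  have h1 : (tapeLaw n).real {ω | q (D.slots (fun _ => 0) ω)} ≤ failProb n + p := by
    rw [tapeLaw_slots]
    refine (prob_or_le _ _).trans (add_le_add (prob_not_goodSlots_le hn hL) ?_)
    refine (prob_exists_mem_le _ _).trans (le_trans (Finset.sum_le_sum fun b _ =>
      prob_le_card_filter_eq_le _ b _) ?_)
    simpa using hp
  have h2 := probReal_compl_eq_one_sub (μ := tapeLaw n) (measurableSet_slots D (fun _ => 0) q)
  refine (sub_le_sub_left h1 1).trans (h2.symm.trans_le (measureReal_mono fun ω hω b => ?_))
  simp only [q, Set.mem_compl_iff, Set.mem_ofPred_eq, not_or, not_not, not_exists, not_and,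
    not_le, Finset.mem_univ, true_imp_iff] at hω
  refine (hX.count_binMsgs_le hn hL ω b).trans ?_
  have h3 : (Finset.univ.filter fun a => D.slots (fun _ => 0) ω a = b ∧
      (D.Good ω → a ∈ EntryProcess.frontCoords n)).card < ⌈x⌉₊ := by
    refine lt_of_le_of_lt (Finset.card_le_card fun a ha => ?_) (hω.2 b)
    simp only [Finset.mem_filter, Finset.mem_univ, true_and] at ha ⊢
    exact ⟨ha.2 hω.1, ha.1⟩
  have h4 := Nat.lt_ceil.1 h3
  rw [ENNReal.ofReal_mul (by norm_num), ENNReal.ofReal_ofNat]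
  refine mul_le_mul_right ?_ _
  rw [← ENNReal.ofReal_natCast]
  exact ENNReal.ofReal_le_ofReal h4.le

end BallsIntoBins

open BallsIntoBins in
theorem mainTheorem2
    (E : (n : ℕ) → Set (Tape n → Set (Msg n)))
    (hE : E = syncExecutions ∨ E = asyncExecutions) :
    -- every ball is eventually placed into exactly one bin
    (∀ n, ∀ X ∈ E n, ∀ ω, ∀ j, ∃! b, ∃ i, Msg.inform j i b ∈ X ω) ∧
    -- number of rounds
    (∀ c : ℝ, 0 < c → ∃ C : ℕ, ∀ᶠ n : ℕ in atTop, ∀ X ∈ E n,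
      1 - 1 / (n : ℝ) ^ c ≤ (tapeLaw n).real {ω | numRounds (X ω) ≤ logStar n + C}) ∧
    -- maximum bin load
    (∀ c : ℝ, 0 < c → ∃ C : ℕ, ∀ᶠ n : ℕ in atTop, ∀ X ∈ E n,
      1 - 1 / (n : ℝ) ^ c ≤ (tapeLaw n).real {ω | ∀ b, load (X ω) b ≤ logStar n + C}) ∧
    -- messages per round, in each of the three steps of the round
    (∀ c : ℝ, 0 < c → ∀ᶠ n : ℕ in atTop, ∀ X ∈ E n,
      1 - 1 / (n : ℝ) ^ c ≤
        (tapeLaw n).real {ω | ∀ i s, count {m ∈ X ω | m.round = i ∧ m.step = s} ≤ n}) ∧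
    -- messages in total
    (∀ c : ℝ, 0 < c → ∃ C : ℝ, ∀ᶠ n : ℕ in atTop, ∀ X ∈ E n,
      1 - 1 / (n : ℝ) ^ c ≤ (tapeLaw n).real {ω | count (X ω) ≤ ENNReal.ofReal (C * n)}) ∧
    -- messages sent and received by each ball, in expectation and with high probability
    (∃ C : ℝ, ∀ᶠ n : ℕ in atTop, ∀ X ∈ E n, ∀ j,
      ∫⁻ ω, count (ballMsgs (X ω) j) ∂(tapeLaw n) ≤ ENNReal.ofReal C) ∧
    (∀ c : ℝ, 0 < c → ∃ C : ℝ, ∀ᶠ n : ℕ in atTop, ∀ X ∈ E n,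
      1 - 1 / (n : ℝ) ^ c ≤ (tapeLaw n).real
        {ω | ∀ j, count (ballMsgs (X ω) j) ≤ ENNReal.ofReal (C * √(Real.logb 2 n))}) ∧
    -- messages sent and received by each bin, in expectation and with high probability
    (∃ C : ℝ, ∀ᶠ n : ℕ in atTop, ∀ X ∈ E n, ∀ b,
      ∫⁻ ω, count (binMsgs (X ω) b) ∂(tapeLaw n) ≤ ENNReal.ofReal C) ∧
    (∀ c : ℝ, 0 < c → ∃ C : ℝ, ∀ᶠ n : ℕ in atTop, ∀ X ∈ E n,
      1 - 1 / (n : ℝ) ^ c ≤ (tapeLaw n).real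
        {ω | ∀ b, count (binMsgs (X ω) b) ≤
          ENNReal.ofReal (C * (Real.logb 2 n / Real.logb 2 (Real.logb 2 n)))}) ∧
    -- size of the round counters in the messages of each ball, in expectation and with high
    -- probability
    (∃ C : ℝ, ∀ᶠ n : ℕ in atTop, ∀ X ∈ E n, ∀ j,
      ∫⁻ ω, counterBits (sentByBall (X ω) j) ∂(tapeLaw n) ≤ ENNReal.ofReal C) ∧
    (∀ c : ℝ, 0 < c → ∃ C : ℝ, ∀ᶠ n : ℕ in atTop, ∀ X ∈ E n,
      1 - 1 / (n : ℝ) ^ c ≤ (tapeLaw n).real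
        {ω | ∀ j, counterBits (sentByBall (X ω) j) ≤
          ENNReal.ofReal (C * Real.logb 2 (logStar n))}) := by
  have hT : ∀ n, ∀ X ∈ E n, (∃ D, IsTranscript D X) ∧ ∀ ω j, ∃ i b, Msg.inform j i b ∈ X ω := by
    rintro n X hX
    refine exists_isTranscript ?_
    rcases hE with rfl | rfl
    · exact Or.inl hX
    · exact Or.inr hX
  have hev : ∀ c : ℝ, ∀ᶠ n : ℕ in atTop, 3 ≤ n ∧ 200 ≤ √(Real.logb 2 n) ∧
      failProb n ≤ 1 / (n : ℝ) ^ c := fun c =>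
    (eventually_ge_atTop 3).and ((tendsto_sqrt_logb.eventually_ge_atTop 200).and
      (eventually_failProb_le c))
  have whp : ∀ c : ℝ, ∀ P : (n : ℕ) → Set (Msg n) → Prop,
      (∀ (n : ℕ) (D : EntryProcess n) (X : Tape n → Set (Msg n)), IsTranscript D X → 3 ≤ n →
        200 ≤ √(Real.logb 2 n) → ∀ ω, D.Good ω → P n (X ω)) →
      ∀ᶠ n : ℕ in atTop, ∀ X ∈ E n,
        1 - 1 / (n : ℝ) ^ c ≤ (tapeLaw n).real {ω | P n (X ω)} := by
    intro c P hP
    filter_upwards [hev c] with n hn X hX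
    have : NeZero n := ⟨by omega⟩
    obtain ⟨D, hD⟩ := (hT n X hX).1
    exact (sub_le_sub_left hn.2.2 1).trans (D.one_sub_failProb_le (by omega) hn.2.1
      (P := fun ω => P n (X ω)) (hP n D X hD hn.1 hn.2.1))
  refine ⟨fun n X hX ω j => ?_, fun c _ => ⟨12, whp c (fun n M => numRounds M ≤ logStar n + (12 : ℕ))
      fun n D X hX hn hL ω hg => hX.numRounds_le hg (by omega) hL⟩,
    fun c _ => ⟨12, whp c (fun n M => ∀ b, load M b ≤ logStar n + (12 : ℕ))
      fun n D X hX hn hL ω hg => hX.load_le hg (by omega) hL⟩,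
    fun c _ => whp c (fun n M => ∀ i s, count {m ∈ M | m.round = i ∧ m.step = s} ≤ n)
      fun n D X hX hn hL ω hg => hX.count_round_step_le hg (by omega) hL,
    fun c _ => ⟨51, whp c (fun n M => count M ≤ ENNReal.ofReal (51 * n))
      fun n D X hX hn hL ω hg => hX.count_total_le hg (by omega) hL⟩,
    ⟨2106, ?_⟩,
    fun c _ => ⟨27, whp c (fun n M => ∀ j, count (ballMsgs M j) ≤
        ENNReal.ofReal (27 * √(Real.logb 2 n)))
      fun n D X hX hn hL ω hg => hX.count_ballMsgs_le_sqrt hg (by omega) hL⟩,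
    ⟨57, ?_⟩, fun c hc => ⟨3 * (2 * (c + 2)), ?_⟩, ⟨702, ?_⟩,
    fun c _ => ⟨5, whp c (fun n M => ∀ j, counterBits (sentByBall M j) ≤
        ENNReal.ofReal (5 * Real.logb 2 (logStar n)))
      fun n D X hX hn hL ω hg => hX.counterBits_le hg hn hL⟩⟩
  · obtain ⟨⟨D, hD⟩, h⟩ := hT n X hX
    obtain ⟨i, b, hb⟩ := h ω j
    exact ⟨b, ⟨i, hb⟩, fun b' ⟨i', hb'⟩ => (hD.inform_unique hb' hb).2⟩
  · filter_upwards [hev 3] with n hn X hX j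
    have : NeZero n := ⟨by omega⟩
    obtain ⟨D, hD⟩ := (hT n X hX).1
    exact hD.lintegral_count_ballMsgs_le (by omega) hn.2.1 hn.2.2 j
  · filter_upwards [hev 3] with n hn X hX b
    have : NeZero n := ⟨by omega⟩
    obtain ⟨D, hD⟩ := (hT n X hX).1
    exact hD.lintegral_count_binMsgs_le (by omega) hn.2.1 hn.2.2 b
  · filter_upwards [hev (c + 1), eventually_mul_choose_le hc] with n hn hr X hX
    have : NeZero n := ⟨by omega⟩
    obtain ⟨D, hD⟩ := (hT n X hX).1
    have h := hD.one_sub_le_count_binMsgs (by omega) hn.2.1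
      (hr _ (EntryProcess.card_frontCoords_le (by omega) hn.2.1))
    simp only [mul_assoc (3 : ℝ)]
    refine le_trans ?_ h
    have h1 : (0 : ℝ) < n := Nat.cast_pos.2 (by omega)
    have h2 : 2 * (1 / (n : ℝ) ^ (c + 1)) ≤ 1 / (n : ℝ) ^ c := by
      rw [Real.rpow_add h1, Real.rpow_one, mul_one_div, div_le_div_iff₀ (by positivity)
        (by positivity)]
      have h3 : (2 : ℝ) ≤ n := by exact_mod_cast (by omega : 2 ≤ n)
      have h4 : (0 : ℝ) < (n : ℝ) ^ c := by positivity
      nlinarith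
    linarith [hn.2.2]
  · filter_upwards [hev 3] with n hn X hX j
    have : NeZero n := ⟨by omega⟩
    obtain ⟨D, hD⟩ := (hT n X hX).1
    exact hD.lintegral_counterBits_le (by omega) hn.2.1 hn.2.2 j
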